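/- Let $d\ge 1$ and let $\Omega$ be the space of simple, locally finite point configurations $\eta$ in $\mathbb R^d$ (identified with their supports), with the $\sigma$-algebra generated by the counts $N_\Lambda(\eta)=|\eta\cap\Lambda|$, $\Lambda\subset\mathbb R^d$ bounded Borel. Write $\eta_\Lambda=\eta\cap\Lambda$ and, for a probability measure $\mu$ on $\Omega$, let $\mu_\Lambda$ be the law of $\eta_\Lambda$ under $\mu$. Let $\pi_\Lambda$ be the Poisson point process of intensity $1$ in $\Lambda$, and $\Lambda_n=[-n/2,n/2)^d$. **Interaction.** Let $H$ be a measurable real-valued function on the finite subsets of $\mathbb R^d$ such that $H_\Lambda(\eta)=\lim_{n}\big(H(\eta_{\Lambda_n})-H(\eta_{\Lambda_n\setminus\Lambda})\big)$ exists in $\mathbb R$ for all bounded Borel $\Lambda$ and all $\eta\in\Omega$. Put $h(x,\eta)=\lim_{n}\big(H(\eta_{\Lambda_n}\cup\{x\})-H(\eta_{\Lambda_n})\big)$ and $b(x,\eta)=e^{-h(x,\eta)}$. Assume that (i) for each $n$, $H(\{x_1,\dots,x_n\})$ is continuous in $(x_1,\dots,x_n)$ on the set of $n$-tuples of distinct points;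 (ii) $h$ is bounded; (iii) there is $R>0$ with $H_\Lambda(\eta)=H_\Lambda(\eta_{\{x:\,\mathrm{dist}(x,\Lambda)\le R\}})$ for all bounded Borel $\Lambda$ and all $\eta$. **Gibbs measure.** Let $\nu$ be a translation-invariant probability measure on $\Omega$ that satisfies the DLR equations: for all bounded Borel $\Lambda$ and measurable $f\ge 0$, $$\int f\,d\nu=\int\nu(d\omega)\,\frac{1}{Z_\Lambda(\omega)}\int\pi_\Lambda(d\eta)\,e^{-H_\Lambda(\eta_\Lambda\omega_{\Lambda^c})}f(\eta_\Lambda\omega_{\Lambda^c}),\qquad Z_\Lambda(\omega)=\int e^{-H_\Lambda(\eta_\Lambda\omega_{\Lambda^c})}\,\pi_\Lambda(d\eta).$$ **Dynamics.** Let $$(\mathscr L f)(\eta)=\int_{\mathbb R^d}b(x,\eta)\big(f(\eta\cup\{x\})-f(\eta)\big)\,dx+\sum_{x\in\eta}\big(f(\eta\setminus\{x\})-f(\eta)\big),$$ and let $(T_t)_{t\ge0}$ be the transition semigroup of the associated birth-and-death process: for each $\omega\in\Omega$, $T_t(\omega,\cdot)$ is the law at time $t$ of a process $X^{(\omega)}$,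 càdlàg for the vague topology on $\Omega$, with $X^{(\omega)}_0=\omega$, that solves the martingale problem for $\mathscr L$ on the bounded, local, measurable functions. Write $\mu T_t=\int\mu(d\omega)\,T_t(\omega,\cdot)$. **Entropy.** Let $I_\Lambda(\mu|\nu)=\int\log\frac{d\mu_\Lambda}{d\nu_\Lambda}\,d\mu_\Lambda$ if $\mu_\Lambda\ll\nu_\Lambda$, and $I_\Lambda(\mu|\nu)=\infty$ otherwise. **Claim.** Let $\mu$ be a regular probability measure on $\Omega$: it is translation invariant and for each bounded Borel $\Lambda$ the density $d\mu_\Lambda/d\pi_\Lambda$ exists and there are $c,z\in(0,\infty)$, which may depend on $\Lambda$, with $c^{-1}z^{-N_\Lambda}\le d\mu_\Lambda/d\pi_\Lambda\le c\,z^{N_\Lambda}$ $\pi_\Lambda$-a.e. Then, for each bounded Borel $\Lambda\subset\mathbb R^d$: $\mu_\Lambda$ and $\nu_\Lambda$ are mutually absolutely continuous; $\mathscr L\log\frac{d\mu_\Lambda}{d\nu_\Lambda}$ (the generator applied to $\eta\mapsto\log\frac{d\mu_\Lambda}{d\nu_\Lambda}(\eta_\Lambda)$) is well defined $\mu$-a.e.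 and $\mu$-integrable; $I_\Lambda(\mu T_t|\nu)$ is finite for all sufficiently small $t\ge0$; and $t\mapsto I_\Lambda(\mu T_t|\nu)$ is (right-)differentiable at $t=0$ with $$\frac{d}{dt}\Big|_{t=0}I_\Lambda(\mu T_t|\nu)=\mu\Big[\mathscr L\log\frac{d\mu_\Lambda}{d\nu_\Lambda}\Big].$$ -/

import Mathlib

open MeasureTheory ProbabilityTheory Filter Topology
open scoped NNReal ENNReal

namespace BirthDeath

/-- The positional space `ℝ^d` with its Euclidean norm, Borel σ-algebra and Lebesgue measure. -/
abbrev E (d : ℕ) : Type := EuclideanSpace ℝ (Fin d)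

/-- The space `Ω` of simple, locally finite point configurations in `ℝ^d`; a configuration is
identified with its support. -/
@[ext]
structure Config (d : ℕ) where
  carrier : Set (E d)
  finite_inter : ∀ B : Set (E d), Bornology.IsBounded B → (carrier ∩ B).Finite

variable {d : ℕ}

namespace Config

/-- The number of points `N_Λ(η) = |η ∩ Λ|`. -/
noncomputable def count (Λ : Set (E d)) (η : Config d) : ℕ := (η.carrier ∩ Λ).ncard

/-- The σ-algebra generated by the counting variables `N_Λ`, `Λ` bounded Borel. -/
noncomputable instance instMeasurableSpace : MeasurableSpace (Config d) :=
  ⨆ (Λ : Set (E d)) (_ : Bornology.IsBounded Λ) (_ : MeasurableSet Λ),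
    MeasurableSpace.comap (count Λ) ⊤

/-- The vague topology: the coarsest one for which `η ↦ ∑_{x ∈ η} φ x` is continuous for each
continuous compactly supported `φ : ℝ^d → ℝ`. -/
noncomputable instance instTopologicalSpace : TopologicalSpace (Config d) :=
  ⨅ φ : CompactlySupportedContinuousMap (E d) ℝ,
    TopologicalSpace.induced (fun η : Config d => ∑' x : η.carrier, φ x.1) inferInstance

/-- The restriction `η_Λ = η ∩ Λ`. -/
def restrict (Λ : Set (E d)) (η : Config d) : Config d where
  carrier := η.carrier ∩ Λ
  finite_inter B hB := (η.finite_inter B hB).subset fun _ h => ⟨h.1.1, h.2⟩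

/-- The configuration `η + δ_x`. -/
def add (η : Config d) (x : E d) : Config d where
  carrier := insert x η.carrier
  finite_inter B hB := ((η.finite_inter B hB).insert x).subset fun _ h =>
    h.1.elim (fun e => Or.inl e) (fun e => Or.inr ⟨e, h.2⟩)

/-- The configuration `η - δ_x`. -/
def remove (η : Config d) (x : E d) : Config d where
  carrier := η.carrier \ {x}
  finite_inter B hB := (η.finite_inter B hB).subset fun _ h => ⟨h.1.1, h.2⟩

/-- The configuration `η_Λ ω_{Λᶜ}`, equal to `η` inside `Λ` and to `ω` outside. -/
def glue (Λ : Set (E d)) (η ω : Config d) : Config d where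
  carrier := (η.carrier ∩ Λ) ∪ (ω.carrier \ Λ)
  finite_inter B hB := ((η.finite_inter B hB).union (ω.finite_inter B hB)).subset fun _ h =>
    h.1.elim (fun e => Or.inl ⟨e.1, h.2⟩) (fun e => Or.inr ⟨e.1, h.2⟩)

/-- The translation `θ_x`, which moves each point `y` to `y - x`. -/
def translate (x : E d) (η : Config d) : Config d where
  carrier := {y | y + x ∈ η.carrier}
  finite_inter B hB := by
    obtain ⟨r, hr⟩ := hB.subset_closedBall (0 : E d)
    refine ((η.finite_inter (Metric.closedBall x r) Metric.isBounded_closedBall).image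
      (fun y => y - x)).subset ?_
    rintro y ⟨hy, hyB⟩
    refine ⟨y + x, ⟨hy, ?_⟩, by simp⟩
    have := hr hyB
    simpa [dist_eq_norm] using this

/-- A finite set of points, as a configuration. -/
def ofFinite (s : Set (E d)) (hs : s.Finite) : Config d where
  carrier := s
  finite_inter _ _ := hs.subset Set.inter_subset_left

/-- The finitely many points of `η` in a bounded set. -/
noncomputable def points (η : Config d) {B : Set (E d)} (hB : Bornology.IsBounded B) :
    Finset (E d) :=
  (η.finite_inter B hB).toFinset

end Config

/-- The marginal `μ_Λ`, i.e. the law of `η_Λ` under `μ`. -/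
noncomputable def marginal (μ : Measure (Config d)) (Λ : Set (E d)) : Measure (Config d) :=
  μ.map (Config.restrict Λ)

/-- The Poisson point process `π_Λ` of intensity `1` in a bounded Borel set `Λ`:
`e^{-|Λ|} ∑_n (1 / n!) ∫_{Λ^n} 1{ {x_1, …, x_n} ∈ · } dx_1 ⋯ dx_n`. -/
noncomputable def poisson (Λ : Set (E d)) : Measure (Config d) :=
  ENNReal.ofReal (Real.exp (-(volume Λ).toReal)) •
    Measure.sum fun n : ℕ => ((n.factorial : ℝ≥0∞)⁻¹) •
      (Measure.pi fun _ : Fin n => (volume : Measure (E d)).restrict Λ).map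
        (fun x => Config.ofFinite (Set.range x) (Set.finite_range x))

/-- Translation invariance of a point process. -/
def IsTranslationInvariant (μ : Measure (Config d)) : Prop :=
  ∀ x : E d, μ.map (Config.translate x) = μ

/-- Regular measures: translation invariant, and for each bounded Borel `Λ` the density
`dμ_Λ/dπ_Λ` exists and lies between `c⁻¹ z^{-N_Λ}` and `c z^{N_Λ}` for some `c, z ∈ (0, ∞)`
that may depend on `Λ`. -/
def IsRegular (μ : Measure (Config d)) : Prop :=
  IsTranslationInvariant μ ∧
  ∀ Λ : Set (E d), Bornology.IsBounded Λ → MeasurableSet Λ →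
    marginal μ Λ ≪ poisson Λ ∧
    ∃ z c : ℝ, 0 < z ∧ 0 < c ∧ ∀ᵐ η ∂(poisson Λ),
      ENNReal.ofReal (c⁻¹ * (z ^ Config.count Λ η)⁻¹) ≤ (marginal μ Λ).rnDeriv (poisson Λ) η ∧
      (marginal μ Λ).rnDeriv (poisson Λ) η ≤ ENNReal.ofReal (c * z ^ Config.count Λ η)

/-- The box `Λ_n = [-n/2, n/2)^d`. -/
def box (d n : ℕ) : Set (E d) := {x | ∀ i, -((n : ℝ) / 2) ≤ x i ∧ x i < (n : ℝ) / 2}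

theorem isBounded_box (d n : ℕ) : Bornology.IsBounded (box d n) := by
  refine isBounded_iff_forall_norm_le.2 ⟨Real.sqrt (∑ _i : Fin d, ((n : ℝ) / 2) ^ 2), ?_⟩
  intro x hx
  rw [EuclideanSpace.norm_eq]
  refine Real.sqrt_le_sqrt (Finset.sum_le_sum fun i _ => ?_)
  rw [Real.norm_eq_abs]
  exact pow_le_pow_left₀ (abs_nonneg _) (abs_le.2 ⟨(hx i).1, (hx i).2.le⟩) 2

/-- `H(η_{Λ_n}) - H(η_{Λ_n \ Λ})`. -/
noncomputable def condEnergyApprox (H : Finset (E d) → ℝ) (Λ : Set (E d)) (η : Config d) (n : ℕ) :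
    ℝ :=
  H (η.points (isBounded_box d n)) -
    H (η.points ((isBounded_box d n).subset (Set.sdiff_subset (t := Λ))))

/-- The conditional energy `H_Λ(η) = lim_n (H(η_{Λ_n}) - H(η_{Λ_n \ Λ}))`. -/
noncomputable def condEnergy (H : Finset (E d) → ℝ) (Λ : Set (E d)) (η : Config d) : ℝ :=
  limUnder atTop (condEnergyApprox H Λ η)

open Classical in
/-- The conditional energy of a point, `h(x, η) = lim_n (H(η_{Λ_n} + δ_x) - H(η_{Λ_n}))`. -/
noncomputable def pointEnergy (H : Finset (E d) → ℝ) (x : E d) (η : Config d) : ℝ :=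
  limUnder atTop fun n : ℕ =>
    H (insert x (η.points (isBounded_box d n))) - H (η.points (isBounded_box d n))

/-- The birth rate `b(x, η) = e^{-h(x, η)}`. -/
noncomputable def birthRate (H : Finset (E d) → ℝ) (x : E d) (η : Config d) : ℝ :=
  Real.exp (-pointEnergy H x η)

/-- The standing assumptions on the energy functional `H` on finite configurations. -/
structure IsAdmissible (H : Finset (E d) → ℝ) : Prop where
  /-- `H` is measurable. -/
  measurable : ∀ (B : Set (E d)) (hB : Bornology.IsBounded B), MeasurableSet B →
    Measurable fun η : Config d => H (η.points hB)
  /-- The conditional energies are well defined. -/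
  exists_limit : ∀ Λ : Set (E d), Bornology.IsBounded Λ → MeasurableSet Λ → ∀ η : Config d,
    ∃ l : ℝ, Tendsto (condEnergyApprox H Λ η) atTop (𝓝 l)
  /-- Continuity: for each `n`, `H` depends continuously on the positions of `n` distinct
  points. -/
  continuous : ∀ n : ℕ, ContinuousOn
    (fun x : Fin n → E d => H (Set.finite_range x).toFinset) {x | Function.Injective x}
  /-- The interaction is bounded from above and below. -/
  bounded : ∃ C : ℝ, ∀ (x : E d) (η : Config d), |pointEnergy H x η| ≤ C
  /-- The interaction has finite range. -/
  finite_range : ∃ R : ℝ, 0 < R ∧ ∀ Λ : Set (E d), Bornology.IsBounded Λ → MeasurableSet Λ →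
    ∀ η : Config d, condEnergy H Λ η = condEnergy H Λ (η.restrict (Metric.cthickening R Λ))

/-- The Boltzmann weight `e^{-H_Λ(η_Λ ω_{Λᶜ})}`. -/
noncomputable def gibbsWeight (H : Finset (E d) → ℝ) (Λ : Set (E d)) (ω η : Config d) : ℝ≥0∞ :=
  ENNReal.ofReal (Real.exp (-condEnergy H Λ (Config.glue Λ η ω)))

/-- The partition function `Z_Λ(ω)`. -/
noncomputable def partitionFunction (H : Finset (E d) → ℝ) (Λ : Set (E d)) (ω : Config d) :
    ℝ≥0∞ :=
  ∫⁻ η, gibbsWeight H Λ ω η ∂(poisson Λ)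

/-- The finite-volume Gibbs point process in `Λ` with boundary condition `ω`. -/
noncomputable def finiteGibbs (H : Finset (E d) → ℝ) (Λ : Set (E d)) (ω : Config d) :
    Measure (Config d) :=
  (partitionFunction H Λ ω)⁻¹ • (poisson Λ).withDensity (gibbsWeight H Λ ω)

/-- Translation-invariant infinite-volume Gibbs point processes: probability measures that
satisfy the DLR equations. -/
structure IsGibbs (H : Finset (E d) → ℝ) (ν : Measure (Config d)) : Prop where
  isProbabilityMeasure : IsProbabilityMeasure ν
  translationInvariant : IsTranslationInvariant ν
  dlr : ∀ Λ : Set (E d), Bornology.IsBounded Λ → MeasurableSet Λ →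
    ∀ f : Config d → ℝ≥0∞, Measurable f →
      ∫⁻ ω, f ω ∂ν = ∫⁻ ω, ∫⁻ η, f (Config.glue Λ η ω) ∂(finiteGibbs H Λ ω) ∂ν

/-- The integrand of the birth part of the generator. -/
noncomputable def birthTerm (b : E d → Config d → ℝ) (f : Config d → ℝ) (η : Config d)
    (x : E d) : ℝ :=
  b x η * (f (η.add x) - f η)

/-- The formal generator
`(𝓛 f)(η) = ∫ b(x, η) (f(η + δ_x) - f(η)) dx + ∑_{x ∈ η} (f(η - δ_x) - f(η))`. -/
noncomputable def generator (b : E d → Config d → ℝ) (f : Config d → ℝ) (η : Config d) : ℝ :=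
  (∫ x, birthTerm b f η x) + ∑' x : η.carrier, (f (η.remove x.1) - f η)

/-- Bounded, local, measurable functions on `Ω`. -/
structure IsBoundedLocal (f : Config d → ℝ) : Prop where
  measurable : Measurable f
  bounded : ∃ C : ℝ, ∀ η, |f η| ≤ C
  isLocal : ∃ Λ : Set (E d), Bornology.IsBounded Λ ∧ MeasurableSet Λ ∧
    ∀ η, f (η.restrict Λ) = f η

/-- `X` is a càdlàg solution, on the probability space `(S, P)`, of the martingale problem for the
generator with birth rate `b` and initial configuration `ω`. -/
structure SolvesMartingaleProblem (b : E d → Config d → ℝ) (ω : Config d)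
    {S : Type} [mS : MeasurableSpace S] (P : Measure S) (X : ℝ≥0 → S → Config d) : Prop where
  initial : ∀ᵐ s ∂P, X 0 s = ω
  rightContinuous : ∀ (s : S) (t : ℝ≥0), ContinuousWithinAt (fun u => X u s) (Set.Ici t) t
  leftLimits : ∀ (s : S) (t : ℝ≥0), ∃ η : Config d, Tendsto (fun u => X u s) (𝓝[<] t) (𝓝 η)
  martingale : ∃ 𝓕 : Filtration ℝ≥0 mS, (∀ t, Measurable[𝓕 t] (X t)) ∧
    ∀ f : Config d → ℝ, IsBoundedLocal f →
      Martingale (fun (t : ℝ≥0) (s : S) =>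
        f (X t s) - ∫ u in (0 : ℝ)..t, generator b f (X u.toNNReal s)) 𝓕 P

/-- `(T_t)` is the transition semigroup of the birth-and-death process with birth rate `b` and
unit death rate: `T_t(ω, ·)` is the law of `X_t^{(ω)}`, where `X^{(ω)}` is a solution of the
martingale problem for the generator that starts in `ω`. -/
structure IsBirthDeathSemigroup (b : E d → Config d → ℝ)
    (T : ℝ≥0 → Kernel (Config d) (Config d)) : Prop where
  semigroup : ∀ s t : ℝ≥0, T (s + t) = T t ∘ₖ T s
  law : ∀ ω : Config d, ∃ (S : Type) (_ : MeasurableSpace S) (P : Measure S)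
    (X : ℝ≥0 → S → Config d), IsProbabilityMeasure P ∧ SolvesMartingaleProblem b ω P X ∧
      ∀ t, T t ω = P.map (X t)

/-- The evolved measure `μ T_t`, for real `t ≥ 0`. -/
noncomputable def evolve (μ : Measure (Config d)) (T : ℝ≥0 → Kernel (Config d) (Config d))
    (t : ℝ) : Measure (Config d) :=
  μ.bind (T t.toNNReal)

/-- The local relative entropy `I_Λ(μ | ν) = I(μ_Λ | ν_Λ)`. -/
noncomputable def localEntropy (Λ : Set (E d)) (μ ν : Measure (Config d)) : ℝ≥0∞ :=
  InformationTheory.klDiv (marginal μ Λ) (marginal ν Λ)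

/-- The `Λ`-local function `η ↦ log (dμ_Λ/dν_Λ)(η_Λ)`. -/
noncomputable def logDensity (Λ : Set (E d)) (μ ν : Measure (Config d)) (η : Config d) : ℝ :=
  Real.log ((marginal μ Λ).rnDeriv (marginal ν Λ) (η.restrict Λ)).toReal

end BirthDeath

/-!
Dominate the generator by a positive operator: replace the birth rate on `Λ` by its supremum and
add gains and losses instead of subtracting them. Iterating Dynkin's formula for local functions
bounds `T_t F` by the exponential series of this operator for small `t`. By Mecke's formula its
powers can be moved, under the Poisson process, from the function onto the weight `z ^ N_Λ`, and
the resulting weights again grow geometrically in `N_Λ`. As `μ_Λ` is comparable to the Poisson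
process, `(μ T_t)_Λ` has with respect to `μ_Λ` a density within `t g y ^ N_Λ` of `1`.

Hence `I_Λ(μ T_t | μ)` is at most a `χ²`-distance of order `t²`, and by the chain rule
`I_Λ(μ T_t | ν) = I_Λ(μ T_t | μ) + (μ T_t)[log dμ_Λ/dν_Λ]` the derivative at `0` is that of the
second term. The function `log dμ_Λ/dν_Λ` is local and bounded by a multiple of `2 ^ N_Λ`, so
applying Dynkin's formula twice expands the second term to first order with error of order `t²`.
-/

namespace BirthDeath

open Bornology (IsBounded)

variable {d : ℕ}

theorem ascFactorial_le_ascFactorial_succ (n k : ℕ) :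
    (n + 1).ascFactorial k ≤ (n + 1).ascFactorial (k + 1) := by
  rw [Nat.ascFactorial_succ]
  exact Nat.le_mul_of_pos_left _ (by omega)

theorem succ_ascFactorial_le (n k : ℕ) :
    (n + 2).ascFactorial k ≤ (n + 1).ascFactorial (k + 1) := by
  rw [Nat.ascFactorial_succ, ← Nat.succ_ascFactorial]
  exact Nat.le_mul_of_pos_left _ n.succ_pos

theorem mul_ascFactorial_le (n k : ℕ) :
    n * (n + 1).ascFactorial k ≤ (n + 1).ascFactorial (k + 1) := by
  rw [Nat.ascFactorial_succ]
  exact Nat.mul_le_mul (by omega) le_rfl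

theorem ascFactorial_le_factorial_mul_two_pow (n k : ℕ) :
    (n + 1).ascFactorial k ≤ k.factorial * 2 ^ (n + k) := by
  rw [Nat.ascFactorial_eq_factorial_mul_choose]
  exact Nat.mul_le_mul le_rfl (Nat.choose_le_two_pow _ _)

theorem ofReal_mul_pow_le {c : ℝ} (hc : 0 ≤ c) {z : ℝ} (hz : 0 ≤ z) (n : ℕ) :
    ENNReal.ofReal (c * z ^ n) ≤
      ((max 1 c.toNNReal : ℝ≥0) : ℝ≥0∞) * ((max 1 z.toNNReal : ℝ≥0) : ℝ≥0∞) ^ n := by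
  rw [ENNReal.ofReal_mul hc, ENNReal.ofReal_pow hz]
  gcongr
  · exact ENNReal.coe_le_coe.2 (le_max_right _ _)
  · exact ENNReal.coe_le_coe.2 (le_max_right _ _)

theorem ofReal_exp_mul_natCast (C : ℝ) (n : ℕ) :
    ENNReal.ofReal (Real.exp (C * n)) = ENNReal.ofReal (Real.exp C) ^ n := by
  rw [mul_comm, Real.exp_nat_mul, ENNReal.ofReal_pow (Real.exp_pos _).le]

theorem measurable_of_natCast {α : Type*} [MeasurableSpace α] {f : α → ℕ}
    (hf : Measurable fun a => (f a : ℝ≥0∞)) : Measurable f := by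
  refine measurable_to_countable' fun n => ?_
  have hpre : f ⁻¹' {n} = (fun a => (f a : ℝ≥0∞)) ⁻¹' {(n : ℝ≥0∞)} := by
    ext a
    simp
  rw [hpre]
  exact hf (measurableSet_singleton _)

theorem tendsto_ceil_mul_div_nhdsGE (u : ℝ≥0) :
    Tendsto (fun k : ℕ => (⌈u * k⌉₊ : ℝ≥0) / k) atTop (𝓝[≥] u) := by
  refine tendsto_nhdsWithin_iff.2 ⟨?_, ?_⟩
  · have h := (tendsto_nat_ceil_mul_div_atTop u.coe_nonneg).comp tendsto_natCast_atTop_atTop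
    refine NNReal.tendsto_coe.1 (h.congr fun k => ?_)
    have hceil : ⌈(u : ℝ) * (k : ℝ)⌉₊ = ⌈u * (k : ℝ≥0)⌉₊ := Nonneg.nat_ceil_coe (u * (k : ℝ≥0))
    simp only [Function.comp_apply, hceil, NNReal.coe_div, NNReal.coe_natCast]
  · filter_upwards [eventually_gt_atTop 0] with k hk
    exact (le_div_iff₀ (show (0 : ℝ≥0) < k by exact_mod_cast hk)).2 (Nat.le_ceil _)

theorem measurable_uncurry_of_continuousWithinAt_Ici {S β : Type*} [MeasurableSpace S]
    [TopologicalSpace β] [TopologicalSpace.PseudoMetrizableSpace β] [MeasurableSpace β]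
    [BorelSpace β] {Z : ℝ≥0 → S → β} (hZ : ∀ t, Measurable (Z t))
    (hr : ∀ s t, ContinuousWithinAt (fun u => Z u s) (Set.Ici t) t) :
    Measurable fun p : ℝ≥0 × S => Z p.1 p.2 := by
  refine measurable_of_tendsto_metrizable (f := fun (k : ℕ) (p : ℝ≥0 × S) =>
    Z (⌈p.1 * k⌉₊ / k) p.2) (fun k => ?_) (tendsto_pi_nhds.2 fun p => ?_)
  · have hstep : Measurable fun q : ℕ × S => Z (q.1 / k : ℝ≥0) q.2 :=
      measurable_from_prod_countable_right fun n => hZ (n / k)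
    have hceil : Measurable fun p : ℝ≥0 × S => (⌈p.1 * k⌉₊, p.2) :=
      (Nat.measurable_ceil.comp (by fun_prop)).prodMk measurable_snd
    exact hstep.comp hceil
  · exact (hr p.2 p.1).tendsto.comp (tendsto_ceil_mul_div_nhdsGE p.1)

theorem lintegral_eq_iSup_min {α : Type*} [MeasurableSpace α] (m : Measure α) {G : α → ℝ≥0∞}
    (hG : Measurable G) : ∫⁻ a, G a ∂m = ⨆ n : ℕ, ∫⁻ a, min (G a) n ∂m := by
  rw [← lintegral_iSup (fun n => hG.min measurable_const)
    (fun i j hij a => min_le_min le_rfl (by exact_mod_cast hij))]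
  refine lintegral_congr fun a => ?_
  change G a = ⨆ n : ℕ, G a ⊓ (n : ℝ≥0∞)
  rw [← inf_iSup_eq, ENNReal.iSup_natCast, inf_top_eq]

theorem ofReal_le_ofReal_add_enorm_sub (a b : ℝ) :
    ENNReal.ofReal a ≤ ENNReal.ofReal b + ‖a - b‖ₑ := by
  rw [Real.enorm_eq_ofReal_abs]
  refine (ENNReal.ofReal_le_ofReal ?_).trans ENNReal.ofReal_add_le
  linarith [le_abs_self (a - b)]

/-- The coefficient `t ^ k / k!` of the exponential series, as an extended nonnegative number, so
that series of operators can be manipulated without summability conditions. -/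
noncomputable def expCoeff (t : ℝ≥0) (k : ℕ) : ℝ≥0∞ := (t : ℝ≥0∞) ^ k * (k.factorial : ℝ≥0∞)⁻¹

theorem expCoeff_zero (t : ℝ≥0) : expCoeff t 0 = 1 := by simp [expCoeff]

theorem expCoeff_mono {s t : ℝ≥0} (h : s ≤ t) (k : ℕ) : expCoeff s k ≤ expCoeff t k := by
  unfold expCoeff
  gcongr

theorem expCoeff_eq_ofReal (t : ℝ≥0) (k : ℕ) :
    expCoeff t k = ENNReal.ofReal ((t : ℝ) ^ k / k.factorial) := by
  rw [expCoeff, ENNReal.ofReal_div_of_pos (by positivity), ENNReal.ofReal_pow t.coe_nonneg,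
    ENNReal.ofReal_coe_nnreal, ENNReal.ofReal_natCast, div_eq_mul_inv]

theorem measurable_expCoeff (k : ℕ) : Measurable fun u : ℝ => expCoeff u.toNNReal k := by
  unfold expCoeff
  fun_prop

theorem lintegral_expCoeff (t : ℝ≥0) (k : ℕ) :
    ∫⁻ u in Set.Ioc (0 : ℝ) t, expCoeff u.toNNReal k = expCoeff t (k + 1) := by
  have hcoeff : ∫⁻ u in Set.Ioc (0 : ℝ) t, expCoeff u.toNNReal k =
      ∫⁻ u in Set.Ioc (0 : ℝ) t, ENNReal.ofReal (u ^ k / k.factorial) :=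
    setLIntegral_congr_fun measurableSet_Ioc fun u hu => by
      rw [expCoeff_eq_ofReal, Real.coe_toNNReal _ hu.1.le]
  have hint : IntervalIntegrable (fun u : ℝ => u ^ k / k.factorial) volume 0 t :=
    Continuous.intervalIntegrable (by fun_prop) _ _
  rw [hcoeff, ← ofReal_integral_eq_lintegral_ofReal
    ((intervalIntegrable_iff_integrableOn_Ioc_of_le t.coe_nonneg).1 hint),
    ← intervalIntegral.integral_of_le t.coe_nonneg, intervalIntegral.integral_div, integral_pow,
    expCoeff_eq_ofReal, Nat.factorial_succ]
  · congr 1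
    push_cast
    rw [zero_pow (by omega), sub_zero]
    field_simp
  · filter_upwards [ae_restrict_mem measurableSet_Ioc] with u hu
    have := hu.1.le
    positivity

theorem expCoeff_mul_factorial (t : ℝ≥0) (k : ℕ) :
    expCoeff t k * k.factorial = (t : ℝ≥0∞) ^ k := by
  rw [expCoeff, mul_assoc, ENNReal.inv_mul_cancel (by exact_mod_cast k.factorial_ne_zero)
    (ENNReal.natCast_ne_top _), mul_one]

theorem expCoeff_mul_factorial_succ_le (t : ℝ≥0) (k : ℕ) :
    expCoeff t k * (k + 1).factorial ≤ (2 * (t : ℝ≥0∞)) ^ k := by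
  have hk : ((k + 1 : ℕ) : ℝ≥0∞) ≤ 2 ^ k := by
    exact_mod_cast Nat.succ_le_of_lt Nat.lt_two_pow_self
  calc expCoeff t k * (k + 1).factorial
      = (k + 1 : ℕ) * (expCoeff t k * k.factorial) := by
        rw [Nat.factorial_succ, Nat.cast_mul]
        ring
    _ ≤ 2 ^ k * (t : ℝ≥0∞) ^ k := by
        rw [expCoeff_mul_factorial]
        gcongr
    _ = (2 * (t : ℝ≥0∞)) ^ k := (mul_pow _ _ _).symm

theorem expCoeff_mul_factorial_succ_mul_two_pow_le {t : ℝ≥0} {a : ℝ≥0∞} (h : 8 * t * a ≤ 1)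
    (k : ℕ) :
    expCoeff t k * (a ^ (k + 1) * ((k + 1).factorial * 2 ^ (k + 1))) ≤ 2 * a * (1 / 2) ^ k := by
  have ha : 4 * (t : ℝ≥0∞) * a ≤ 1 / 2 := by
    rw [ENNReal.le_div_iff_mul_le (by simp) (by simp)]
    calc 4 * (t : ℝ≥0∞) * a * 2 = 8 * t * a := by ring
      _ ≤ 1 := h
  calc expCoeff t k * (a ^ (k + 1) * ((k + 1).factorial * 2 ^ (k + 1)))
      = 2 * a * (expCoeff t k * (k + 1).factorial * (2 * a) ^ k) := by
        rw [mul_pow]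
        ring
    _ ≤ 2 * a * ((2 * (t : ℝ≥0∞)) ^ k * (2 * a) ^ k) := by
        gcongr
        exact expCoeff_mul_factorial_succ_le t k
    _ = 2 * a * (4 * t * a) ^ k := by
        rw [← mul_pow]
        ring_nf
    _ ≤ 2 * a * (1 / 2) ^ k := by gcongr

theorem setLIntegral_Ioc_toNNReal_le {f : ℝ≥0 → ℝ≥0∞} {K : ℝ≥0∞} {t : ℝ≥0}
    (h : ∀ u ≤ t, f u ≤ K) : ∫⁻ u in Set.Ioc (0 : ℝ) t, f u.toNNReal ≤ t * K := by
  calc ∫⁻ u in Set.Ioc (0 : ℝ) t, f u.toNNReal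
      ≤ ∫⁻ _ in Set.Ioc (0 : ℝ) t, K := setLIntegral_mono' measurableSet_Ioc fun u hu =>
        h _ (Real.toNNReal_le_iff_le_coe.2 hu.2)
    _ = t * K := by
        rw [setLIntegral_const, Real.volume_Ioc, sub_zero, ENNReal.ofReal_coe_nnreal, mul_comm]

theorem tendsto_intervalIntegral_of_norm_le {E : Type*} [NormedAddCommGroup E] [NormedSpace ℝ E]
    {f : ℕ → ℝ → E} {g : ℝ → E} {a b C : ℝ} (hab : a ≤ b)
    (hf : ∀ n, IntervalIntegrable (f n) volume a b) (hC : ∀ n, ∀ u ∈ Set.Ioc a b, ‖f n u‖ ≤ C)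
    (hlim : ∀ u ∈ Set.Ioc a b, Tendsto (fun n => f n u) atTop (𝓝 (g u))) :
    IntervalIntegrable g volume a b ∧
      Tendsto (fun n => ∫ u in a..b, f n u) atTop (𝓝 (∫ u in a..b, g u)) := by
  simp only [intervalIntegrable_iff, intervalIntegral.integral_of_le hab, Set.uIoc_of_le hab]
    at hf ⊢
  have hlim_ae : ∀ᵐ u ∂volume.restrict (Set.Ioc a b), Tendsto (fun n => f n u) atTop (𝓝 (g u)) :=
    ae_restrict_of_forall_mem measurableSet_Ioc hlim
  have hmeas (n : ℕ) := (hf n).aestronglyMeasurable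
  have hbound (n : ℕ) : ∀ᵐ u ∂volume.restrict (Set.Ioc a b), ‖f n u‖ ≤ C :=
    ae_restrict_of_forall_mem measurableSet_Ioc (hC n)
  refine ⟨Integrable.of_bound (aestronglyMeasurable_of_tendsto_ae atTop hmeas hlim_ae) C ?_,
    tendsto_integral_of_dominated_convergence _ hmeas (integrable_const C) hbound hlim_ae⟩
  exact ae_restrict_of_forall_mem measurableSet_Ioc fun u hu =>
    le_of_tendsto' (hlim u hu).norm fun n => hC n u hu

section Truncation

variable {α : Type*}

theorem measurable_truncation [MeasurableSpace α] {f : α → ℝ} (hf : Measurable f) (A : ℝ) :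
    Measurable (truncation f A) :=
  (measurable_id.indicator measurableSet_Ioc).comp hf

theorem tendsto_truncation (f : α → ℝ) (a : α) :
    Tendsto (fun n : ℕ => truncation f n a) atTop (𝓝 (f a)) :=
  tendsto_nhds_of_eventually_eq
    ((tendsto_natCast_atTop_atTop.eventually_gt_atTop |f a|).mono fun _ => truncation_eq_self)

end Truncation

theorem integral_bind_of_integrable {α β : Type*} [MeasurableSpace α] [MeasurableSpace β]
    {μ : Measure α} {κ : Kernel α β} {F : β → ℝ} (hF : Integrable F (μ.bind κ)) :
    Integrable (fun a => ∫ b, F b ∂(κ a)) μ ∧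
      ∫ b, F b ∂(μ.bind κ) = ∫ a, ∫ b, F b ∂(κ a) ∂μ := by
  rw [Measure.comp_eq_comp_const_apply] at hF ⊢
  have hint := hF.integral_comp
  have heq := Kernel.integral_comp hF
  simp only [Kernel.const_apply] at hint heq
  exact ⟨hint, heq⟩

theorem hasDerivWithinAt_of_abs_sub_le {f : ℝ → ℝ} {a L B ε : ℝ} (hε : 0 < ε)
    (h : ∀ t, 0 ≤ t → t ≤ ε → |f t - a - t * L| ≤ B * t ^ 2) :
    HasDerivWithinAt f L (Set.Ici 0) 0 := by
  have h0 : f 0 = a := by simpa [sub_eq_zero] using h 0 le_rfl hε.le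
  rw [hasDerivWithinAt_iff_isLittleO]
  have hO : (fun t => f t - f 0 - (t - 0) • L) =O[𝓝[≥] 0] fun t => t ^ 2 := by
    refine Asymptotics.IsBigO.of_bound B ?_
    filter_upwards [self_mem_nhdsWithin, nhdsWithin_le_nhds (Iic_mem_nhds hε)] with t ht0 htε
    simpa [h0] using h t ht0 htε
  refine hO.trans_isLittleO ?_
  simpa using (Asymptotics.isLittleO_pow_id one_lt_two).mono nhdsWithin_le_nhds

theorem abs_log_toReal_le {r M : ℝ≥0∞} (hM : M ≠ ∞) (hle : r ≤ M) (hinv : r⁻¹ ≤ M) :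
    |Real.log r.toReal| ≤ Real.log M.toReal := by
  have hr0 : r ≠ 0 := ENNReal.inv_ne_top.1 (ne_top_of_le_ne_top hM hinv)
  have hpos : 0 < r.toReal := ENNReal.toReal_pos hr0 (ne_top_of_le_ne_top hM hle)
  have hinv' : r.toReal⁻¹ ≤ M.toReal := by
    rw [← ENNReal.toReal_inv]
    exact ENNReal.toReal_mono hM hinv
  refine abs_le'.2 ⟨Real.log_le_log hpos (ENNReal.toReal_mono hM hle), ?_⟩
  rw [← Real.log_inv]
  exact Real.log_le_log (inv_pos.2 hpos) hinv'

theorem log_mul_pow_le {K Z : ℝ} (hK : 0 < K) (hZ : 0 < Z) (N : ℕ) :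
    Real.log (K * Z ^ N) ≤ (K + Z) * 2 ^ N := by
  have hN : (N : ℝ) ≤ 2 ^ N := by exact_mod_cast Nat.lt_two_pow_self.le
  calc Real.log (K * Z ^ N) = Real.log K + N * Real.log Z := by
        rw [Real.log_mul hK.ne' (by positivity), Real.log_pow]
    _ ≤ K + N * Z := by
        gcongr
        exacts [Real.log_le_self hK.le, Real.log_le_self hZ.le]
    _ ≤ K * 2 ^ N + 2 ^ N * Z := by
        gcongr
        exact le_mul_of_one_le_right hK.le (one_le_pow₀ one_le_two)
    _ = (K + Z) * 2 ^ N := by ring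

section DensityComparison

variable {α : Type*} [MeasurableSpace α] {m n : Measure α} {w : α → ℝ≥0∞}

theorem absolutelyContinuous_of_lintegral_le
    (h : ∀ F : α → ℝ≥0∞, Measurable F → ∫⁻ a, F a ∂m ≤ ∫⁻ a, w a * F a ∂n) : m ≪ n := by
  refine Measure.AbsolutelyContinuous.mk fun B hB h0 => ?_
  have hw : ∫⁻ a, w a * B.indicator 1 a ∂n = 0 := by
    refine lintegral_eq_zero_of_ae_eq_zero ?_
    filter_upwards [measure_eq_zero_iff_ae_notMem.1 h0] with a ha
    simp [ha]
  simpa [lintegral_indicator_one hB, hw] using h (B.indicator 1) (measurable_one.indicator hB)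

theorem rnDeriv_le_of_lintegral_le [SigmaFinite m] [SigmaFinite n]
    (h : ∀ F : α → ℝ≥0∞, Measurable F → ∫⁻ a, F a ∂m ≤ ∫⁻ a, w a * F a ∂n) :
    m.rnDeriv n ≤ᵐ[n] w := by
  refine ae_le_of_forall_setLIntegral_le_of_sigmaFinite (Measure.measurable_rnDeriv m n)
    fun B hB _ => ?_
  rw [Measure.setLIntegral_rnDeriv (absolutelyContinuous_of_lintegral_le h),
    ← lintegral_indicator_one hB, ← lintegral_indicator hB]
  refine (h _ (measurable_one.indicator hB)).trans_eq (lintegral_congr fun a => ?_)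
  by_cases ha : a ∈ B <;> simp [ha]

end DensityComparison

section RelativeEntropy

open InformationTheory

variable {α : Type*} [MeasurableSpace α]

theorem klFun_le_sq {x : ℝ} (hx : 0 ≤ x) : klFun x ≤ (x - 1) ^ 2 := by
  rcases hx.eq_or_lt with rfl | h
  · simp [klFun_zero]
  · rw [klFun_apply]
    nlinarith [mul_le_mul_of_nonneg_left (Real.log_le_sub_one_of_pos h) h.le]

theorem ofReal_sq_toReal_sub_one_le {r G : ℝ≥0∞} (hr : r ≤ 1 + G) (hG : 1 ≤ r + G) :
    ENNReal.ofReal ((r.toReal - 1) ^ 2) ≤ G ^ 2 := by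
  induction G with
  | top => simp
  | coe G =>
    lift r to ℝ≥0 using ne_top_of_le_ne_top (by simp) hr
    have hr' : (r : ℝ) ≤ 1 + G := by exact_mod_cast hr
    have hG' : (1 : ℝ) ≤ r + G := by exact_mod_cast hG
    have hsq : ((r : ℝ) - 1) ^ 2 ≤ (G : ℝ) ^ 2 := sq_le_sq' (by linarith) (by linarith)
    refine (ENNReal.ofReal_le_ofReal hsq).trans_eq ?_
    rw [ENNReal.ofReal_pow G.coe_nonneg, ENNReal.ofReal_coe_nnreal]

/- The hypotheses bound the density of `m` with respect to `m₀` between `1 - G` and `1 + G`, and the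
relative entropy is at most the chi-squared divergence. -/
theorem klDiv_le_lintegral_sq {m m₀ : Measure α} [IsFiniteMeasure m] [IsFiniteMeasure m₀]
    {G : α → ℝ≥0∞} (hGm : Measurable G)
    (hle : ∀ B, MeasurableSet B → m B ≤ m₀ B + ∫⁻ a in B, G a ∂m₀)
    (hge : ∀ B, MeasurableSet B → m₀ B ≤ m B + ∫⁻ a in B, G a ∂m₀) :
    m ≪ m₀ ∧ klDiv m m₀ ≤ ∫⁻ a, G a ^ 2 ∂m₀ := by
  have hac : m ≪ m₀ := by
    refine Measure.AbsolutelyContinuous.mk fun B hB h0 => ?_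
    simpa [h0, setLIntegral_measure_zero] using hle B hB
  have hupper : m.rnDeriv m₀ ≤ᵐ[m₀] fun a => 1 + G a := by
    refine ae_le_of_forall_setLIntegral_le_of_sigmaFinite (Measure.measurable_rnDeriv m m₀)
      fun B hB _ => ?_
    rw [Measure.setLIntegral_rnDeriv hac, lintegral_add_right _ hGm, setLIntegral_one]
    exact hle B hB
  have hlower : (fun _ => 1) ≤ᵐ[m₀] fun a => m.rnDeriv m₀ a + G a := by
    refine ae_le_of_forall_setLIntegral_le_of_sigmaFinite measurable_const fun B hB _ => ?_
    rw [lintegral_add_right _ hGm, Measure.setLIntegral_rnDeriv hac, setLIntegral_one]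
    exact hge B hB
  refine ⟨hac, ?_⟩
  rw [klDiv_eq_lintegral_klFun_of_ac hac]
  refine lintegral_mono_ae ?_
  filter_upwards [hupper, hlower] with a hr hG
  exact (ENNReal.ofReal_le_ofReal (klFun_le_sq ENNReal.toReal_nonneg)).trans
    (ofReal_sq_toReal_sub_one_le hr hG)

theorem llr_ae_eq_add {m m₀ n : Measure α} [SigmaFinite m] [SigmaFinite m₀] [SigmaFinite n]
    (hm : m ≪ m₀) (hn : m₀ ≪ n) : llr m n =ᵐ[m] fun a => llr m m₀ a + llr m₀ n a := by
  have hmn := hm.trans hn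
  filter_upwards [hmn (Measure.rnDeriv_mul_rnDeriv hm), Measure.rnDeriv_pos hm,
    hm (Measure.rnDeriv_pos hn), hm (Measure.rnDeriv_lt_top m m₀),
    hmn (Measure.rnDeriv_lt_top m₀ n)] with a hchain hpos hpos₀ hfin hfin₀
  simp only [llr_def]
  rw [← hchain, Pi.mul_apply, ENNReal.toReal_mul,
    Real.log_mul (ENNReal.toReal_pos hpos.ne' hfin.ne).ne'
      (ENNReal.toReal_pos hpos₀.ne' hfin₀.ne).ne']

theorem toReal_klDiv_eq_add {m m₀ n : Measure α} [IsProbabilityMeasure m]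
    [IsProbabilityMeasure m₀] [IsProbabilityMeasure n] (hm : m ≪ m₀) (hn : m₀ ≪ n)
    (hkl : klDiv m m₀ ≠ ∞) (hint : Integrable (llr m₀ n) m) :
    klDiv m n ≠ ∞ ∧ (klDiv m n).toReal = (klDiv m m₀).toReal + ∫ a, llr m₀ n a ∂m := by
  have hllr := (klDiv_ne_top_iff.1 hkl).2
  have heq := llr_ae_eq_add hm hn
  refine ⟨klDiv_ne_top (hm.trans hn) ((hllr.add hint).congr heq.symm), ?_⟩
  rw [toReal_klDiv_of_measure_eq (hm.trans hn) (by simp), toReal_klDiv_of_measure_eq hm (by simp),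
    integral_congr_ae heq, integral_add hllr hint]

end RelativeEntropy

namespace Config

theorem measurable_count {Λ : Set (E d)} (hΛ : IsBounded Λ) (hm : MeasurableSet Λ) :
    Measurable (count Λ) := by
  have h : MeasurableSpace.comap (count Λ) ⊤ ≤ (instMeasurableSpace : MeasurableSpace (Config d)) :=
    le_iSup₂_of_le Λ hΛ (le_iSup_of_le hm le_rfl)
  exact (comap_measurable (count Λ)).mono h le_rfl

theorem measurable_of_count {α : Type*} [MeasurableSpace α] {f : α → Config d}
    (h : ∀ Λ : Set (E d), IsBounded Λ → MeasurableSet Λ →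
      Measurable fun a => count Λ (f a)) : Measurable f := by
  rw [measurable_iff_comap_le, instMeasurableSpace]
  simp only [MeasurableSpace.comap_iSup, MeasurableSpace.comap_comp, iSup_le_iff]
  intro Λ hΛ hm
  exact (h Λ hΛ hm).comap_le

@[simp]
theorem mem_points {η : Config d} {B : Set (E d)} {hB : IsBounded B} {x : E d} :
    x ∈ η.points hB ↔ x ∈ η.carrier ∧ x ∈ B := by
  simp [points]

theorem card_points (η : Config d) {B : Set (E d)} (hB : IsBounded B) :
    (η.points hB).card = η.count B := by
  rw [count, Set.ncard_eq_toFinset_card _ (η.finite_inter B hB)]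
  rfl

@[simp]
theorem carrier_restrict (Λ : Set (E d)) (η : Config d) :
    (η.restrict Λ).carrier = η.carrier ∩ Λ := rfl

@[simp]
theorem carrier_add (η : Config d) (x : E d) : (η.add x).carrier = insert x η.carrier := rfl

@[simp]
theorem carrier_remove (η : Config d) (x : E d) : (η.remove x).carrier = η.carrier \ {x} := rfl

theorem count_restrict (B Λ : Set (E d)) (η : Config d) :
    count B (η.restrict Λ) = count (Λ ∩ B) η := by
  simp [count, Set.inter_assoc]

theorem measurable_restrict {Λ : Set (E d)} (hm : MeasurableSet Λ) :
    Measurable (restrict Λ : Config d → Config d) := by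
  refine measurable_of_count fun B hB hBm => ?_
  simp_rw [count_restrict]
  exact measurable_count (hB.subset Set.inter_subset_right) (hm.inter hBm)

@[simp]
theorem restrict_restrict (Λ Λ' : Set (E d)) (η : Config d) :
    (η.restrict Λ).restrict Λ' = η.restrict (Λ ∩ Λ') := by
  ext x; simp [and_assoc]

theorem add_of_mem {η : Config d} {x : E d} (h : x ∈ η.carrier) : η.add x = η := by
  ext1
  exact Set.insert_eq_of_mem h

theorem restrict_add_of_mem {Λ : Set (E d)} {x : E d} (hx : x ∈ Λ) (η : Config d) :
    (η.add x).restrict Λ = (η.restrict Λ).add x := by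
  ext1
  exact Set.insert_inter_of_mem hx

theorem restrict_add_of_notMem {Λ : Set (E d)} {x : E d} (hx : x ∉ Λ) (η : Config d) :
    (η.add x).restrict Λ = η.restrict Λ := by
  ext1
  exact Set.insert_inter_of_notMem hx

theorem restrict_remove (Λ : Set (E d)) (x : E d) (η : Config d) :
    (η.remove x).restrict Λ = (η.restrict Λ).remove x := by
  ext1
  exact Set.sdiff_inter_right_comm _ _ _

theorem restrict_remove_of_notMem {Λ : Set (E d)} {x : E d} (hx : x ∉ Λ) (η : Config d) :
    (η.remove x).restrict Λ = η.restrict Λ := by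
  rw [restrict_remove]
  ext1
  exact Set.sdiff_singleton_eq_self fun h => hx h.2

theorem remove_add_of_notMem {η : Config d} {x : E d} (hx : x ∉ η.carrier) :
    (η.add x).remove x = η := by
  ext1
  exact Set.insert_sdiff_self_of_notMem hx

theorem points_restrict {Λ : Set (E d)} (hΛ : IsBounded Λ) (η : Config d) :
    (η.restrict Λ).points hΛ = η.points hΛ := by
  ext x; simp

theorem count_pos_iff {B : Set (E d)} (hB : IsBounded B) (η : Config d) :
    0 < count B η ↔ (η.carrier ∩ B).Nonempty := by
  rw [count, Set.ncard_pos (η.finite_inter B hB)]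

theorem isClosed_carrier (η : Config d) : IsClosed η.carrier := by
  refine isClosed_of_closure_subset fun x hx => ?_
  have hfin : (η.carrier ∩ Metric.ball x 1).Finite := η.finite_inter _ Metric.isBounded_ball
  have hx' : x ∈ closure (η.carrier ∩ Metric.ball x 1) :=
    Metric.isOpen_ball.closure_inter ⟨hx, Metric.mem_ball_self one_pos⟩
  exact (hfin.isClosed.closure_eq ▸ hx').1

theorem mem_carrier_iff_forall_ball {η : Config d} {x : E d} :
    x ∈ η.carrier ↔ ∀ k : ℕ, ∃ q : ℕ, dist x (TopologicalSpace.denseSeq (E d) q) < 1 / (k + 1) ∧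
      0 < η.count (Metric.ball (TopologicalSpace.denseSeq (E d) q) (1 / (k + 1))) := by
  constructor
  · intro hx k
    obtain ⟨q, hq⟩ := (TopologicalSpace.denseRange_denseSeq (E d)).exists_dist_lt x
      (Nat.one_div_pos_of_nat (α := ℝ) (n := k))
    exact ⟨q, hq, (count_pos_iff Metric.isBounded_ball _).2 ⟨x, hx, hq⟩⟩
  · intro h
    rw [← η.isClosed_carrier.closure_eq, Metric.mem_closure_iff]
    intro ε hε
    obtain ⟨k, hk⟩ := exists_nat_one_div_lt (half_pos hε)
    obtain ⟨q, hxq, hq⟩ := h k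
    obtain ⟨y, hy, hyq⟩ := (count_pos_iff Metric.isBounded_ball _).1 hq
    rw [Metric.mem_ball] at hyq
    exact ⟨y, hy, by linarith [dist_triangle_right x y (TopologicalSpace.denseSeq (E d) q)]⟩

theorem measurableSet_mem_carrier :
    MeasurableSet {p : Config d × E d | p.2 ∈ p.1.carrier} := by
  simp_rw [mem_carrier_iff_forall_ball, Set.ofPred_forall, Set.ofPred_exists, Set.ofPred_and]
  refine MeasurableSet.iInter fun k => MeasurableSet.iUnion fun q => MeasurableSet.inter ?_ ?_
  · exact measurableSet_lt (by fun_prop) measurable_const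
  · exact measurableSet_lt measurable_const
      ((measurable_count Metric.isBounded_ball measurableSet_ball).comp measurable_fst)

open Classical in
theorem count_add {B : Set (E d)} (hB : IsBounded B) (η : Config d) (x : E d) :
    count B (η.add x) = count B η + if x ∈ B ∧ x ∉ η.carrier then 1 else 0 := by
  have hf := η.finite_inter B hB
  split_ifs with h
  · rw [count, carrier_add, Set.insert_inter_of_mem h.1,
      Set.ncard_insert_of_notMem (fun h' => h.2 h'.1) hf, count]
  · by_cases hx : x ∈ η.carrier
    · rw [add_of_mem hx, add_zero]
    · rw [count, carrier_add, Set.insert_inter_of_notMem (by tauto), count, add_zero]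

open Classical in
theorem count_remove (B : Set (E d)) (η : Config d) (x : E d) :
    count B (η.remove x) = count B η - if x ∈ B ∧ x ∈ η.carrier then 1 else 0 := by
  rw [count, carrier_remove, Set.sdiff_inter_right_comm]
  split_ifs with h
  · rw [Set.ncard_sdiff_singleton_of_mem (show x ∈ η.carrier ∩ B from ⟨h.2, h.1⟩), count]
  · rw [Set.sdiff_singleton_eq_self (fun h' : x ∈ η.carrier ∩ B => h ⟨h'.2, h'.1⟩), count,
      Nat.sub_zero]

theorem measurable_add : Measurable fun p : Config d × E d => p.1.add p.2 := by
  classical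
  refine measurable_of_count fun B hB hBm => ?_
  simp_rw [count_add hB]
  refine ((measurable_count hB hBm).comp measurable_fst).add ?_
  refine Measurable.ite ?_ measurable_const measurable_const
  exact (measurable_snd hBm).inter measurableSet_mem_carrier.compl

theorem measurable_remove : Measurable fun p : Config d × E d => p.1.remove p.2 := by
  classical
  refine measurable_of_count fun B hB hBm => ?_
  simp_rw [count_remove]
  refine ((measurable_count hB hBm).comp measurable_fst).sub ?_
  refine Measurable.ite ?_ measurable_const measurable_const
  exact (measurable_snd hBm).inter measurableSet_mem_carrier

/-- The finite configuration formed by the entries of a tuple. -/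
def ofTuple {n : ℕ} (x : Fin n → E d) : Config d :=
  ofFinite (Set.range x) (Set.finite_range x)

@[simp]
theorem carrier_ofTuple {n : ℕ} (x : Fin n → E d) : (ofTuple x).carrier = Set.range x := rfl

theorem ofTuple_eq_add {n : ℕ} (x : Fin (n + 1) → E d) (i : Fin (n + 1)) :
    ofTuple x = (ofTuple fun j : Fin n => x (i.succAbove j)).add (x i) := by
  ext y
  simp only [carrier_ofTuple, carrier_add, Set.mem_range, Set.mem_insert_iff,
    i.exists_iff_succAbove, eq_comm (b := y)]

theorem measurable_ofTuple : ∀ n : ℕ, Measurable (ofTuple : (Fin n → E d) → Config d)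
  | 0 => measurable_of_countable _
  | n + 1 => by
    simp_rw [funext fun x : Fin (n + 1) → E d => ofTuple_eq_add x 0]
    exact measurable_add.comp (((measurable_ofTuple n).comp (by fun_prop)).prodMk (by fun_prop))

/-- The counting measure on the points of a configuration that lie in a bounded set. -/
noncomputable def pointMeasure {Λ : Set (E d)} (hΛ : IsBounded Λ) (η : Config d) :
    Measure (E d) :=
  ∑ x ∈ η.points hΛ, Measure.dirac x

theorem pointMeasure_apply {Λ : Set (E d)} (hΛ : IsBounded Λ) (η : Config d)
    {s : Set (E d)} (hs : MeasurableSet s) :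
    pointMeasure hΛ η s = (count (Λ ∩ s) η : ℝ≥0∞) := by
  classical
  rw [pointMeasure, Measure.finsetSum_apply]
  simp_rw [Measure.dirac_apply' _ hs, Set.indicator_apply, Pi.one_apply]
  rw [Finset.sum_ite, Finset.sum_const_zero, add_zero, Finset.sum_const, nsmul_one,
    ← card_points η (hΛ.subset Set.inter_subset_left)]
  congr 2
  ext x; simp [and_assoc]

theorem lintegral_pointMeasure {Λ : Set (E d)} (hΛ : IsBounded Λ) (η : Config d)
    (f : E d → ℝ≥0∞) : ∫⁻ x, f x ∂(pointMeasure hΛ η) = ∑ x ∈ η.points hΛ, f x := by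
  rw [pointMeasure, lintegral_finsetSum_measure]
  simp

theorem integral_pointMeasure {Λ : Set (E d)} (hΛ : IsBounded Λ) (η : Config d)
    (f : E d → ℝ) : ∫ x, f x ∂(pointMeasure hΛ η) = ∑ x ∈ η.points hΛ, f x := by
  rw [pointMeasure, integral_finsetSum_measure fun _ _ => integrable_dirac (by simp)]
  simp

/-- The kernel that maps a configuration to the counting measure on its points in `Λ`. -/
noncomputable def pointKernel {Λ : Set (E d)} (hΛ : IsBounded Λ)
    (hm : MeasurableSet Λ) : Kernel (Config d) (E d) where
  toFun := pointMeasure hΛ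
  measurable' := by
    refine Measure.measurable_of_measurable_coe _ fun s hs => ?_
    simp_rw [pointMeasure_apply hΛ _ hs]
    exact (measurable_from_top (f := fun n : ℕ => (n : ℝ≥0∞))).comp
      (measurable_count (hΛ.subset Set.inter_subset_left) (hm.inter hs))

instance isSFiniteKernel_pointKernel {Λ : Set (E d)} (hΛ : IsBounded Λ)
    (hm : MeasurableSet Λ) : IsSFiniteKernel (pointKernel hΛ hm) := by
  classical
  have hs : ∀ n : ℕ, MeasurableSet {η : Config d | count Λ η = n} := fun n =>
    measurable_count hΛ hm (measurableSet_singleton n)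
  refine ⟨⟨fun n => Kernel.piecewise (hs n) (pointKernel hΛ hm) 0, fun n => ⟨⟨n, by simp, ?_⟩⟩, ?_⟩⟩
  · intro η
    rw [Kernel.piecewise_apply]
    split_ifs with h
    · change pointMeasure hΛ η Set.univ ≤ _
      rw [pointMeasure_apply hΛ η .univ, Set.inter_univ, show count Λ η = n from h]
    · simp
  · ext η s hsm
    rw [Kernel.sum_apply' _ _ hsm, tsum_eq_single (count Λ η)]
    · simp [Kernel.piecewise_apply]
    · intro n hn
      rw [Kernel.piecewise_apply, if_neg (show η ∉ {η | count Λ η = n} from fun h => hn h.symm)]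
      simp

theorem measurable_sum_points {Λ : Set (E d)} (hΛ : IsBounded Λ) (hm : MeasurableSet Λ)
    {f : Config d → E d → ℝ≥0∞} (hf : Measurable (Function.uncurry f)) :
    Measurable fun η => ∑ x ∈ η.points hΛ, f η x := by
  simp_rw [← lintegral_pointMeasure hΛ]
  exact Measurable.lintegral_kernel_prod_right (κ := pointKernel hΛ hm) hf

theorem measurable_sum_points_real {Λ : Set (E d)} (hΛ : IsBounded Λ)
    (hm : MeasurableSet Λ) {f : Config d → E d → ℝ} (hf : Measurable (Function.uncurry f)) :
    Measurable fun η => ∑ x ∈ η.points hΛ, f η x := by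
  simp_rw [← integral_pointMeasure hΛ]
  exact (StronglyMeasurable.integral_kernel_prod_right (κ := pointKernel hΛ hm)
    hf.stronglyMeasurable).measurable

end Config

open Config

section Poisson

variable {Λ : Set (E d)}

/-- Lebesgue measure on `Λ^n`. -/
noncomputable def tupleMeasure (Λ : Set (E d)) (n : ℕ) : Measure (Fin n → E d) :=
  Measure.pi fun _ : Fin n => (volume : Measure (E d)).restrict Λ

instance sigmaFinite_tupleMeasure (Λ : Set (E d)) (n : ℕ) : SigmaFinite (tupleMeasure Λ n) := by
  unfold tupleMeasure; infer_instance

theorem tupleMeasure_univ (Λ : Set (E d)) (n : ℕ) :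
    tupleMeasure Λ n Set.univ = volume Λ ^ n := by
  simp [tupleMeasure, Measure.pi_univ]

theorem measurePreserving_succAbove (Λ : Set (E d)) {n : ℕ} (i : Fin (n + 1)) :
    MeasurePreserving (MeasurableEquiv.piFinSuccAbove (fun _ => E d) i) (tupleMeasure Λ (n + 1))
      (((volume : Measure (E d)).restrict Λ).prod (tupleMeasure Λ n)) :=
  measurePreserving_piFinSuccAbove (fun _ : Fin (n + 1) => (volume : Measure (E d)).restrict Λ) i

theorem lintegral_tupleMeasure_succ (Λ : Set (E d)) {n : ℕ} (i : Fin (n + 1))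
    {f : E d × (Fin n → E d) → ℝ≥0∞} (hf : Measurable f) :
    ∫⁻ x, f (x i, fun j => x (i.succAbove j)) ∂(tupleMeasure Λ (n + 1)) =
      ∫⁻ y, (∫⁻ a in Λ, f (a, y)) ∂(tupleMeasure Λ n) := by
  rw [← lintegral_prod_symm' _ hf, ← (measurePreserving_succAbove Λ i).lintegral_comp hf]
  rfl

theorem ae_mem_tupleMeasure (hm : MeasurableSet Λ) (n : ℕ) :
    ∀ᵐ x ∂(tupleMeasure Λ n), ∀ i, x i ∈ Λ := by
  rw [ae_all_iff]
  intro i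
  exact (Measure.quasiMeasurePreserving_eval
    (fun _ : Fin n => (volume : Measure (E d)).restrict Λ) i).ae (ae_restrict_mem hm)

theorem ae_ne_tupleMeasure [NeZero d] (Λ : Set (E d)) {n : ℕ} (i : Fin (n + 1)) (j : Fin n) :
    ∀ᵐ x ∂(tupleMeasure Λ (n + 1)), x i ≠ x (i.succAbove j) := by
  have hmeas : MeasurableSet {p : E d × (Fin n → E d) | p.1 ≠ p.2 j} :=
    (measurableSet_eq_fun measurable_fst (by fun_prop)).compl
  refine (measurePreserving_succAbove Λ i).quasiMeasurePreserving.ae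
    (p := fun p : E d × (Fin n → E d) => p.1 ≠ p.2 j)
    ((Measure.ae_prod_iff_ae_ae hmeas).2 <| Eventually.of_forall fun a => ?_)
  exact (Measure.quasiMeasurePreserving_eval
    (fun _ : Fin n => (volume : Measure (E d)).restrict Λ) j).ae (p := fun x => a ≠ x)
    ((Measure.ae_ne _ a).mono fun _ => Ne.symm)

theorem ae_injective_tupleMeasure [NeZero d] (Λ : Set (E d)) (n : ℕ) :
    ∀ᵐ x ∂(tupleMeasure Λ n), Function.Injective x := by
  cases n with
  | zero => exact Eventually.of_forall fun x => Function.injective_of_subsingleton x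
  | succ n =>
    filter_upwards [ae_all_iff.2 fun i => ae_all_iff.2 (ae_ne_tupleMeasure Λ i)] with x hx i k hik
    by_contra hne
    obtain ⟨j, rfl⟩ := Fin.exists_succAbove_eq (Ne.symm hne)
    exact hx i j hik

theorem count_ofTuple {n : ℕ} {x : Fin n → E d} (hx : Function.Injective x)
    (hxΛ : ∀ i, x i ∈ Λ) : count Λ (ofTuple x) = n := by
  rw [count, carrier_ofTuple, Set.inter_eq_left.2 (Set.range_subset_iff.2 hxΛ),
    ← Set.image_univ, Set.ncard_image_of_injective _ hx, Set.ncard_univ, Nat.card_fin]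

theorem sum_points_ofTuple (hΛ : IsBounded Λ) {n : ℕ} {x : Fin n → E d}
    (hx : Function.Injective x) (hxΛ : ∀ i, x i ∈ Λ) (f : E d → ℝ≥0∞) :
    ∑ y ∈ (ofTuple x).points hΛ, f y = ∑ i, f (x i) := by
  classical
  have : (ofTuple x).points hΛ = Finset.univ.image x := by
    ext y; simp only [mem_points, carrier_ofTuple, Set.mem_range, Finset.mem_image,
      Finset.mem_univ, true_and, and_iff_left_iff_imp]
    rintro ⟨i, rfl⟩; exact hxΛ i
  rw [this, Finset.sum_image fun a _ b _ h => hx h]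

/-- The normalizing constant `e^{-|Λ|}` of the Poisson process. -/
noncomputable def poissonConst (Λ : Set (E d)) : ℝ≥0∞ :=
  ENNReal.ofReal (Real.exp (-(volume Λ).toReal))

theorem poissonConst_pos (Λ : Set (E d)) : 0 < poissonConst Λ :=
  ENNReal.ofReal_pos.2 (Real.exp_pos _)

theorem poissonConst_ne_top (Λ : Set (E d)) : poissonConst Λ ≠ ∞ := ENNReal.ofReal_ne_top

theorem lintegral_poisson (Λ : Set (E d)) {F : Config d → ℝ≥0∞} (hF : Measurable F) :
    ∫⁻ η, F η ∂(poisson Λ) = poissonConst Λ *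
      ∑' n : ℕ, ((n.factorial : ℝ≥0∞)⁻¹ * ∫⁻ x, F (ofTuple x) ∂(tupleMeasure Λ n)) := by
  rw [poisson, lintegral_smul_measure, lintegral_sum_measure]
  simp_rw [lintegral_smul_measure, smul_eq_mul]
  congr 2
  ext n
  congr 1
  exact lintegral_map hF (measurable_ofTuple n)

theorem measurable_comp_count {α : Type*} [MeasurableSpace α] (hΛ : IsBounded Λ)
    (hm : MeasurableSet Λ) (W : ℕ → α) :
    Measurable fun η : Config d => W (count Λ η) :=
  (measurable_from_top (f := W)).comp (measurable_count hΛ hm)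

theorem lintegral_poisson_comp_count [NeZero d] (hΛ : IsBounded Λ) (hm : MeasurableSet Λ)
    (W : ℕ → ℝ≥0∞) :
    ∫⁻ η, W (count Λ η) ∂(poisson Λ) =
      poissonConst Λ * ∑' n : ℕ, ((n.factorial : ℝ≥0∞)⁻¹ * (W n * volume Λ ^ n)) := by
  rw [lintegral_poisson Λ (measurable_comp_count hΛ hm W)]
  congr! 4 with n
  rw [← tupleMeasure_univ, ← lintegral_const]
  refine lintegral_congr_ae ?_
  filter_upwards [ae_injective_tupleMeasure Λ n, ae_mem_tupleMeasure hm n] with x hx hxΛ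
  rw [count_ofTuple hx hxΛ]

theorem lintegral_poisson_pow_count_lt_top [NeZero d] (hΛ : IsBounded Λ) (hm : MeasurableSet Λ)
    (y : ℝ≥0) : ∫⁻ η, (y : ℝ≥0∞) ^ count Λ η ∂(poisson Λ) < ∞ := by
  rw [lintegral_poisson_comp_count hΛ hm fun n => (y : ℝ≥0∞) ^ n]
  refine ENNReal.mul_lt_top (poissonConst_ne_top Λ).lt_top ?_
  lift volume Λ to ℝ≥0 using hΛ.measure_lt_top.ne with v
  have hsummable : Summable fun n : ℕ => (n.factorial : ℝ≥0)⁻¹ * (y ^ n * v ^ n) := by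
    rw [← NNReal.summable_coe]
    refine (Real.summable_pow_div_factorial ((y : ℝ) * v)).congr fun n => ?_
    push_cast
    ring
  convert (ENNReal.tsum_coe_ne_top_iff_summable.2 hsummable).lt_top using 3 with n
  rw [ENNReal.coe_mul, ENNReal.coe_inv (by positivity)]
  push_cast
  rfl

theorem isFiniteMeasure_poisson [NeZero d] (hΛ : IsBounded Λ) (hm : MeasurableSet Λ) :
    IsFiniteMeasure (poisson Λ) :=
  ⟨by simpa using lintegral_poisson_pow_count_lt_top hΛ hm 1⟩

theorem lintegral_tupleMeasure_sum_points [NeZero d] (hΛ : IsBounded Λ) (hm : MeasurableSet Λ)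
    {f : Config d → E d → ℝ≥0∞} (hf : Measurable (Function.uncurry f)) (n : ℕ) :
    ∫⁻ x, ∑ y ∈ (ofTuple x).points hΛ, f (ofTuple x) y ∂(tupleMeasure Λ (n + 1)) =
      (n + 1 : ℕ) * ∫⁻ x, (∫⁻ a in Λ, f ((ofTuple x).add a) a) ∂(tupleMeasure Λ n) := by
  have hsum : ∫⁻ x, ∑ y ∈ (ofTuple x).points hΛ, f (ofTuple x) y ∂(tupleMeasure Λ (n + 1)) =
      ∫⁻ x, ∑ i : Fin (n + 1), f (ofTuple x) (x i) ∂(tupleMeasure Λ (n + 1)) := by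
    refine lintegral_congr_ae ?_
    filter_upwards [ae_injective_tupleMeasure Λ (n + 1), ae_mem_tupleMeasure hm (n + 1)]
      with x hx hxΛ
    exact sum_points_ofTuple hΛ hx hxΛ _
  have hterm (i : Fin (n + 1)) : ∫⁻ x, f (ofTuple x) (x i) ∂(tupleMeasure Λ (n + 1)) =
      ∫⁻ x, (∫⁻ a in Λ, f ((ofTuple x).add a) a) ∂(tupleMeasure Λ n) := by
    have hmeas : Measurable fun p : E d × (Fin n → E d) => f ((ofTuple p.2).add p.1) p.1 :=
      hf.comp ((measurable_add.comp (((measurable_ofTuple n).comp measurable_snd).prodMk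
        measurable_fst)).prodMk measurable_fst)
    rw [← lintegral_tupleMeasure_succ Λ i hmeas]
    simp only [← ofTuple_eq_add]
  have hmeas (i : Fin (n + 1)) : Measurable fun x : Fin (n + 1) → E d => f (ofTuple x) (x i) :=
    hf.comp ((measurable_ofTuple _).prodMk (measurable_pi_apply i))
  rw [hsum, lintegral_finsetSum _ fun i _ => hmeas i]
  simp [hterm]

theorem lintegral_poisson_sum_points [NeZero d] (hΛ : IsBounded Λ) (hm : MeasurableSet Λ)
    {f : Config d → E d → ℝ≥0∞} (hf : Measurable (Function.uncurry f)) :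
    ∫⁻ η, ∑ x ∈ η.points hΛ, f η x ∂(poisson Λ) =
      ∫⁻ η, (∫⁻ x in Λ, f (η.add x) x) ∂(poisson Λ) := by
  have hbirth : Measurable fun η : Config d => ∫⁻ x in Λ, f (η.add x) x :=
    (hf.comp (measurable_add.prodMk measurable_snd)).lintegral_prod_right'
  rw [lintegral_poisson Λ (measurable_sum_points hΛ hm hf), lintegral_poisson Λ hbirth,
    tsum_eq_zero_add' ENNReal.summable]
  have hzero (x : Fin 0 → E d) : ∑ y ∈ (ofTuple x).points hΛ, f (ofTuple x) y = 0 := by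
    rw [sum_points_ofTuple hΛ (Function.injective_of_subsingleton x) fun i => i.elim0]
    simp
  simp only [hzero, lintegral_zero, mul_zero, zero_add]
  congr! 3 with n
  have hn : ((n + 1 : ℕ) : ℝ≥0∞) ≠ 0 := by simp
  rw [lintegral_tupleMeasure_sum_points hΛ hm hf, Nat.factorial_succ, Nat.cast_mul,
    ENNReal.mul_inv (Or.inl hn) (Or.inl (ENNReal.natCast_ne_top _)), mul_comm (_⁻¹) (_⁻¹),
    mul_assoc, ← mul_assoc (_⁻¹) ((n + 1 : ℕ) : ℝ≥0∞),
    ENNReal.inv_mul_cancel hn (ENNReal.natCast_ne_top _), one_mul]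

theorem ae_restrict_notMem_carrier [NeZero d] (hΛ : IsBounded Λ) (η : Config d) :
    ∀ᵐ x ∂(volume.restrict Λ), x ∉ η.carrier := by
  rw [← measure_eq_zero_iff_ae_notMem,
    Measure.restrict_apply η.isClosed_carrier.measurableSet]
  exact (η.finite_inter Λ hΛ).measure_zero _

theorem ae_restrict_count_add [NeZero d] (hΛ : IsBounded Λ) (hm : MeasurableSet Λ)
    (η : Config d) : ∀ᵐ x ∂(volume.restrict Λ), count Λ (η.add x) = count Λ η + 1 := by
  classical
  filter_upwards [ae_restrict_notMem_carrier hΛ η, ae_restrict_mem hm] with x hx hxΛ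
  rw [count_add hΛ, if_pos ⟨hxΛ, hx⟩]

theorem lintegral_poisson_birth [NeZero d] (hΛ : IsBounded Λ) (hm : MeasurableSet Λ)
    (W : ℕ → ℝ≥0∞) {F : Config d → ℝ≥0∞} (hF : Measurable F) :
    ∫⁻ η, W (count Λ η) * (∫⁻ x in Λ, F (η.add x)) ∂(poisson Λ) =
      ∫⁻ η, count Λ η * W (count Λ η - 1) * F η ∂(poisson Λ) := by
  have hadd (η : Config d) : Measurable fun x => F (η.add x) :=
    hF.comp (Config.measurable_add.comp measurable_prodMk_left)
  have hmeas : Measurable fun η : Config d => W (count Λ η - 1) * F η :=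
    (measurable_comp_count hΛ hm fun n => W (n - 1)).mul hF
  calc ∫⁻ η, W (count Λ η) * (∫⁻ x in Λ, F (η.add x)) ∂(poisson Λ)
      = ∫⁻ η, (∫⁻ x in Λ, W (count Λ (η.add x) - 1) * F (η.add x)) ∂(poisson Λ) := by
        refine lintegral_congr fun η => ?_
        rw [← lintegral_const_mul _ (hadd η)]
        refine lintegral_congr_ae ?_
        filter_upwards [ae_restrict_count_add hΛ hm η] with x hx
        rw [hx, Nat.add_sub_cancel]
    _ = ∫⁻ η, ∑ _x ∈ η.points hΛ, W (count Λ η - 1) * F η ∂(poisson Λ) :=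
        (lintegral_poisson_sum_points hΛ hm (f := fun η _ => W (count Λ η - 1) * F η)
          (hmeas.comp measurable_fst)).symm
    _ = ∫⁻ η, count Λ η * W (count Λ η - 1) * F η ∂(poisson Λ) := by
        simp only [Finset.sum_const, nsmul_eq_mul, card_points, mul_assoc]

theorem lintegral_poisson_death [NeZero d] (hΛ : IsBounded Λ) (hm : MeasurableSet Λ)
    (W : ℕ → ℝ≥0∞) {F : Config d → ℝ≥0∞} (hF : Measurable F) :
    ∫⁻ η, W (count Λ η) * ∑ x ∈ η.points hΛ, F (η.remove x) ∂(poisson Λ) =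
      ∫⁻ η, volume Λ * W (count Λ η + 1) * F η ∂(poisson Λ) := by
  have hmeas : Measurable (Function.uncurry fun (η : Config d) x =>
      W (count Λ η) * F (η.remove x)) :=
    ((measurable_comp_count hΛ hm W).comp measurable_fst).mul (hF.comp measurable_remove)
  simp_rw [Finset.mul_sum]
  rw [lintegral_poisson_sum_points hΛ hm hmeas]
  refine lintegral_congr fun η => ?_
  calc ∫⁻ x in Λ, W (count Λ (η.add x)) * F ((η.add x).remove x)
      = ∫⁻ _x in Λ, W (count Λ η + 1) * F η := by
        refine lintegral_congr_ae ?_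
        filter_upwards [ae_restrict_count_add hΛ hm η, ae_restrict_notMem_carrier hΛ η]
          with x hcount hx
        rw [hcount, remove_add_of_notMem hx]
    _ = volume Λ * W (count Λ η + 1) * F η := by
        rw [setLIntegral_const]
        ring

end Poisson

/-- The function `F` on configurations depends on the points in `Λ` only. -/
def IsLocalOn {α : Type*} (Λ : Set (E d)) (F : Config d → α) : Prop :=
  ∀ η, F (η.restrict Λ) = F η

theorem IsLocalOn.indicator_one {M : Type*} [Zero M] [One M] {Λ : Set (E d)} {A : Set (Config d)}
    (hA : IsLocalOn Λ (· ∈ A)) : IsLocalOn Λ (A.indicator (1 : Config d → M)) := fun η => by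
  classical simp only [Set.indicator_apply, hA η, Pi.one_apply]

theorem IsLocalOn.add_of_notMem {α : Type*} {Λ : Set (E d)} {F : Config d → α}
    (hF : IsLocalOn Λ F) {x : E d} (hx : x ∉ Λ) (η : Config d) : F (η.add x) = F η := by
  rw [← hF, restrict_add_of_notMem hx, hF]

theorem IsLocalOn.remove_of_notMem {α : Type*} {Λ : Set (E d)} {F : Config d → α}
    (hF : IsLocalOn Λ F) {x : E d} (hx : x ∉ Λ) (η : Config d) : F (η.remove x) = F η := by
  rw [← hF, restrict_remove_of_notMem hx, hF]

theorem isLocalOn_count (Λ : Set (E d)) : IsLocalOn Λ (count Λ) := fun η => by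
  rw [count_restrict, Set.inter_self]

/-- A positive operator that dominates a birth-and-death generator with birth rate at most `c` on
functions of the points in `Λ`: gains and losses are added instead of subtracted. -/
noncomputable def domOp (c : ℝ≥0) {Λ : Set (E d)} (hΛ : IsBounded Λ)
    (F : Config d → ℝ≥0∞) (η : Config d) : ℝ≥0∞ :=
  c * (∫⁻ x in Λ, F (η.add x)) + ∑ x ∈ η.points hΛ, F (η.remove x) +
    (c * volume Λ + count Λ η) * F η

/-- The adjoint of `domOp` with respect to the Poisson process, on functions of the number of
points; `v` is the volume of the region. -/
noncomputable def dualOp (c : ℝ≥0) (v : ℝ≥0∞) (W : ℕ → ℝ≥0∞) (n : ℕ) : ℝ≥0∞ :=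
  c * (n * W (n - 1)) + v * W (n + 1) + (c * v + n) * W n

section domOp

variable (c : ℝ≥0) {Λ : Set (E d)} (hΛ : IsBounded Λ)

theorem measurable_lintegral_add (Λ : Set (E d)) {F : Config d → ℝ≥0∞} (hF : Measurable F) :
    Measurable fun η : Config d => ∫⁻ x in Λ, F (η.add x) :=
  (hF.comp Config.measurable_add).lintegral_prod_right'

theorem measurable_sum_remove (hm : MeasurableSet Λ) {F : Config d → ℝ≥0∞} (hF : Measurable F) :
    Measurable fun η : Config d => ∑ x ∈ η.points hΛ, F (η.remove x) :=
  measurable_sum_points hΛ hm (hF.comp measurable_remove)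

theorem measurable_domOp (hm : MeasurableSet Λ) {F : Config d → ℝ≥0∞} (hF : Measurable F) :
    Measurable (domOp c hΛ F) :=
  (((measurable_lintegral_add Λ hF).const_mul _).add (measurable_sum_remove hΛ hm hF)).add
    ((measurable_comp_count hΛ hm fun n => c * volume Λ + n).mul hF)

theorem measurable_domOp_iterate (hm : MeasurableSet Λ) {F : Config d → ℝ≥0∞} (hF : Measurable F)
    (k : ℕ) : Measurable ((domOp c hΛ)^[k] F) := by
  induction k with
  | zero => exact hF
  | succ k ih =>
    rw [Function.iterate_succ_apply']
    exact measurable_domOp c hΛ hm ih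

theorem domOp_mono : Monotone (domOp (d := d) c hΛ) := by
  intro F G h η
  unfold domOp
  gcongr <;> exact h _

theorem isLocalOn_domOp (hm : MeasurableSet Λ) {F : Config d → ℝ≥0∞}
    (hF : IsLocalOn Λ F) : IsLocalOn Λ (domOp c hΛ F) := by
  intro η
  have hbirth : ∫⁻ x in Λ, F ((η.restrict Λ).add x) = ∫⁻ x in Λ, F (η.add x) :=
    setLIntegral_congr_fun hm fun x hx => by rw [← restrict_add_of_mem hx, hF]
  have hdeath : ∑ x ∈ (η.restrict Λ).points hΛ, F ((η.restrict Λ).remove x) =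
      ∑ x ∈ η.points hΛ, F (η.remove x) := by
    rw [points_restrict]
    exact Finset.sum_congr rfl fun x _ => by rw [← restrict_remove, hF]
  rw [domOp, hbirth, hdeath, hF, count_restrict, Set.inter_self, domOp]

theorem isLocalOn_domOp_iterate (hm : MeasurableSet Λ) {F : Config d → ℝ≥0∞}
    (hF : IsLocalOn Λ F) (k : ℕ) : IsLocalOn Λ ((domOp c hΛ)^[k] F) := by
  induction k with
  | zero => exact hF
  | succ k ih =>
    rw [Function.iterate_succ_apply']
    exact isLocalOn_domOp c hΛ hm ih

theorem lintegral_poisson_domOp [NeZero d] (hm : MeasurableSet Λ) (W : ℕ → ℝ≥0∞)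
    {F : Config d → ℝ≥0∞} (hF : Measurable F) :
    ∫⁻ η, W (count Λ η) * domOp c hΛ F η ∂(poisson Λ) =
      ∫⁻ η, dualOp c (volume Λ) W (count Λ η) * F η ∂(poisson Λ) := by
  have hmul (V : ℕ → ℝ≥0∞) {G : Config d → ℝ≥0∞} (hG : Measurable G) :
      Measurable fun η : Config d => V (count Λ η) * G η :=
    (measurable_comp_count hΛ hm V).mul hG
  have hloss := hmul (fun n => (c * volume Λ + n) * W n) hF
  calc ∫⁻ η, W (count Λ η) * domOp c hΛ F η ∂(poisson Λ)
      = ∫⁻ η, c * (W (count Λ η) * ∫⁻ x in Λ, F (η.add x)) +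
          W (count Λ η) * (∑ x ∈ η.points hΛ, F (η.remove x)) +
          (c * volume Λ + count Λ η) * W (count Λ η) * F η ∂(poisson Λ) := by
        refine lintegral_congr fun η => ?_
        unfold domOp
        ring
    _ = c * ∫⁻ η, count Λ η * W (count Λ η - 1) * F η ∂(poisson Λ) +
          ∫⁻ η, volume Λ * W (count Λ η + 1) * F η ∂(poisson Λ) +
          ∫⁻ η, (c * volume Λ + count Λ η) * W (count Λ η) * F η ∂(poisson Λ) := by
        rw [lintegral_add_right _ hloss,
          lintegral_add_right _ (hmul W (measurable_sum_remove hΛ hm hF)),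
          lintegral_const_mul _ (hmul W (measurable_lintegral_add Λ hF)),
          lintegral_poisson_birth hΛ hm W hF, lintegral_poisson_death hΛ hm W hF]
    _ = ∫⁻ η, c * (count Λ η * W (count Λ η - 1) * F η) + volume Λ * W (count Λ η + 1) * F η +
          (c * volume Λ + count Λ η) * W (count Λ η) * F η ∂(poisson Λ) := by
        rw [lintegral_add_right _ hloss,
          lintegral_add_right _ (hmul (fun n => volume Λ * W (n + 1)) hF),
          lintegral_const_mul _ (hmul (fun n => n * W (n - 1)) hF)]
    _ = ∫⁻ η, dualOp c (volume Λ) W (count Λ η) * F η ∂(poisson Λ) := by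
        refine lintegral_congr fun η => ?_
        unfold dualOp
        ring

theorem lintegral_poisson_domOp_iterate [NeZero d] (hm : MeasurableSet Λ) (W : ℕ → ℝ≥0∞)
    {F : Config d → ℝ≥0∞} (hF : Measurable F) (k : ℕ) :
    ∫⁻ η, W (count Λ η) * (domOp c hΛ)^[k] F η ∂(poisson Λ) =
      ∫⁻ η, (dualOp c (volume Λ))^[k] W (count Λ η) * F η ∂(poisson Λ) := by
  induction k generalizing W with
  | zero => rfl
  | succ k ih =>
    rw [Function.iterate_succ_apply', lintegral_poisson_domOp c hΛ hm W
      (measurable_domOp_iterate c hΛ hm hF k), ih, ← Function.iterate_succ_apply]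

theorem domOp_comp_count_le {W : ℕ → ℝ≥0∞} (hW : Monotone W) (η : Config d) :
    domOp c hΛ (fun η => W (count Λ η)) η ≤
      c * volume Λ * W (count Λ η + 1) + (c * volume Λ + 2 * count Λ η) * W (count Λ η) := by
  have hbirth : (∫⁻ x in Λ, W (count Λ (η.add x))) ≤ volume Λ * W (count Λ η + 1) := by
    calc (∫⁻ x in Λ, W (count Λ (η.add x))) ≤ ∫⁻ x in Λ, W (count Λ η + 1) := by
          refine lintegral_mono fun x => hW ?_
          rw [count_add hΛ]
          split_ifs <;> omega
      _ = volume Λ * W (count Λ η + 1) := by rw [setLIntegral_const, mul_comm]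
  have hdeath : ∑ x ∈ η.points hΛ, W (count Λ (η.remove x)) ≤ count Λ η * W (count Λ η) := by
    rw [← card_points η hΛ, ← nsmul_eq_mul]
    refine Finset.sum_le_card_nsmul _ _ _ fun x _ => hW ?_
    rw [count_remove, card_points]
    exact Nat.sub_le _ _
  calc domOp c hΛ (fun η => W (count Λ η)) η
      ≤ c * (volume Λ * W (count Λ η + 1)) + count Λ η * W (count Λ η) +
        (c * volume Λ + count Λ η) * W (count Λ η) := by
        unfold domOp; gcongr
    _ = c * volume Λ * W (count Λ η + 1) + (c * volume Λ + 2 * count Λ η) * W (count Λ η) := by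
        ring

theorem domOp_pow_count_le {A y : ℝ≥0} (hy : 1 ≤ y) (η : Config d) :
    domOp c hΛ (fun η => A * (y : ℝ≥0∞) ^ count Λ η) η ≤
      (A * (c * volume Λ * (y + 1) + 2)) * (2 * y : ℝ≥0∞) ^ count Λ η := by
  have hy' : (1 : ℝ≥0∞) ≤ y := by exact_mod_cast hy
  have hmono : Monotone fun n : ℕ => A * (y : ℝ≥0∞) ^ n := fun m n h => by
    beta_reduce; gcongr
  refine (domOp_comp_count_le c hΛ hmono η).trans ?_
  generalize count Λ η = n
  have hone : (1 : ℝ≥0∞) ≤ 2 ^ n := one_le_pow₀ one_le_two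
  have hn : (n : ℝ≥0∞) ≤ 2 ^ n := by exact_mod_cast (Nat.lt_two_pow_self (n := n)).le
  calc c * volume Λ * (A * (y : ℝ≥0∞) ^ (n + 1)) +
        (c * volume Λ + 2 * n) * (A * (y : ℝ≥0∞) ^ n)
      = (A * (c * volume Λ * (y + 1) * 1 + 2 * n)) * (y : ℝ≥0∞) ^ n := by ring
    _ ≤ (A * (c * volume Λ * (y + 1) * 2 ^ n + 2 * 2 ^ n)) * (y : ℝ≥0∞) ^ n := by gcongr
    _ = (A * (c * volume Λ * (y + 1) + 2)) * (2 * y : ℝ≥0∞) ^ n := by ring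

end domOp

/-- A constant that governs the growth of the iterates of `domOp` and `dualOp`. -/
noncomputable def growthConst (c : ℝ≥0) (v : ℝ≥0∞) : ℝ≥0∞ := 2 * c * v + c + v + 2

theorem dualOp_mono (c : ℝ≥0) (v : ℝ≥0∞) : Monotone (dualOp c v) := by
  intro W W' h n
  unfold dualOp
  gcongr <;> exact h _

theorem dualOp_ascFactorial_mul_pow_le (c : ℝ≥0) (v a : ℝ≥0∞) {z : ℝ≥0} (hz : 1 ≤ z) (k n : ℕ) :
    dualOp c v (fun m => a * (m + 1).ascFactorial k * (z : ℝ≥0∞) ^ (m + k)) n ≤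
      a * growthConst c v * (n + 1).ascFactorial (k + 1) * (z : ℝ≥0∞) ^ (n + (k + 1)) := by
  have hz' : (1 : ℝ≥0∞) ≤ z := by exact_mod_cast hz
  set B : ℝ≥0∞ := (((n + 1).ascFactorial (k + 1) : ℕ) : ℝ≥0∞) with hB
  have hpred : (n : ℝ≥0∞) * ((n - 1 + 1).ascFactorial k : ℕ) ≤ B := by
    rw [hB]
    exact_mod_cast (Nat.mul_le_mul le_rfl (Nat.ascFactorial_le k (by omega))).trans
      (mul_ascFactorial_le n k)
  have hsucc : (((n + 2).ascFactorial k : ℕ) : ℝ≥0∞) ≤ B := by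
    rw [hB]; exact_mod_cast succ_ascFactorial_le n k
  have hself : (((n + 1).ascFactorial k : ℕ) : ℝ≥0∞) ≤ B := by
    rw [hB]; exact_mod_cast ascFactorial_le_ascFactorial_succ n k
  have hmul : (n : ℝ≥0∞) * ((n + 1).ascFactorial k : ℕ) ≤ B := by
    rw [hB]; exact_mod_cast mul_ascFactorial_le n k
  set Z := (z : ℝ≥0∞) ^ (n + (k + 1))
  have hconst : c + v + c * v + 1 ≤ growthConst c v := by
    calc c + v + c * v + 1 ≤ (c + v + c * v + 1) + (c * v + 1) := le_self_add
      _ = growthConst c v := by rw [growthConst]; ring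
  have hpow {m : ℕ} (hmn : m ≤ n + (k + 1)) : (z : ℝ≥0∞) ^ m ≤ Z := pow_le_pow_right₀ hz' hmn
  unfold dualOp
  calc c * (n * (a * ((n - 1 + 1).ascFactorial k : ℕ) * (z : ℝ≥0∞) ^ (n - 1 + k))) +
        v * (a * ((n + 1 + 1).ascFactorial k : ℕ) * (z : ℝ≥0∞) ^ (n + 1 + k)) +
        (c * v + n) * (a * ((n + 1).ascFactorial k : ℕ) * (z : ℝ≥0∞) ^ (n + k))
      = a * (c * (n * ((n - 1 + 1).ascFactorial k : ℕ)) * (z : ℝ≥0∞) ^ (n - 1 + k) +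
        v * ((n + 2).ascFactorial k : ℕ) * (z : ℝ≥0∞) ^ (n + 1 + k) +
        (c * v * ((n + 1).ascFactorial k : ℕ) + n * ((n + 1).ascFactorial k : ℕ)) *
          (z : ℝ≥0∞) ^ (n + k)) := by ring
    _ ≤ a * (c * B * Z + v * B * Z + (c * v * B + B) * Z) := by
        gcongr <;> exact hpow (by omega)
    _ = a * (c + v + c * v + 1) * B * Z := by ring
    _ ≤ a * growthConst c v * B * Z := by gcongr

theorem dualOp_iterate_pow_le (c : ℝ≥0) (v : ℝ≥0∞) {z : ℝ≥0} (hz : 1 ≤ z) (k n : ℕ) :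
    (dualOp c v)^[k] (fun n => (z : ℝ≥0∞) ^ n) n ≤
      growthConst c v ^ k * (n + 1).ascFactorial k * (z : ℝ≥0∞) ^ (n + k) := by
  induction k generalizing n with
  | zero => simp
  | succ k ih =>
    rw [Function.iterate_succ_apply', pow_succ]
    exact (dualOp_mono c v ih n).trans (dualOp_ascFactorial_mul_pow_le c v _ hz k n)

theorem domOp_ascFactorial_count_le (c : ℝ≥0) {Λ : Set (E d)} (hΛ : IsBounded Λ) (a : ℝ≥0∞)
    (k : ℕ) (η : Config d) :
    domOp c hΛ (fun η => a * (count Λ η + 1).ascFactorial k) η ≤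
      a * growthConst c (volume Λ) * (count Λ η + 1).ascFactorial (k + 1) := by
  have hmono : Monotone fun n : ℕ => a * ((n + 1).ascFactorial k : ℕ) := by
    intro m n h
    beta_reduce
    gcongr
  refine (domOp_comp_count_le c hΛ hmono η).trans ?_
  generalize count Λ η = n
  set B : ℝ≥0∞ := (((n + 1).ascFactorial (k + 1) : ℕ) : ℝ≥0∞) with hB
  have hsucc : (((n + 2).ascFactorial k : ℕ) : ℝ≥0∞) ≤ B := by
    rw [hB]; exact_mod_cast succ_ascFactorial_le n k
  have hself : (((n + 1).ascFactorial k : ℕ) : ℝ≥0∞) ≤ B := by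
    rw [hB]; exact_mod_cast ascFactorial_le_ascFactorial_succ n k
  have hmul : (n : ℝ≥0∞) * ((n + 1).ascFactorial k : ℕ) ≤ B := by
    rw [hB]; exact_mod_cast mul_ascFactorial_le n k
  have hconst : 2 * c * volume Λ + 2 ≤ growthConst c (volume Λ) := by
    calc 2 * c * volume Λ + 2 ≤ (2 * c * volume Λ + 2) + (c + volume Λ) := le_self_add
      _ = growthConst c (volume Λ) := by rw [growthConst]; ring
  calc c * volume Λ * (a * ((n + 1 + 1).ascFactorial k : ℕ)) +
        (c * volume Λ + 2 * n) * (a * ((n + 1).ascFactorial k : ℕ))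
      = a * (c * volume Λ * ((n + 2).ascFactorial k : ℕ) +
        c * volume Λ * ((n + 1).ascFactorial k : ℕ) +
        2 * (n * ((n + 1).ascFactorial k : ℕ))) := by ring
    _ ≤ a * (c * volume Λ * B + c * volume Λ * B + 2 * B) := by gcongr
    _ = a * (2 * c * volume Λ + 2) * B := by ring
    _ ≤ a * growthConst c (volume Λ) * B := by gcongr

theorem domOp_iterate_one_le (c : ℝ≥0) {Λ : Set (E d)} (hΛ : IsBounded Λ) (k : ℕ)
    (η : Config d) :
    (domOp c hΛ)^[k] (fun _ => 1) η ≤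
      growthConst c (volume Λ) ^ k * (k.factorial * 2 ^ k) * 2 ^ count Λ η := by
  have hasc : (domOp c hΛ)^[k] (fun _ => 1) η ≤
      growthConst c (volume Λ) ^ k * ((count Λ η + 1).ascFactorial k : ℕ) := by
    induction k generalizing η with
    | zero => simp
    | succ k ih =>
      rw [Function.iterate_succ_apply', pow_succ]
      exact (domOp_mono c hΛ ih η).trans (domOp_ascFactorial_count_le c hΛ _ k η)
  calc (domOp c hΛ)^[k] (fun _ => 1) η
      ≤ growthConst c (volume Λ) ^ k * ((count Λ η + 1).ascFactorial k : ℕ) := hasc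
    _ ≤ growthConst c (volume Λ) ^ k * ((k.factorial * 2 ^ (count Λ η + k) : ℕ) : ℝ≥0∞) := by
        gcongr
        exact ascFactorial_le_factorial_mul_two_pow _ k
    _ = growthConst c (volume Λ) ^ k * (k.factorial * 2 ^ k) * 2 ^ count Λ η := by
        push_cast
        ring

theorem measurableSet_box (d n : ℕ) : MeasurableSet (box d n) := by
  unfold box
  simp_rw [Set.ofPred_forall, Set.ofPred_and]
  refine MeasurableSet.iInter fun i => MeasurableSet.inter ?_ ?_
  · exact measurableSet_le measurable_const (by fun_prop)
  · exact measurableSet_lt (by fun_prop) measurable_const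

theorem eventually_mem_box (x : E d) : ∀ᶠ n : ℕ in atTop, x ∈ box d n := by
  have h : Tendsto (fun n : ℕ => (n : ℝ) / 2) atTop atTop :=
    tendsto_natCast_atTop_atTop.atTop_div_const (by norm_num)
  filter_upwards [h.eventually_gt_atTop ‖x‖] with n hn i
  have hi : |x i| ≤ ‖x‖ := by simpa using PiLp.norm_apply_le x i
  obtain ⟨hl, hu⟩ := abs_le.1 hi
  constructor <;> linarith

section Energy

variable {H : Finset (E d) → ℝ}

open Classical in
theorem points_add_of_mem {B : Set (E d)} (hB : IsBounded B) {x : E d} (hx : x ∈ B)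
    (η : Config d) : (η.add x).points hB = insert x (η.points hB) := by
  ext y
  simp only [mem_points, carrier_add, Set.mem_insert_iff, Finset.mem_insert]
  constructor
  · tauto
  · rintro (rfl | h) <;> tauto

theorem points_add_sdiff_singleton {B : Set (E d)} (hB : IsBounded B)
    {x : E d} (hB' : IsBounded (B \ {x})) {η : Config d} (hx : x ∉ η.carrier) :
    (η.add x).points hB' = η.points hB := by
  ext y
  simp only [mem_points, carrier_add, Set.mem_insert_iff, Set.mem_sdiff, Set.mem_singleton_iff]
  constructor
  · tauto
  · rintro ⟨h, h'⟩
    exact ⟨Or.inr h, h', by rintro rfl; exact hx h⟩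

open Classical in
theorem condEnergyApprox_singleton_eventuallyEq {x : E d} {η : Config d} (hx : x ∉ η.carrier) :
    condEnergyApprox H {x} (η.add x) =ᶠ[atTop] fun n =>
      H (insert x (η.points (isBounded_box d n))) - H (η.points (isBounded_box d n)) := by
  filter_upwards [eventually_mem_box x] with n hn
  rw [condEnergyApprox, points_add_of_mem _ hn, points_add_sdiff_singleton _ _ hx]

open Classical in
theorem energyDiff_eventuallyEq_zero {x : E d} {η : Config d} (hx : x ∈ η.carrier) :
    (fun n => H (insert x (η.points (isBounded_box d n))) - H (η.points (isBounded_box d n)))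
      =ᶠ[atTop] fun _ => 0 := by
  filter_upwards [eventually_mem_box x] with n hn
  rw [Finset.insert_eq_of_mem (mem_points.2 ⟨hx, hn⟩), sub_self]

theorem pointEnergy_of_mem {x : E d} {η : Config d} (hx : x ∈ η.carrier) :
    pointEnergy H x η = 0 :=
  (tendsto_const_nhds.congr' (energyDiff_eventuallyEq_zero hx).symm).limUnder_eq

theorem pointEnergy_of_notMem (hH : IsAdmissible H) {x : E d} {η : Config d}
    (hx : x ∉ η.carrier) : pointEnergy H x η = condEnergy H {x} (η.add x) := by
  obtain ⟨l, hl⟩ := hH.exists_limit {x} Bornology.isBounded_singleton (measurableSet_singleton x)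
    (η.add x)
  rw [condEnergy, hl.limUnder_eq]
  exact (hl.congr' (condEnergyApprox_singleton_eventuallyEq hx)).limUnder_eq

open Classical in
theorem tendsto_pointEnergy (hH : IsAdmissible H) (x : E d) (η : Config d) :
    Tendsto (fun n =>
      H (insert x (η.points (isBounded_box d n))) - H (η.points (isBounded_box d n))) atTop
      (𝓝 (pointEnergy H x η)) := by
  by_cases hx : x ∈ η.carrier
  · rw [pointEnergy_of_mem hx]
    exact tendsto_const_nhds.congr' (energyDiff_eventuallyEq_zero hx).symm
  · obtain ⟨l, hl⟩ := hH.exists_limit {x} Bornology.isBounded_singleton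
      (measurableSet_singleton x) (η.add x)
    have hdiff := hl.congr' (condEnergyApprox_singleton_eventuallyEq hx)
    rwa [pointEnergy, hdiff.limUnder_eq]

theorem measurable_pointEnergy (hH : IsAdmissible H) :
    Measurable fun p : Config d × E d => pointEnergy H p.2 p.1 := by
  refine measurable_of_tendsto_metrizable (f := fun (n : ℕ) (p : Config d × E d) =>
    H ((p.1.add p.2).points (isBounded_box d n)) - H (p.1.points (isBounded_box d n))) ?_ ?_
  · intro n
    have hm := hH.measurable _ (isBounded_box d n) (measurableSet_box d n)
    exact (hm.comp measurable_add).sub (hm.comp measurable_fst)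
  · rw [tendsto_pi_nhds]
    rintro ⟨η, x⟩
    refine (tendsto_pointEnergy hH x η).congr' ?_
    filter_upwards [eventually_mem_box x] with n hn
    rw [points_add_of_mem _ hn]

theorem measurable_birthRate (hH : IsAdmissible H) :
    Measurable fun p : Config d × E d => birthRate H p.2 p.1 :=
  (measurable_pointEnergy hH).neg.exp

theorem birthRate_pos (x : E d) (η : Config d) : 0 < birthRate H x η := Real.exp_pos _

theorem exists_birthRate_le (hH : IsAdmissible H) :
    ∃ c : ℝ≥0, ∀ x (η : Config d), birthRate H x η ≤ c := by
  obtain ⟨C, hC⟩ := hH.bounded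
  refine ⟨⟨Real.exp C, (Real.exp_pos _).le⟩, fun x η => ?_⟩
  exact Real.exp_le_exp.2 (by linarith [neg_abs_le (pointEnergy H x η), hC x η])

theorem exists_pointEnergy_restrict (hH : IsAdmissible H) :
    ∃ R : ℝ, ∀ (x : E d) (η : Config d),
      pointEnergy H x (η.restrict (Metric.cthickening R {x})) = pointEnergy H x η := by
  obtain ⟨R, -, hR⟩ := hH.finite_range
  refine ⟨R, fun x η => ?_⟩
  have hxR : x ∈ Metric.cthickening R {x} := Metric.self_subset_cthickening _ rfl
  by_cases hx : x ∈ η.carrier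
  · rw [pointEnergy_of_mem hx, pointEnergy_of_mem]
    exact ⟨hx, hxR⟩
  · have hx' : x ∉ (η.restrict (Metric.cthickening R {x})).carrier := fun h => hx h.1
    rw [pointEnergy_of_notMem hH hx, pointEnergy_of_notMem hH hx',
      hR {x} Bornology.isBounded_singleton (measurableSet_singleton x) (η.add x),
      restrict_add_of_mem hxR]

theorem exists_birthRate_restrict (hH : IsAdmissible H) :
    ∃ R : ℝ, ∀ (Λ : Set (E d)) (x : E d), x ∈ Λ → ∀ η : Config d,
      birthRate H x (η.restrict (Metric.cthickening R Λ)) = birthRate H x η := by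
  obtain ⟨R, hR⟩ := exists_pointEnergy_restrict hH
  refine ⟨R, fun Λ x hx η => ?_⟩
  have hsub : Metric.cthickening R {x} ⊆ Metric.cthickening R Λ :=
    Metric.cthickening_subset_of_subset R (Set.singleton_subset_iff.2 hx)
  rw [birthRate, ← hR, restrict_restrict, Set.inter_eq_right.2 hsub, hR, birthRate]

open Classical in
theorem exists_tendsto_energy_union (hH : IsAdmissible H) {C : ℝ}
    (hC : ∀ (x : E d) (η : Config d), |pointEnergy H x η| ≤ C) (s : Finset (E d))
    (ζ : Config d) (hs : ∀ x ∈ s, x ∉ ζ.carrier) : ∃ l : ℝ, |l| ≤ C * s.card ∧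
      Tendsto (fun n => H (s.filter (· ∈ box d n) ∪ ζ.points (isBounded_box d n)) -
        H (ζ.points (isBounded_box d n))) atTop (𝓝 l) := by
  induction s using Finset.induction_on generalizing ζ with
  | empty => exact ⟨0, by simp, by simp⟩
  | insert a s ha ih =>
    obtain ⟨l, hl, ht⟩ := ih (ζ.add a) fun x hx hxζ => by
      rcases hxζ with rfl | hxζ
      · exact ha hx
      · exact hs x (Finset.mem_insert_of_mem hx) hxζ
    refine ⟨l + pointEnergy H a ζ, ?_, ?_⟩
    · rw [Finset.card_insert_of_notMem ha]
      push_cast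
      linarith [abs_add_le l (pointEnergy H a ζ), hC a ζ]
    · refine (ht.add (tendsto_pointEnergy hH a ζ)).congr' ?_
      filter_upwards [eventually_mem_box a] with n hn
      rw [points_add_of_mem _ hn, Finset.filter_insert, if_pos hn, Finset.union_insert,
        Finset.insert_union]
      ring

theorem abs_condEnergy_le (hH : IsAdmissible H) {C : ℝ}
    (hC : ∀ (x : E d) (η : Config d), |pointEnergy H x η| ≤ C) {Λ : Set (E d)}
    (hΛ : IsBounded Λ) (η : Config d) :
    |condEnergy H Λ η| ≤ C * count Λ η := by
  classical
  obtain ⟨l, hl, ht⟩ := exists_tendsto_energy_union hH hC (η.points hΛ) (η.restrict Λᶜ)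
    fun x hx hxΛ => hxΛ.2 (mem_points.1 hx).2
  rw [card_points] at hl
  have hcond : condEnergy H Λ η = l := by
    refine Tendsto.limUnder_eq (ht.congr fun n => ?_)
    rw [condEnergyApprox]
    congr 2 <;> ext y <;>
      simp only [Finset.mem_union, Finset.mem_filter, mem_points, carrier_restrict,
        Set.mem_inter_iff, Set.mem_compl_iff, Set.mem_sdiff] <;>
      tauto
  rwa [hcond]

theorem count_glue (Λ : Set (E d)) (η ω : Config d) : count Λ (glue Λ η ω) = count Λ η := by
  rw [count, count]
  congr 1
  ext x
  simp only [glue, Set.mem_inter_iff, Set.mem_union, Set.mem_sdiff]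
  tauto

theorem restrict_glue (Λ : Set (E d)) (η ω : Config d) :
    (glue Λ η ω).restrict Λ = η.restrict Λ := by
  ext x
  simp only [glue, carrier_restrict, Set.mem_inter_iff, Set.mem_union, Set.mem_sdiff]
  tauto

end Energy

section Comparison

/-- Two-sided comparison of a measure with a Poisson process in `Λ`, with densities
`a z^{N_Λ}` and `(a z^{N_Λ})⁻¹`, tested on functions. -/
structure IsPoissonComparable (Λ : Set (E d)) (m : Measure (Config d)) (a z : ℝ≥0) : Prop where
  one_le_const : 1 ≤ a
  one_le_base : 1 ≤ z
  le : ∀ F : Config d → ℝ≥0∞, Measurable F →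
    ∫⁻ η, F η ∂m ≤ ∫⁻ η, (a * (z : ℝ≥0∞) ^ count Λ η) * F η ∂(poisson Λ)
  ge : ∀ F : Config d → ℝ≥0∞, Measurable F →
    ∫⁻ η, F η ∂(poisson Λ) ≤ ∫⁻ η, (a * (z : ℝ≥0∞) ^ count Λ η) * F η ∂m

variable {Λ : Set (E d)} {a z : ℝ≥0}

theorem isPoissonComparable_withDensity (hΛ : IsBounded Λ) (hm : MeasurableSet Λ) (ha : 1 ≤ a)
    (hz : 1 ≤ z) {w : Config d → ℝ≥0∞}
    (hge : ∀ᵐ η ∂(poisson Λ), (a * (z : ℝ≥0∞) ^ count Λ η)⁻¹ ≤ w η)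
    (hle : ∀ᵐ η ∂(poisson Λ), w η ≤ a * (z : ℝ≥0∞) ^ count Λ η) :
    IsPoissonComparable Λ ((poisson Λ).withDensity w) a z := by
  set u : Config d → ℝ≥0∞ := fun η => a * (z : ℝ≥0∞) ^ count Λ η
  have hu : Measurable u := measurable_comp_count hΛ hm fun n => a * (z : ℝ≥0∞) ^ n
  have hu0 (η : Config d) : u η ≠ 0 := mul_ne_zero
    (ENNReal.coe_ne_zero.2 (one_pos.trans_le ha).ne')
    (pow_ne_zero _ (ENNReal.coe_ne_zero.2 (one_pos.trans_le hz).ne'))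
  have hut (η : Config d) : u η ≠ ∞ :=
    ENNReal.mul_ne_top ENNReal.coe_ne_top (ENNReal.pow_ne_top ENNReal.coe_ne_top)
  refine ⟨ha, hz, fun F hF => ?_, fun F hF => ?_⟩
  · calc ∫⁻ η, F η ∂((poisson Λ).withDensity w)
        ≤ ∫⁻ η, F η ∂((poisson Λ).withDensity u) :=
          lintegral_mono' (withDensity_mono hle) le_rfl
      _ = ∫⁻ η, u η * F η ∂(poisson Λ) := lintegral_withDensity_eq_lintegral_mul _ hu hF
  · calc ∫⁻ η, F η ∂(poisson Λ) = ∫⁻ η, (u η)⁻¹ * (u η * F η) ∂(poisson Λ) := by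
          refine lintegral_congr fun η => ?_
          rw [← mul_assoc, ENNReal.inv_mul_cancel (hu0 η) (hut η), one_mul]
      _ = ∫⁻ η, u η * F η ∂((poisson Λ).withDensity fun η => (u η)⁻¹) :=
          (lintegral_withDensity_eq_lintegral_mul _ hu.inv (hu.mul hF)).symm
      _ ≤ ∫⁻ η, u η * F η ∂((poisson Λ).withDensity w) :=
          lintegral_mono' (withDensity_mono hge) le_rfl

theorem lintegral_poisson_restrict (hm : MeasurableSet Λ) {F : Config d → ℝ≥0∞}
    (hF : Measurable F) :
    ∫⁻ η, F (η.restrict Λ) ∂(poisson Λ) = ∫⁻ η, F η ∂(poisson Λ) := by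
  rw [lintegral_poisson Λ (F := fun η => F (η.restrict Λ)) (hF.comp (measurable_restrict hm)),
    lintegral_poisson Λ hF]
  congr! 4 with n
  refine lintegral_congr_ae ?_
  filter_upwards [ae_mem_tupleMeasure hm n] with x hx
  congr 1
  ext y
  simp only [carrier_restrict, carrier_ofTuple, Set.mem_inter_iff, Set.mem_range,
    and_iff_left_iff_imp]
  rintro ⟨i, rfl⟩
  exact hx i

theorem lintegral_marginal (hm : MeasurableSet Λ) (μ : Measure (Config d))
    {F : Config d → ℝ≥0∞} (hF : Measurable F) :
    ∫⁻ η, F η ∂(marginal μ Λ) = ∫⁻ η, F (η.restrict Λ) ∂μ :=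
  lintegral_map hF (measurable_restrict hm)

theorem IsPoissonComparable.marginal (hΛ : IsBounded Λ) (hm : MeasurableSet Λ)
    {m : Measure (Config d)} (h : IsPoissonComparable Λ m a z) :
    IsPoissonComparable Λ (marginal m Λ) a z := by
  have hself (η : Config d) : count Λ (η.restrict Λ) = count Λ η := by
    rw [count_restrict, Set.inter_self]
  have hmul {F : Config d → ℝ≥0∞} (hF : Measurable F) :
      Measurable fun η : Config d => (a * (z : ℝ≥0∞) ^ count Λ η) * F η :=
    (measurable_comp_count hΛ hm fun n => a * (z : ℝ≥0∞) ^ n).mul hF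
  refine ⟨h.one_le_const, h.one_le_base, fun F hF => ?_, fun F hF => ?_⟩
  · rw [lintegral_marginal hm m hF, ← lintegral_poisson_restrict hm (hmul hF)]
    simpa only [hself] using
      h.le (fun η => F (η.restrict Λ)) (hF.comp (measurable_restrict hm))
  · rw [lintegral_marginal hm m (hmul hF), ← lintegral_poisson_restrict hm hF]
    simpa only [hself] using
      h.ge (fun η => F (η.restrict Λ)) (hF.comp (measurable_restrict hm))

theorem IsRegular.exists_isPoissonComparable [NeZero d] {μ : Measure (Config d)}
    [IsProbabilityMeasure μ] (hμ : IsRegular μ) (hΛ : IsBounded Λ) (hm : MeasurableSet Λ) :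
    ∃ a z : ℝ≥0, IsPoissonComparable Λ (BirthDeath.marginal μ Λ) a z := by
  have := isFiniteMeasure_poisson hΛ hm
  have : IsFiniteMeasure (BirthDeath.marginal μ Λ) := by
    unfold BirthDeath.marginal
    infer_instance
  obtain ⟨hac, z, c, hz, hc, hbounds⟩ := hμ.2 Λ hΛ hm
  refine ⟨max 1 c.toNNReal, max 1 z.toNNReal, ?_⟩
  rw [← Measure.withDensity_rnDeriv_eq _ _ hac]
  refine isPoissonComparable_withDensity hΛ hm (le_max_left _ _) (le_max_left _ _) ?_ ?_
  · filter_upwards [hbounds] with η hη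
    refine le_trans ?_ hη.1
    rw [← mul_inv, ENNReal.ofReal_inv_of_pos (by positivity)]
    exact ENNReal.inv_le_inv.2 (ofReal_mul_pow_le hc.le hz.le _)
  · filter_upwards [hbounds] with η hη
    exact hη.2.trans (ofReal_mul_pow_le hc.le hz.le _)

end Comparison

section Gibbs

variable {H : Finset (E d) → ℝ} {Λ : Set (E d)} {C : ℝ}

theorem gibbsWeight_le (hH : IsAdmissible H)
    (hC : ∀ (x : E d) (η : Config d), |pointEnergy H x η| ≤ C) (hΛ : IsBounded Λ)
    (ω η : Config d) : gibbsWeight H Λ ω η ≤ ENNReal.ofReal (Real.exp C) ^ count Λ η := by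
  rw [← ofReal_exp_mul_natCast, ← count_glue Λ η ω]
  refine ENNReal.ofReal_le_ofReal (Real.exp_le_exp.2 ?_)
  linarith [(abs_le.1 (abs_condEnergy_le hH hC hΛ (glue Λ η ω))).1]

theorem inv_le_gibbsWeight (hH : IsAdmissible H)
    (hC : ∀ (x : E d) (η : Config d), |pointEnergy H x η| ≤ C) (hΛ : IsBounded Λ)
    (ω η : Config d) : (ENNReal.ofReal (Real.exp C) ^ count Λ η)⁻¹ ≤ gibbsWeight H Λ ω η := by
  rw [← ofReal_exp_mul_natCast, ← ENNReal.ofReal_inv_of_pos (Real.exp_pos _), ← Real.exp_neg,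
    ← count_glue Λ η ω]
  refine ENNReal.ofReal_le_ofReal (Real.exp_le_exp.2 ?_)
  linarith [(abs_le.1 (abs_condEnergy_le hH hC hΛ (glue Λ η ω))).2]

theorem poissonConst_le_partitionFunction [NeZero d] (hH : IsAdmissible H)
    (hC : ∀ (x : E d) (η : Config d), |pointEnergy H x η| ≤ C) (hΛ : IsBounded Λ)
    (hm : MeasurableSet Λ) (ω : Config d) : poissonConst Λ ≤ partitionFunction H Λ ω := by
  calc poissonConst Λ ≤ poissonConst Λ * ∑' n : ℕ, ((n.factorial : ℝ≥0∞)⁻¹ *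
        ((ENNReal.ofReal (Real.exp C) ^ n)⁻¹ * volume Λ ^ n)) := by
        refine le_mul_of_one_le_right' (le_trans ?_ (ENNReal.le_tsum 0))
        simp
    _ = ∫⁻ η, (ENNReal.ofReal (Real.exp C) ^ count Λ η)⁻¹ ∂(poisson Λ) :=
        (lintegral_poisson_comp_count hΛ hm fun n => (ENNReal.ofReal (Real.exp C) ^ n)⁻¹).symm
    _ ≤ partitionFunction H Λ ω := lintegral_mono (inv_le_gibbsWeight hH hC hΛ ω)

theorem exists_isPoissonComparable_finiteGibbs [NeZero d] (hH : IsAdmissible H)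
    (hΛ : IsBounded Λ) (hm : MeasurableSet Λ) :
    ∃ a z : ℝ≥0, ∀ ω, IsPoissonComparable Λ (finiteGibbs H Λ ω) a z := by
  obtain ⟨C, hC⟩ := hH.bounded
  have hC0 : 0 ≤ C := (abs_nonneg _).trans (hC 0 (ofFinite ∅ Set.finite_empty))
  set z : ℝ≥0 := (Real.exp C).toNNReal
  have hz1 : 1 ≤ z := Real.one_le_toNNReal.2 (Real.one_le_exp hC0)
  set M : ℝ≥0∞ := ∫⁻ η, (z : ℝ≥0∞) ^ count Λ η ∂(poisson Λ)
  have hM : M ≠ ∞ := (lintegral_poisson_pow_count_lt_top hΛ hm z).ne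
  have hpoisson : (poissonConst Λ)⁻¹ ≠ ∞ := ENNReal.inv_ne_top.2 (poissonConst_pos Λ).ne'
  have hZM (ω : Config d) : partitionFunction H Λ ω ≤ M :=
    lintegral_mono (gibbsWeight_le hH hC hΛ ω)
  have hZ (ω : Config d) : poissonConst Λ ≤ partitionFunction H Λ ω :=
    poissonConst_le_partitionFunction hH hC hΛ hm ω
  set a : ℝ≥0 := max 1 (max (poissonConst Λ)⁻¹.toNNReal M.toNNReal)
  have haπ : (poissonConst Λ)⁻¹ ≤ a := by
    rw [← ENNReal.coe_toNNReal hpoisson]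
    exact_mod_cast (le_max_left _ _).trans (le_max_right _ _)
  have haM : M ≤ a := by
    rw [← ENNReal.coe_toNNReal hM]
    exact_mod_cast (le_max_right _ _).trans (le_max_right _ _)
  refine ⟨a, z, fun ω => ?_⟩
  have hZ_inv : (partitionFunction H Λ ω)⁻¹ ≠ ∞ :=
    ENNReal.inv_ne_top.2 ((poissonConst_pos Λ).trans_le (hZ ω)).ne'
  rw [finiteGibbs, ← withDensity_smul' _ _ hZ_inv]
  refine isPoissonComparable_withDensity hΛ hm (le_max_left _ _) hz1
    (Eventually.of_forall fun η => ?_) (Eventually.of_forall fun η => ?_)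
  · rw [ENNReal.mul_inv (Or.inr (ENNReal.pow_ne_top ENNReal.coe_ne_top))
      (Or.inl ENNReal.coe_ne_top)]
    exact mul_le_mul' (ENNReal.inv_le_inv.2 ((hZM ω).trans haM))
      (inv_le_gibbsWeight hH hC hΛ ω η)
  · exact mul_le_mul' ((ENNReal.inv_le_inv.2 (hZ ω)).trans haπ) (gibbsWeight_le hH hC hΛ ω η)

theorem IsGibbs.lintegral_marginal_eq {ν : Measure (Config d)} (hν : IsGibbs H ν)
    (hΛ : IsBounded Λ) (hm : MeasurableSet Λ) {F : Config d → ℝ≥0∞} (hF : Measurable F) :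
    ∫⁻ η, F η ∂(marginal ν Λ) = ∫⁻ ω, ∫⁻ η, F η ∂(marginal (finiteGibbs H Λ ω) Λ) ∂ν := by
  simp_rw [lintegral_marginal hm _ hF]
  rw [hν.dlr Λ hΛ hm (fun η => F (η.restrict Λ)) (hF.comp (measurable_restrict hm))]
  simp_rw [restrict_glue]

theorem IsGibbs.exists_isPoissonComparable [NeZero d] (hH : IsAdmissible H)
    {ν : Measure (Config d)} (hν : IsGibbs H ν) (hΛ : IsBounded Λ) (hm : MeasurableSet Λ) :
    ∃ a z : ℝ≥0, IsPoissonComparable Λ (marginal ν Λ) a z := by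
  have := hν.isProbabilityMeasure
  obtain ⟨a, z, h⟩ := exists_isPoissonComparable_finiteGibbs hH hΛ hm
  have hω (ω : Config d) := (h ω).marginal hΛ hm
  have h₀ := h (ofFinite ∅ Set.finite_empty)
  refine ⟨a, z, h₀.one_le_const, h₀.one_le_base, fun F hF => ?_, fun F hF => ?_⟩
  · rw [hν.lintegral_marginal_eq hΛ hm hF]
    calc ∫⁻ ω, ∫⁻ η, F η ∂(marginal (finiteGibbs H Λ ω) Λ) ∂ν
        ≤ ∫⁻ _ω, ∫⁻ η, (a * (z : ℝ≥0∞) ^ count Λ η) * F η ∂(poisson Λ) ∂ν :=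
          lintegral_mono fun ω => (hω ω).le F hF
      _ = ∫⁻ η, (a * (z : ℝ≥0∞) ^ count Λ η) * F η ∂(poisson Λ) := by simp
  · have hmul : Measurable fun η : Config d => (a * (z : ℝ≥0∞) ^ count Λ η) * F η :=
      (measurable_comp_count hΛ hm fun n => a * (z : ℝ≥0∞) ^ n).mul hF
    rw [hν.lintegral_marginal_eq hΛ hm hmul]
    calc ∫⁻ η, F η ∂(poisson Λ) = ∫⁻ _ω, ∫⁻ η, F η ∂(poisson Λ) ∂ν := by simp
      _ ≤ ∫⁻ ω, ∫⁻ η, (a * (z : ℝ≥0∞) ^ count Λ η) * F η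
            ∂(marginal (finiteGibbs H Λ ω) Λ) ∂ν :=
          lintegral_mono fun ω => (hω ω).ge F hF

end Gibbs

theorem tsum_carrier_eq_sum_points {Λ : Set (E d)} (hΛ : IsBounded Λ) (η : Config d)
    {f : E d → ℝ} (hf : ∀ x ∉ Λ, f x = 0) :
    ∑' x : η.carrier, f x.1 = ∑ x ∈ η.points hΛ, f x := by
  rw [tsum_subtype η.carrier f, tsum_eq_sum (s := η.points hΛ)]
  · exact Finset.sum_congr rfl fun x hx => Set.indicator_of_mem (mem_points.1 hx).1 f
  · intro x hx
    by_cases hxη : x ∈ η.carrier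
    · rw [Set.indicator_of_mem hxη]
      exact hf x fun h => hx (mem_points.2 ⟨hxη, h⟩)
    · exact Set.indicator_of_notMem hxη f

section VagueMeasurability

theorem exists_compactlySupported_tendsto_indicator [NeZero d] {U : Set (E d)}
    (hU : IsOpen U) (hUb : IsBounded U) :
    ∃ φ : ℕ → CompactlySupportedContinuousMap (E d) ℝ, (∀ k, ∀ x ∉ U, φ k x = 0) ∧
      ∀ x ∈ U, Tendsto (fun k => φ k x) atTop (𝓝 1) := by
  have hne : Uᶜ.Nonempty := by
    rw [Set.nonempty_compl]
    rintro rfl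
    exact NormedSpace.unbounded_univ ℝ (E d) hUb
  have hzero (k : ℕ) (x : E d) (hx : x ∉ U) : min 1 ((k : ℝ) * Metric.infDist x Uᶜ) = 0 := by
    rw [Metric.infDist_zero_of_mem (Set.mem_compl hx), mul_zero]
    exact min_eq_right zero_le_one
  refine ⟨fun k => ⟨⟨fun x => min 1 ((k : ℝ) * Metric.infDist x Uᶜ), ?_⟩, ?_⟩, hzero, ?_⟩
  · have := Metric.continuous_infDist_pt (Uᶜ : Set (E d))
    fun_prop
  · exact HasCompactSupport.intro hUb.isCompact_closure fun x hx =>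
      hzero k x fun h => hx (subset_closure h)
  · intro x hx
    have hpos : 0 < Metric.infDist x Uᶜ :=
      (hU.isClosed_compl.notMem_iff_infDist_pos hne).1 (Set.notMem_compl_iff.2 hx)
    refine tendsto_const_nhds.congr' ?_
    have htop := (tendsto_natCast_atTop_atTop (R := ℝ)).atTop_mul_const hpos
    filter_upwards [htop.eventually_ge_atTop 1] with k hk
    exact (min_eq_left hk).symm

theorem measurable_count_of_tsum_compactlySupported [NeZero d] {α : Type*} [MeasurableSpace α]
    {Y : α → Config d}
    (h : ∀ φ : CompactlySupportedContinuousMap (E d) ℝ,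
      Measurable fun a => ∑' x : (Y a).carrier, φ x.1)
    {U : Set (E d)} (hU : IsOpen U) (hUb : IsBounded U) :
    Measurable fun a => (count U (Y a) : ℝ≥0∞) := by
  obtain ⟨φ, hφ0, hφ1⟩ := exists_compactlySupported_tendsto_indicator hU hUb
  have hreal : Measurable fun a => (count U (Y a) : ℝ) := by
    refine measurable_of_tendsto_metrizable (fun k => h (φ k)) (tendsto_pi_nhds.2 fun a => ?_)
    simp_rw [tsum_carrier_eq_sum_points hUb (Y a) (hφ0 _)]
    have hsum : (count U (Y a) : ℝ) = ∑ x ∈ (Y a).points hUb, 1 := by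
      rw [Finset.sum_const, card_points, nsmul_eq_mul, mul_one]
    rw [hsum]
    exact tendsto_finsetSum _ fun x hx => hφ1 x (mem_points.1 hx).2
  simpa only [ENNReal.ofReal_natCast] using hreal.ennreal_ofReal

/- The counts of open sets determine those of all Borel subsets of a ball, because the open sets
are a π-system that generates the Borel σ-algebra. -/
theorem measurable_of_tsum_compactlySupported [NeZero d] {α : Type*} [MeasurableSpace α]
    {Y : α → Config d}
    (h : ∀ φ : CompactlySupportedContinuousMap (E d) ℝ,
      Measurable fun a => ∑' x : (Y a).carrier, φ x.1) : Measurable Y := by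
  refine measurable_of_count fun B hB hBm => measurable_of_natCast ?_
  obtain ⟨r, hr⟩ := hB.subset_ball (0 : E d)
  have hball : IsBounded (Metric.ball (0 : E d) r) := Metric.isBounded_ball
  have (a : α) : IsFiniteMeasure (pointMeasure hball (Y a)) := ⟨by
    rw [pointMeasure_apply hball _ .univ]
    exact ENNReal.natCast_lt_top _⟩
  have hmeas : Measurable fun a => pointMeasure hball (Y a) := by
    refine Measurable.measure_of_isPiSystem (S := {s | IsOpen s})
      (BorelSpace.measurable_eq) isPiSystem_isOpen (fun s hs => ?_) ?_
    · simp_rw [pointMeasure_apply hball _ (IsOpen.measurableSet hs)]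
      exact measurable_count_of_tsum_compactlySupported h (Metric.isOpen_ball.inter hs)
        (hball.subset Set.inter_subset_left)
    · simp_rw [pointMeasure_apply hball _ MeasurableSet.univ, Set.inter_univ]
      exact measurable_count_of_tsum_compactlySupported h Metric.isOpen_ball hball
  simpa only [pointMeasure_apply hball _ hBm, Set.inter_eq_right.2 hr] using
    Measure.measurable_measure.1 hmeas B hBm

theorem continuous_tsum_compactlySupported (φ : CompactlySupportedContinuousMap (E d) ℝ) :
    Continuous fun η : Config d => ∑' x : η.carrier, φ x.1 :=
  continuous_iInf_dom continuous_induced_dom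

theorem measurable_tsum_compactlySupported (φ : CompactlySupportedContinuousMap (E d) ℝ) :
    Measurable fun η : Config d => ∑' x : η.carrier, φ x.1 := by
  have hb : IsBounded (tsupport φ) := φ.hasCompactSupport.isCompact.isBounded
  have hsum (η : Config d) : ∑' x : η.carrier, φ x.1 = ∑ x ∈ η.points hb, φ x :=
    tsum_carrier_eq_sum_points hb η fun x hx => image_eq_zero_of_notMem_tsupport hx
  simp_rw [hsum]
  exact measurable_sum_points_real hb (isClosed_tsupport φ).measurableSet
    (f := fun _ x => φ x) (φ.continuous.measurable.comp measurable_snd)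

end VagueMeasurability

section MartingaleProblem

variable {b : E d → Config d → ℝ} {ω : Config d} {S : Type} [MeasurableSpace S] {P : Measure S}
  {X : ℝ≥0 → S → Config d}

theorem SolvesMartingaleProblem.measurable (hX : SolvesMartingaleProblem b ω P X) (t : ℝ≥0) :
    Measurable (X t) := by
  obtain ⟨𝓕, hadapted, -⟩ := hX.martingale
  exact (hadapted t).mono (𝓕.le t) le_rfl

theorem SolvesMartingaleProblem.measurable_uncurry [NeZero d]
    (hX : SolvesMartingaleProblem b ω P X) : Measurable fun p : ℝ≥0 × S => X p.1 p.2 :=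
  measurable_of_tsum_compactlySupported fun φ => measurable_uncurry_of_continuousWithinAt_Ici
    (Z := fun t s => ∑' x : (X t s).carrier, φ x.1)
    (fun t => (measurable_tsum_compactlySupported φ).comp (hX.measurable t))
    fun s t => (continuous_tsum_compactlySupported φ).continuousAt.comp_continuousWithinAt
      (hX.rightContinuous s t)

theorem SolvesMartingaleProblem.integral_sub_eq [IsProbabilityMeasure P]
    (hX : SolvesMartingaleProblem b ω P X) {F : Config d → ℝ} (hF : IsBoundedLocal F) (t : ℝ≥0)
    (hint : Integrable (fun p : ℝ × S => generator b F (X p.1.toNNReal p.2))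
      ((volume.restrict (Set.Ioc (0 : ℝ) t)).prod P)) :
    ∫ s, F (X t s) ∂P - F ω = ∫ u in (0 : ℝ)..t, ∫ s, generator b F (X u.toNNReal s) ∂P := by
  obtain ⟨𝓕, -, hmart⟩ := hX.martingale
  obtain ⟨C, hC⟩ := hF.bounded
  have hFint : Integrable (fun s => F (X t s)) P :=
    Integrable.of_bound (hF.measurable.comp (hX.measurable t)).aestronglyMeasurable C
      (Eventually.of_forall fun s => hC _)
  have hmean := (hmart F hF).setIntegral_eq (zero_le (a := t)) MeasurableSet.univ
  simp only [Measure.restrict_univ, NNReal.coe_zero, intervalIntegral.integral_same, sub_zero,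
    intervalIntegral.integral_of_le t.coe_nonneg] at hmean
  have hinit : ∫ s, F (X 0 s) ∂P = F ω := by
    rw [integral_congr_ae (g := fun _ => F ω) (by
      filter_upwards [hX.initial] with s hs
      rw [hs]), integral_const, probReal_univ, one_smul]
  rw [hinit, integral_sub hFint hint.integral_prod_right] at hmean
  rw [intervalIntegral.integral_of_le t.coe_nonneg, hmean, sub_sub_cancel]
  exact (integral_integral_swap hint).symm

end MartingaleProblem

/-- Birth rates that are jointly measurable, nonnegative and bounded by `c`. -/
structure IsBoundedRate (b : E d → Config d → ℝ) (c : ℝ≥0) : Prop where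
  measurable : Measurable fun p : Config d × E d => b p.2 p.1
  nonneg : ∀ x η, 0 ≤ b x η
  le : ∀ x η, b x η ≤ c

section Generator

variable {b : E d → Config d → ℝ} {c : ℝ≥0} {Λ : Set (E d)}

theorem generator_eq (hΛ : IsBounded Λ) {F : Config d → ℝ} (hF : IsLocalOn Λ F)
    (η : Config d) :
    generator b F η = (∫ x in Λ, birthTerm b F η x) +
      ∑ x ∈ η.points hΛ, (F (η.remove x) - F η) := by
  rw [generator, tsum_carrier_eq_sum_points hΛ η (f := fun x => F (η.remove x) - F η)
    fun x hx => by rw [hF.remove_of_notMem hx, sub_self]]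
  congr 1
  refine (setIntegral_eq_integral_of_forall_compl_eq_zero fun x hx => ?_).symm
  rw [birthTerm, hF.add_of_notMem hx, sub_self, mul_zero]

theorem measurable_generator (hbm : Measurable fun p : Config d × E d => b p.2 p.1)
    (hΛ : IsBounded Λ) (hm : MeasurableSet Λ) {F : Config d → ℝ} (hFm : Measurable F)
    (hF : IsLocalOn Λ F) : Measurable (generator b F) := by
  simp_rw [funext (generator_eq (b := b) hΛ hF)]
  have hbirth : Measurable fun p : Config d × E d => birthTerm b F p.1 p.2 :=
    hbm.mul ((hFm.comp Config.measurable_add).sub (hFm.comp measurable_fst))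
  refine Measurable.add ?_ ?_
  · exact (hbirth.stronglyMeasurable.integral_prod_right' (ν := volume.restrict Λ)).measurable
  · exact measurable_sum_points_real hΛ hm
      ((hFm.comp measurable_remove).sub (hFm.comp measurable_fst))

theorem IsBoundedRate.enorm_le (hb : IsBoundedRate b c) (x : E d) (η : Config d) :
    ‖b x η‖ₑ ≤ c := by
  rw [Real.enorm_eq_ofReal (hb.nonneg x η), ENNReal.ofReal_le_iff_le_toReal ENNReal.coe_ne_top]
  exact hb.le x η

theorem IsBoundedRate.enorm_setIntegral_birthTerm_le (hb : IsBoundedRate b c) {F : Config d → ℝ}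
    (η : Config d) :
    ‖∫ x in Λ, birthTerm b F η x‖ₑ ≤
      c * (∫⁻ x in Λ, ‖F (η.add x)‖ₑ) + c * volume Λ * ‖F η‖ₑ := by
  calc ‖∫ x in Λ, birthTerm b F η x‖ₑ
      ≤ ∫⁻ x in Λ, ‖birthTerm b F η x‖ₑ := enorm_integral_le_lintegral_enorm _
    _ ≤ ∫⁻ x in Λ, c * (‖F (η.add x)‖ₑ + ‖F η‖ₑ) := by
        refine lintegral_mono fun x => ?_
        rw [birthTerm, enorm_mul]
        exact mul_le_mul' (hb.enorm_le _ _) enorm_sub_le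
    _ = c * (∫⁻ x in Λ, ‖F (η.add x)‖ₑ) + c * volume Λ * ‖F η‖ₑ := by
        rw [lintegral_const_mul' _ _ ENNReal.coe_ne_top, lintegral_add_right _ measurable_const,
          lintegral_const, Measure.restrict_apply_univ]
        ring

theorem enorm_sum_remove_sub_le (hΛ : IsBounded Λ) (F : Config d → ℝ) (η : Config d) :
    ‖∑ x ∈ η.points hΛ, (F (η.remove x) - F η)‖ₑ ≤
      ∑ x ∈ η.points hΛ, ‖F (η.remove x)‖ₑ + count Λ η * ‖F η‖ₑ := by
  calc ‖∑ x ∈ η.points hΛ, (F (η.remove x) - F η)‖ₑ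
      ≤ ∑ x ∈ η.points hΛ, ‖F (η.remove x) - F η‖ₑ := enorm_sum_le _ _
    _ ≤ ∑ x ∈ η.points hΛ, (‖F (η.remove x)‖ₑ + ‖F η‖ₑ) :=
        Finset.sum_le_sum fun x _ => enorm_sub_le
    _ = ∑ x ∈ η.points hΛ, ‖F (η.remove x)‖ₑ + count Λ η * ‖F η‖ₑ := by
        rw [Finset.sum_add_distrib, Finset.sum_const, card_points, nsmul_eq_mul]

theorem IsBoundedRate.enorm_generator_le (hb : IsBoundedRate b c) (hΛ : IsBounded Λ)
    {F : Config d → ℝ} (hF : IsLocalOn Λ F) (η : Config d) :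
    ‖generator b F η‖ₑ ≤ domOp c hΛ (fun η => ‖F η‖ₑ) η := by
  rw [generator_eq hΛ hF]
  refine (enorm_add_le _ _).trans ((add_le_add (hb.enorm_setIntegral_birthTerm_le η)
    (enorm_sum_remove_sub_le hΛ F η)).trans_eq ?_)
  unfold domOp
  ring

end Generator

section Dynkin

variable {b : E d → Config d → ℝ} {T : ℝ≥0 → Kernel (Config d) (Config d)}

theorem IsBirthDeathSemigroup.isProbabilityMeasure (hT : IsBirthDeathSemigroup b T) (t : ℝ≥0)
    (ω : Config d) : IsProbabilityMeasure (T t ω) := by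
  obtain ⟨S, _, P, X, _, hX, hlaw⟩ := hT.law ω
  rw [hlaw t]
  exact Measure.isProbabilityMeasure_map (hX.measurable t).aemeasurable

theorem IsBirthDeathSemigroup.dynkin [NeZero d] (hT : IsBirthDeathSemigroup b T)
    (ω : Config d) {F : Config d → ℝ} (hF : IsBoundedLocal F)
    (hG : Measurable (generator b F)) (t : ℝ≥0)
    (hfin : ∫⁻ u in Set.Ioc (0 : ℝ) t, ∫⁻ η, ‖generator b F η‖ₑ ∂(T u.toNNReal ω) ≠ ∞) :
    IntervalIntegrable (fun u : ℝ => ∫ η, generator b F η ∂(T u.toNNReal ω)) volume 0 t ∧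
    ∫ η, F η ∂(T t ω) - F ω = ∫ u in (0 : ℝ)..t, ∫ η, generator b F η ∂(T u.toNNReal ω) := by
  obtain ⟨S, _, P, X, _, hX, hlaw⟩ := hT.law ω
  have hpath : Measurable fun p : ℝ × S => generator b F (X p.1.toNNReal p.2) :=
    hG.comp (hX.measurable_uncurry.comp
      ((measurable_real_toNNReal.comp measurable_fst).prodMk measurable_snd))
  have hint : Integrable (fun p : ℝ × S => generator b F (X p.1.toNNReal p.2))
      ((volume.restrict (Set.Ioc (0 : ℝ) t)).prod P) := by
    refine ⟨hpath.aestronglyMeasurable, ?_⟩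
    rw [hasFiniteIntegral_iff_enorm, lintegral_prod _ hpath.enorm.aemeasurable]
    refine (lintegral_congr fun u => ?_).trans_lt hfin.lt_top
    rw [hlaw, lintegral_map hG.enorm (hX.measurable _)]
  have hmap (u : ℝ) : ∫ η, generator b F η ∂(T u.toNNReal ω) =
      ∫ s, generator b F (X u.toNNReal s) ∂P := by
    rw [hlaw, integral_map (hX.measurable _).aemeasurable hG.aestronglyMeasurable]
  simp_rw [hmap]
  refine ⟨(intervalIntegrable_iff_integrableOn_Ioc_of_le t.2).2 hint.integral_prod_left, ?_⟩
  rw [hlaw, integral_map (hX.measurable t).aemeasurable hF.measurable.aestronglyMeasurable]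
  exact hX.integral_sub_eq hF t hint

end Dynkin

section Estimates

variable {b : E d → Config d → ℝ} {c : ℝ≥0} {T : ℝ≥0 → Kernel (Config d) (Config d)}
  {Λ : Set (E d)}

theorem IsBirthDeathSemigroup.enorm_integral_sub_le [NeZero d] (hT : IsBirthDeathSemigroup b T)
    (hb : IsBoundedRate b c) (hΛ : IsBounded Λ) (hm : MeasurableSet Λ)
    {F : Config d → ℝ} (hFm : Measurable F) (hFb : ∃ C : ℝ, ∀ η, |F η| ≤ C) (hF : IsLocalOn Λ F)
    (ω : Config d) (t : ℝ≥0) :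
    ‖∫ η, F η ∂(T t ω) - F ω‖ₑ ≤
      ∫⁻ u in Set.Ioc (0 : ℝ) t, ∫⁻ η, domOp c hΛ (fun η => ‖F η‖ₑ) η ∂(T u.toNNReal ω) := by
  refine le_trans ?_
    (lintegral_mono fun u => lintegral_mono fun η => hb.enorm_generator_le hΛ hF η)
  by_cases hfin : ∫⁻ u in Set.Ioc (0 : ℝ) t, ∫⁻ η, ‖generator b F η‖ₑ ∂(T u.toNNReal ω) = ∞
  · rw [hfin]
    exact le_top
  · rw [(hT.dynkin ω ⟨hFm, hFb, Λ, hΛ, hm, hF⟩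
      (measurable_generator hb.measurable hΛ hm hFm hF) t hfin).2,
      intervalIntegral.integral_of_le t.coe_nonneg]
    exact (enorm_integral_le_lintegral_enorm _).trans
      (lintegral_mono fun u => enorm_integral_le_lintegral_enorm _)

theorem IsBirthDeathSemigroup.lintegral_le_add_lintegral_domOp [NeZero d]
    (hT : IsBirthDeathSemigroup b T) (hb : IsBoundedRate b c) (hΛ : IsBounded Λ)
    (hm : MeasurableSet Λ) {G : Config d → ℝ≥0∞} (hGm : Measurable G) (hG : IsLocalOn Λ G)
    (ω : Config d) (t : ℝ≥0) :
    ∫⁻ η, G η ∂(T t ω) ≤ G ω +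
      ∫⁻ u in Set.Ioc (0 : ℝ) t, ∫⁻ η, domOp c hΛ G η ∂(T u.toNNReal ω) := by
  have := hT.isProbabilityMeasure t ω
  rw [lintegral_eq_iSup_min _ hGm]
  refine iSup_le fun n => ?_
  set F : Config d → ℝ := fun η => (min (G η) n).toReal with hFdef
  have hne (η : Config d) : min (G η) n ≠ ∞ :=
    ((min_le_right _ _).trans_lt (ENNReal.natCast_lt_top n)).ne
  have hFm : Measurable F := (hGm.min measurable_const).ennreal_toReal
  have hFb (η : Config d) : |F η| ≤ n := by
    rw [abs_of_nonneg ENNReal.toReal_nonneg]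
    exact ENNReal.toReal_le_of_le_ofReal (by positivity) (by simp)
  have hFl : IsLocalOn Λ F := fun η => by simp only [hFdef, hG η]
  have hF_enorm (η : Config d) : ‖F η‖ₑ = min (G η) n := by
    rw [Real.enorm_eq_ofReal ENNReal.toReal_nonneg, ENNReal.ofReal_toReal (hne η)]
  have hFi : Integrable F (T t ω) :=
    Integrable.of_bound hFm.aestronglyMeasurable n (Eventually.of_forall hFb)
  have hF_integral : ∫⁻ η, min (G η) n ∂(T t ω) = ENNReal.ofReal (∫ η, F η ∂(T t ω)) := by
    rw [ofReal_integral_eq_lintegral_ofReal hFi (Eventually.of_forall fun η =>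
      ENNReal.toReal_nonneg)]
    exact lintegral_congr fun η => (ENNReal.ofReal_toReal (hne η)).symm
  rw [hF_integral]
  refine (ofReal_le_ofReal_add_enorm_sub _ (F ω)).trans (add_le_add ?_
    ((hT.enorm_integral_sub_le hb hΛ hm hFm ⟨n, hFb⟩ hFl ω t).trans ?_))
  · rw [ENNReal.ofReal_toReal (hne ω)]
    exact min_le_left _ _
  · simp_rw [hF_enorm]
    exact lintegral_mono fun u => lintegral_mono fun η =>
      domOp_mono c hΛ (fun η => min_le_left _ _) η

end Estimates

section Moments

variable {b : E d → Config d → ℝ} {c : ℝ≥0} {T : ℝ≥0 → Kernel (Config d) (Config d)}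
  {Λ : Set (E d)}

theorem generator_comp_count [NeZero d] (b : E d → Config d → ℝ) (hΛ : IsBounded Λ)
    (hm : MeasurableSet Λ) (g : ℕ → ℝ) (η : Config d) :
    generator b (fun η => g (count Λ η)) η =
      (∫ x in Λ, b x η) * (g (count Λ η + 1) - g (count Λ η)) +
        count Λ η * (g (count Λ η - 1) - g (count Λ η)) := by
  rw [generator_eq hΛ fun η => congrArg g (isLocalOn_count Λ η)]
  congr 1
  · rw [← integral_mul_const]
    refine integral_congr_ae ?_
    filter_upwards [ae_restrict_count_add hΛ hm η] with x hx
    rw [birthTerm, hx]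
  · rw [← card_points η hΛ, ← nsmul_eq_mul, ← Finset.sum_const]
    refine Finset.sum_congr rfl fun _ hx => ?_
    rw [count_remove, if_pos (mem_points.1 hx).symm, card_points]

theorem IsBoundedRate.setIntegral_nonneg (hb : IsBoundedRate b c) (Λ : Set (E d))
    (η : Config d) : 0 ≤ ∫ x in Λ, b x η :=
  integral_nonneg fun x => hb.nonneg x η

theorem IsBoundedRate.setIntegral_le (hb : IsBoundedRate b c) (hΛ : IsBounded Λ) (η : Config d) :
    ∫ x in Λ, b x η ≤ c * volume.real Λ := by
  have : IsFiniteMeasure (volume.restrict Λ) := ⟨by simpa using hΛ.measure_lt_top⟩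
  calc ∫ x in Λ, b x η ≤ ∫ _ in Λ, (c : ℝ) :=
        integral_mono_of_nonneg (Eventually.of_forall fun x => hb.nonneg x η)
          (integrable_const _) (Eventually.of_forall fun x => hb.le x η)
    _ = c * volume.real Λ := by rw [setIntegral_const, smul_eq_mul, mul_comm]

theorem pow_min_succ_sub_le {y : ℝ} (hy : 1 ≤ y) (M n : ℕ) :
    y ^ min (n + 1) M - y ^ min n M ≤ (y - 1) * y ^ min n M := by
  have h : y ^ min (n + 1) M ≤ y ^ (min n M + 1) := pow_le_pow_right₀ hy (by omega)
  rw [pow_succ] at h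
  linarith

theorem mul_pow_min_pred_sub_nonpos {y : ℝ} (hy : 1 ≤ y) (M n : ℕ) :
    n * (y ^ min (n - 1) M - y ^ min n M) ≤ 0 :=
  mul_nonpos_of_nonneg_of_nonpos n.cast_nonneg
    (sub_nonpos.2 (pow_le_pow_right₀ hy (by omega)))

theorem neg_mul_pow_le_mul_pow_min_pred_sub {y : ℝ} (hy : 1 ≤ y) (M n : ℕ) :
    -(M * y ^ M) ≤ n * (y ^ min (n - 1) M - y ^ min n M) := by
  rcases le_or_gt n M with h | h
  · have hn : (n : ℝ) * y ^ min n M ≤ M * y ^ M := by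
      gcongr
      exact min_le_right _ _
    have hpred : 0 ≤ (n : ℝ) * y ^ min (n - 1) M := by positivity
    linarith
  · rw [show min (n - 1) M = min n M by omega, sub_self, mul_zero, neg_nonpos]
    positivity

theorem IsBoundedRate.generator_pow_min_count_le [NeZero d] (hb : IsBoundedRate b c)
    (hΛ : IsBounded Λ) (hm : MeasurableSet Λ) {y : ℝ} (hy : 1 ≤ y) (M : ℕ) (η : Config d) :
    generator b (fun η => y ^ min (count Λ η) M) η ≤
      c * volume.real Λ * (y - 1) * y ^ min (count Λ η) M := by
  rw [generator_comp_count b hΛ hm (fun n => y ^ min n M)]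
  have hbirth : (∫ x in Λ, b x η) * (y ^ min (count Λ η + 1) M - y ^ min (count Λ η) M) ≤
      c * volume.real Λ * ((y - 1) * y ^ min (count Λ η) M) := by
    refine mul_le_mul (hb.setIntegral_le hΛ η) (pow_min_succ_sub_le hy M _)
      (sub_nonneg.2 (pow_le_pow_right₀ hy (by omega))) (by positivity)
  linarith [mul_pow_min_pred_sub_nonpos hy M (count Λ η)]

theorem IsBoundedRate.abs_generator_pow_min_count_le [NeZero d] (hb : IsBoundedRate b c)
    (hΛ : IsBounded Λ) (hm : MeasurableSet Λ) {y : ℝ} (hy : 1 ≤ y) (M : ℕ) (η : Config d) :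
    |generator b (fun η => y ^ min (count Λ η) M) η| ≤
      (c * volume.real Λ * (y - 1) + M) * y ^ M := by
  refine abs_le.2 ⟨?_, ?_⟩
  · rw [generator_comp_count b hΛ hm (fun n => y ^ min n M)]
    have hbirth : 0 ≤ (∫ x in Λ, b x η) *
        (y ^ min (count Λ η + 1) M - y ^ min (count Λ η) M) :=
      mul_nonneg (hb.setIntegral_nonneg Λ η)
        (sub_nonneg.2 (pow_le_pow_right₀ hy (by omega)))
    have hpos : 0 ≤ c * volume.real Λ * (y - 1) * y ^ M := by positivity
    linarith [neg_mul_pow_le_mul_pow_min_pred_sub hy M (count Λ η)]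
  · have hpow : c * volume.real Λ * (y - 1) * y ^ min (count Λ η) M ≤
        c * volume.real Λ * (y - 1) * y ^ M := by
      gcongr
      exact min_le_right _ _
    have hpos : 0 ≤ M * y ^ M := by positivity
    linarith [hb.generator_pow_min_count_le hΛ hm hy M η]

theorem IsBirthDeathSemigroup.dynkin_of_abs_generator_le [NeZero d]
    (hT : IsBirthDeathSemigroup b T) (ω : Config d) {F : Config d → ℝ} (hF : IsBoundedLocal F)
    (hG : Measurable (generator b F)) {B : ℝ} (hB : ∀ η, |generator b F η| ≤ B) (t : ℝ≥0) :
    IntervalIntegrable (fun u : ℝ => ∫ η, generator b F η ∂(T u.toNNReal ω)) volume 0 t ∧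
      ∫ η, F η ∂(T t ω) - F ω =
        ∫ u in (0 : ℝ)..t, ∫ η, generator b F η ∂(T u.toNNReal ω) := by
  have (t : ℝ≥0) : IsProbabilityMeasure (T t ω) := hT.isProbabilityMeasure t ω
  refine hT.dynkin ω hF hG t (ne_top_of_le_ne_top ?_ (calc
    ∫⁻ u in Set.Ioc (0 : ℝ) t, ∫⁻ η, ‖generator b F η‖ₑ ∂(T u.toNNReal ω) ≤
        ∫⁻ u in Set.Ioc (0 : ℝ) t, ∫⁻ _, ENNReal.ofReal B ∂(T u.toNNReal ω) :=
      lintegral_mono fun u => lintegral_mono fun η => by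
        simpa only [Real.enorm_eq_ofReal_abs] using ENNReal.ofReal_le_ofReal (hB η)
    _ = ENNReal.ofReal B * t := by simp))
  exact ENNReal.mul_ne_top ENNReal.ofReal_ne_top ENNReal.coe_ne_top

/- The drift of `F` is at most `a F`, so `sup_{t ≤ ε} ∫ F dT_t ≤ F ω + ε a sup_{t ≤ ε} ∫ F dT_t`,
and the supremum is finite because `F` is bounded. -/
theorem IsBirthDeathSemigroup.integral_le_two_mul_of_generator_le [NeZero d]
    (hT : IsBirthDeathSemigroup b T) {F : Config d → ℝ} (hF : IsBoundedLocal F)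
    (hF0 : ∀ η, 0 ≤ F η) (hG : Measurable (generator b F)) {B : ℝ}
    (hB : ∀ η, |generator b F η| ≤ B) {a : ℝ≥0} (ha : ∀ η, generator b F η ≤ a * F η)
    {ε : ℝ≥0} (hε : ε * a ≤ 1 / 2) {t : ℝ≥0} (ht : t ≤ ε) (ω : Config d) :
    ∫ η, F η ∂(T t ω) ≤ 2 * F ω := by
  have (t : ℝ≥0) : IsProbabilityMeasure (T t ω) := hT.isProbabilityMeasure t ω
  obtain ⟨C, hC⟩ := hF.bounded
  have hFi (t : ℝ≥0) : Integrable F (T t ω) :=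
    .of_bound hF.measurable.aestronglyMeasurable C (Eventually.of_forall hC)
  have hGi (t : ℝ≥0) : Integrable (generator b F) (T t ω) :=
    .of_bound hG.aestronglyMeasurable B (Eventually.of_forall hB)
  set v : ℝ≥0 → ℝ := fun t => ∫ η, F η ∂(T t ω)
  have hbdd : BddAbove (Set.range fun u : Set.Iic ε => v u) := by
    refine ⟨C, Set.forall_mem_range.2 fun u => ?_⟩
    calc v u ≤ ∫ _, C ∂(T u ω) :=
          integral_mono (hFi u) (integrable_const C) fun η => (le_abs_self _).trans (hC η)
      _ = C := by simp
  set S : ℝ := ⨆ u : Set.Iic ε, v u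
  have hvS (u : ℝ≥0) (hu : u ≤ ε) : v u ≤ S := le_ciSup hbdd ⟨u, hu⟩
  have hS0 : 0 ≤ S := (integral_nonneg hF0).trans (hvS 0 zero_le)
  have hstep (t : ℝ≥0) (ht : t ≤ ε) : v t ≤ F ω + S / 2 := by
    obtain ⟨hint, heq⟩ := hT.dynkin_of_abs_generator_le ω hF hG hB t
    have hdrift : ∫ u in (0 : ℝ)..t, ∫ η, generator b F η ∂(T u.toNNReal ω) ≤
        ∫ _ in (0 : ℝ)..t, a * S := by
      refine intervalIntegral.integral_mono_on t.coe_nonneg hint (by simp) fun u hu => ?_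
      calc ∫ η, generator b F η ∂(T u.toNNReal ω) ≤ ∫ η, a * F η ∂(T u.toNNReal ω) :=
            integral_mono (hGi _) ((hFi _).const_mul _) ha
        _ = a * v u.toNNReal := integral_const_mul _ _
        _ ≤ a * S := mul_le_mul_of_nonneg_left
          (hvS _ ((Real.toNNReal_le_iff_le_coe.2 hu.2).trans ht)) a.2
    rw [intervalIntegral.integral_const, smul_eq_mul, sub_zero] at hdrift
    have hta : (t : ℝ) * a ≤ 1 / 2 := by exact_mod_cast (mul_le_mul_left ht a).trans hε
    nlinarith
  have : Nonempty (Set.Iic ε) := ⟨⟨0, Set.mem_Iic.2 zero_le⟩⟩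
  have hS : S ≤ F ω + S / 2 := ciSup_le fun u => hstep u u.2
  linarith [hvS t ht]

theorem IsBirthDeathSemigroup.integral_pow_min_count_le [NeZero d]
    (hT : IsBirthDeathSemigroup b T) (hb : IsBoundedRate b c) (hΛ : IsBounded Λ)
    (hm : MeasurableSet Λ) {y : ℝ≥0} (hy : 1 ≤ y) (M : ℕ) {ε : ℝ≥0}
    (hε : (ε : ℝ) * (c * volume.real Λ * (y - 1)) ≤ 1 / 2) {t : ℝ≥0} (ht : t ≤ ε)
    (ω : Config d) :
    ∫ η, (y : ℝ) ^ min (count Λ η) M ∂(T t ω) ≤ 2 * (y : ℝ) ^ min (count Λ ω) M := by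
  have hy1 : (1 : ℝ) ≤ y := by exact_mod_cast hy
  have hFm : Measurable fun η : Config d => (y : ℝ) ^ min (count Λ η) M :=
    measurable_comp_count hΛ hm fun n => (y : ℝ) ^ min n M
  have hFl : IsLocalOn Λ fun η : Config d => (y : ℝ) ^ min (count Λ η) M := fun η => by
    simp only [isLocalOn_count Λ η]
  have hFb (η : Config d) : |(y : ℝ) ^ min (count Λ η) M| ≤ (y : ℝ) ^ M := by
    rw [abs_of_nonneg (by positivity)]
    exact pow_le_pow_right₀ hy1 (min_le_right _ _)
  have ha : 0 ≤ c * volume.real Λ * (y - 1) :=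
    mul_nonneg (by positivity) (sub_nonneg.2 hy1)
  exact hT.integral_le_two_mul_of_generator_le (a := ⟨_, ha⟩) ⟨hFm, ⟨_, hFb⟩, Λ, hΛ, hm, hFl⟩
    (fun η => by positivity) (measurable_generator hb.measurable hΛ hm hFm hFl)
    (hb.abs_generator_pow_min_count_le hΛ hm hy1 M)
    (hb.generator_pow_min_count_le hΛ hm hy1 M) (by exact_mod_cast hε) ht ω

theorem IsBirthDeathSemigroup.lintegral_pow_count_le [NeZero d]
    (hT : IsBirthDeathSemigroup b T) (hb : IsBoundedRate b c) (hΛ : IsBounded Λ)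
    (hm : MeasurableSet Λ) {y : ℝ≥0} (hy : 1 ≤ y) {ε : ℝ≥0}
    (hε : (ε : ℝ) * (c * volume.real Λ * (y - 1)) ≤ 1 / 2) {t : ℝ≥0} (ht : t ≤ ε)
    (ω : Config d) :
    ∫⁻ η, (y : ℝ≥0∞) ^ count Λ η ∂(T t ω) ≤ 2 * (y : ℝ≥0∞) ^ count Λ ω := by
  have := hT.isProbabilityMeasure t ω
  have hy1 : (1 : ℝ) ≤ y := by exact_mod_cast hy
  have hy' : (1 : ℝ≥0∞) ≤ y := by exact_mod_cast hy
  have hcoe (n : ℕ) : ENNReal.ofReal ((y : ℝ) ^ n) = (y : ℝ≥0∞) ^ n := by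
    rw [ENNReal.ofReal_pow y.coe_nonneg, ENNReal.ofReal_coe_nnreal]
  have hsup (η : Config d) : (y : ℝ≥0∞) ^ count Λ η = ⨆ M : ℕ, (y : ℝ≥0∞) ^ min (count Λ η) M :=
    le_antisymm (le_iSup_of_le (count Λ η) (by rw [min_self]))
      (iSup_le fun M => pow_le_pow_right₀ hy' (min_le_left _ _))
  simp_rw [hsup]
  rw [lintegral_iSup (fun M => measurable_comp_count hΛ hm fun n => (y : ℝ≥0∞) ^ min n M)
    (fun i j hij η => pow_le_pow_right₀ hy' (min_le_min le_rfl hij)), ENNReal.mul_iSup]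
  refine iSup_mono fun M => ?_
  have hint : Integrable (fun η : Config d => (y : ℝ) ^ min (count Λ η) M) (T t ω) :=
    .of_bound (measurable_comp_count hΛ hm fun n => (y : ℝ) ^ min n M).aestronglyMeasurable
      ((y : ℝ) ^ M) (Eventually.of_forall fun η => by
        rw [Real.norm_of_nonneg (by positivity)]
        exact pow_le_pow_right₀ hy1 (min_le_right _ _))
  calc ∫⁻ η, (y : ℝ≥0∞) ^ min (count Λ η) M ∂(T t ω)
      = ENNReal.ofReal (∫ η, (y : ℝ) ^ min (count Λ η) M ∂(T t ω)) := by
        rw [ofReal_integral_eq_lintegral_ofReal hint (Eventually.of_forall fun η => by positivity)]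
        simp_rw [hcoe]
    _ ≤ ENNReal.ofReal (2 * (y : ℝ) ^ min (count Λ ω) M) :=
        ENNReal.ofReal_le_ofReal (hT.integral_pow_min_count_le hb hΛ hm hy M hε ht ω)
    _ = 2 * (y : ℝ≥0∞) ^ min (count Λ ω) M := by
        rw [ENNReal.ofReal_mul zero_le_two, hcoe, ENNReal.ofReal_ofNat]

end Moments

section Iteration

variable {b : E d → Config d → ℝ} {c : ℝ≥0} {T : ℝ≥0 → Kernel (Config d) (Config d)}
  {Λ : Set (E d)}

theorem IsBirthDeathSemigroup.lintegral_le_sum_domOp_iterate [NeZero d]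
    (hT : IsBirthDeathSemigroup b T) (hb : IsBoundedRate b c) (hΛ : IsBounded Λ)
    (hm : MeasurableSet Λ) (ω : Config d) {ε : ℝ≥0} {R : ℝ≥0∞} (n : ℕ)
    {G : Config d → ℝ≥0∞} (hGm : Measurable G) (hG : IsLocalOn Λ G)
    (hR : ∀ u ≤ ε, ∫⁻ η, (domOp c hΛ)^[n] G η ∂(T u ω) ≤ R) {t : ℝ≥0} (ht : t ≤ ε) :
    ∫⁻ η, G η ∂(T t ω) ≤
      ∑ k ∈ Finset.range n, expCoeff t k * (domOp c hΛ)^[k] G ω + expCoeff t n * R := by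
  induction n generalizing G t with
  | zero => simpa [expCoeff_zero] using hR t ht
  | succ n ih =>
    have hstep : ∀ u ∈ Set.Ioc (0 : ℝ) t, ∫⁻ η, domOp c hΛ G η ∂(T u.toNNReal ω) ≤
        ∑ k ∈ Finset.range n, expCoeff u.toNNReal k * (domOp c hΛ)^[k + 1] G ω +
          expCoeff u.toNNReal n * R := fun u hu =>
      ih (measurable_domOp c hΛ hm hGm) (isLocalOn_domOp c hΛ hm hG) hR
        ((Real.toNNReal_le_iff_le_coe.2 hu.2).trans ht)
    calc ∫⁻ η, G η ∂(T t ω)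
        ≤ G ω + ∫⁻ u in Set.Ioc (0 : ℝ) t, ∫⁻ η, domOp c hΛ G η ∂(T u.toNNReal ω) :=
          hT.lintegral_le_add_lintegral_domOp hb hΛ hm hGm hG ω t
      _ ≤ G ω + ∫⁻ u in Set.Ioc (0 : ℝ) t,
          (∑ k ∈ Finset.range n, expCoeff u.toNNReal k * (domOp c hΛ)^[k + 1] G ω +
            expCoeff u.toNNReal n * R) := by
          gcongr G ω + ?_
          exact setLIntegral_mono' measurableSet_Ioc hstep
      _ = G ω + (∑ k ∈ Finset.range n, expCoeff t (k + 1) * (domOp c hΛ)^[k + 1] G ω +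
            expCoeff t (n + 1) * R) := by
          rw [lintegral_add_right _ ((measurable_expCoeff n).mul_const _), lintegral_finsetSum]
          · simp_rw [lintegral_mul_const _ (measurable_expCoeff _), lintegral_expCoeff]
          · exact fun k _ => (measurable_expCoeff k).mul_const _
      _ = ∑ k ∈ Finset.range (n + 1), expCoeff t k * (domOp c hΛ)^[k] G ω +
            expCoeff t (n + 1) * R := by
          rw [Finset.sum_range_succ', expCoeff_zero, Function.iterate_zero, id, one_mul]
          ring

/-- The series `∑ ε ^ k / k! D ^ (k + 1) F` for the dominating operator `D = domOp c hΛ`: the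
expansion of `D F` along the semigroup with generator `D`, up to time `ε`. -/
noncomputable def domSeries (c : ℝ≥0) (hΛ : IsBounded Λ) (ε : ℝ≥0)
    (F : Config d → ℝ≥0∞) (ω : Config d) : ℝ≥0∞ :=
  ∑' k : ℕ, expCoeff ε k * (domOp c hΛ)^[k + 1] F ω

theorem growthConst_ne_top (c : ℝ≥0) {v : ℝ≥0∞} (hv : v ≠ ∞) : growthConst c v ≠ ∞ := by
  simp [growthConst, ENNReal.mul_ne_top, hv]

theorem mul_toReal_le_half {v : ℝ≥0∞} {ε : ℝ≥0} (hε : 8 * (ε : ℝ≥0∞) * growthConst c v ≤ 1) :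
    (ε : ℝ) * (c * v.toReal) ≤ 1 / 2 := by
  have h : 2 * ((ε : ℝ≥0∞) * (c * v)) ≤ 1 :=
    calc 2 * ((ε : ℝ≥0∞) * (c * v)) = ε * (2 * c * v) := by ring
      _ ≤ 8 * (ε : ℝ≥0∞) * growthConst c v := by
          unfold growthConst
          gcongr
          · exact le_mul_of_one_le_left' (by norm_num)
          · rw [add_assoc, add_assoc]
            exact le_self_add
      _ ≤ 1 := hε
  have := ENNReal.toReal_mono ENNReal.one_ne_top h
  simp only [ENNReal.toReal_mul, ENNReal.coe_toReal, ENNReal.toReal_ofNat,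
    ENNReal.toReal_one] at this
  linarith

theorem IsBirthDeathSemigroup.lintegral_domOp_iterate_le [NeZero d]
    (hT : IsBirthDeathSemigroup b T) (hb : IsBoundedRate b c) (hΛ : IsBounded Λ)
    (hm : MeasurableSet Λ) {ε : ℝ≥0} (hε : (ε : ℝ) * (c * volume.real Λ) ≤ 1 / 2)
    {F : Config d → ℝ≥0∞} (hF : ∀ η, F η ≤ 1) (k : ℕ) (ω : Config d) {t : ℝ≥0} (ht : t ≤ ε) :
    ∫⁻ η, (domOp c hΛ)^[k] F η ∂(T t ω) ≤
      growthConst c (volume Λ) ^ k * (k.factorial * 2 ^ k) * (2 * 2 ^ count Λ ω) := by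
  set a := growthConst c (volume Λ)
  calc ∫⁻ η, (domOp c hΛ)^[k] F η ∂(T t ω)
      ≤ ∫⁻ η, a ^ k * (k.factorial * 2 ^ k) * 2 ^ count Λ η ∂(T t ω) :=
        lintegral_mono fun η => ((domOp_mono c hΛ).iterate k hF η).trans
          (domOp_iterate_one_le c hΛ k η)
    _ = a ^ k * (k.factorial * 2 ^ k) * ∫⁻ η, 2 ^ count Λ η ∂(T t ω) :=
        lintegral_const_mul _ (measurable_comp_count hΛ hm fun n => (2 : ℝ≥0∞) ^ n)
    _ ≤ a ^ k * (k.factorial * 2 ^ k) * (2 * 2 ^ count Λ ω) := by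
        gcongr
        exact hT.lintegral_pow_count_le hb hΛ hm (y := 2) one_le_two
          (by push_cast; linarith) ht ω

theorem IsBirthDeathSemigroup.lintegral_domOp_le_domSeries [NeZero d]
    (hT : IsBirthDeathSemigroup b T) (hb : IsBoundedRate b c) (hΛ : IsBounded Λ)
    (hm : MeasurableSet Λ) {ε : ℝ≥0} (hε : 8 * (ε : ℝ≥0∞) * growthConst c (volume Λ) ≤ 1)
    {F : Config d → ℝ≥0∞} (hFm : Measurable F)
    (hF : IsLocalOn Λ F) (hF1 : ∀ η, F η ≤ 1) (ω : Config d) {t : ℝ≥0} (ht : t ≤ ε) :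
    ∫⁻ η, domOp c hΛ F η ∂(T t ω) ≤ domSeries c hΛ ε F ω := by
  set a := growthConst c (volume Λ)
  have ht' : 8 * (t : ℝ≥0∞) * a ≤ 1 := le_trans (by gcongr) hε
  have hle (n : ℕ) : ∫⁻ η, domOp c hΛ F η ∂(T t ω) ≤
      domSeries c hΛ ε F ω + 2 * a * (2 * 2 ^ count Λ ω) * (1 / 2) ^ n := by
    refine (hT.lintegral_le_sum_domOp_iterate hb hΛ hm ω n (measurable_domOp c hΛ hm hFm)
      (isLocalOn_domOp c hΛ hm hF)
      (fun u hu => hT.lintegral_domOp_iterate_le hb hΛ hm (mul_toReal_le_half hε) hF1 (n + 1) ω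
        hu) ht).trans (add_le_add ?_ ?_)
    · exact (Finset.sum_le_sum fun k _ => mul_le_mul' (expCoeff_mono ht k) le_rfl).trans
        (ENNReal.sum_le_tsum (Finset.range n))
    · rw [← mul_assoc, mul_right_comm (2 * a)]
      exact mul_le_mul_left (expCoeff_mul_factorial_succ_mul_two_pow_le ht' n) _
  have hconst : 2 * a * (2 * 2 ^ count Λ ω) ≠ ∞ := by
    simp [a, ENNReal.mul_ne_top, growthConst_ne_top c hΛ.measure_lt_top.ne]
  have hlim := (ENNReal.Tendsto.const_mul (ENNReal.tendsto_pow_atTop_nhds_zero_of_lt_one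
    (r := 1 / 2) (by simp)) (Or.inr hconst)).const_add (domSeries c hΛ ε F ω)
  rw [mul_zero, add_zero] at hlim
  exact ge_of_tendsto' hlim hle

theorem IsBirthDeathSemigroup.enorm_integral_sub_le_domSeries [NeZero d]
    (hT : IsBirthDeathSemigroup b T) (hb : IsBoundedRate b c) (hΛ : IsBounded Λ)
    (hm : MeasurableSet Λ) {ε : ℝ≥0} (hε : 8 * (ε : ℝ≥0∞) * growthConst c (volume Λ) ≤ 1)
    {F : Config d → ℝ} (hFm : Measurable F)
    (hF : IsLocalOn Λ F) (hF1 : ∀ η, |F η| ≤ 1) (ω : Config d) {t : ℝ≥0} (ht : t ≤ ε) :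
    ‖∫ η, F η ∂(T t ω) - F ω‖ₑ ≤ t * domSeries c hΛ ε (fun η => ‖F η‖ₑ) ω := by
  have hF_enorm (η : Config d) : ‖F η‖ₑ ≤ 1 := by
    simpa [Real.enorm_eq_ofReal_abs] using hF1 η
  calc ‖∫ η, F η ∂(T t ω) - F ω‖ₑ
      ≤ ∫⁻ u in Set.Ioc (0 : ℝ) t, ∫⁻ η, domOp c hΛ (fun η => ‖F η‖ₑ) η ∂(T u.toNNReal ω) :=
        hT.enorm_integral_sub_le hb hΛ hm hFm ⟨1, hF1⟩ hF ω t
    _ ≤ ∫⁻ _ in Set.Ioc (0 : ℝ) t, domSeries c hΛ ε (fun η => ‖F η‖ₑ) ω :=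
        setLIntegral_mono' measurableSet_Ioc fun u hu =>
          hT.lintegral_domOp_le_domSeries hb hΛ hm hε hFm.enorm
            (fun η => congrArg (‖·‖ₑ) (hF η)) hF_enorm ω
            ((Real.toNNReal_le_iff_le_coe.2 hu.2).trans ht)
    _ = t * domSeries c hΛ ε (fun η => ‖F η‖ₑ) ω := by
        rw [setLIntegral_const, Real.volume_Ioc, sub_zero, ENNReal.ofReal_coe_nnreal, mul_comm]

theorem IsBirthDeathSemigroup.measure_le_add_domSeries [NeZero d]
    (hT : IsBirthDeathSemigroup b T) (hb : IsBoundedRate b c) (hΛ : IsBounded Λ)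
    (hm : MeasurableSet Λ) {ε : ℝ≥0} (hε : 8 * (ε : ℝ≥0∞) * growthConst c (volume Λ) ≤ 1)
    {A : Set (Config d)} (hA : MeasurableSet A)
    (hAl : IsLocalOn Λ (· ∈ A)) (ω : Config d) {t : ℝ≥0}
    (ht : t ≤ ε) :
    T t ω A ≤ A.indicator 1 ω + t * domSeries c hΛ ε (A.indicator 1) ω ∧
      A.indicator 1 ω ≤ T t ω A + t * domSeries c hΛ ε (A.indicator 1) ω := by
  have := hT.isProbabilityMeasure t ω
  set F : Config d → ℝ := A.indicator 1 with hF
  have hF_ofReal (η : Config d) : ENNReal.ofReal (F η) = A.indicator 1 η := by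
    by_cases h : η ∈ A <;> simp [hF, h]
  have hF_enorm : (fun η => ‖F η‖ₑ) = A.indicator 1 := by
    ext η
    by_cases h : η ∈ A <;> simp [hF, h]
  have hF1 (η : Config d) : |F η| ≤ 1 := by
    by_cases h : η ∈ A <;> simp [hF, h]
  have hTA : ENNReal.ofReal (∫ η, F η ∂(T t ω)) = T t ω A := by
    rw [hF, integral_indicator_one hA, ofReal_measureReal]
  have hbound := hT.enorm_integral_sub_le_domSeries hb hΛ hm hε
    (measurable_one.indicator hA) hAl.indicator_one hF1 ω ht
  rw [hF_enorm] at hbound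
  rw [← hTA, ← hF_ofReal]
  refine ⟨(ofReal_le_ofReal_add_enorm_sub _ _).trans (add_le_add le_rfl hbound),
    (ofReal_le_ofReal_add_enorm_sub _ (∫ η, F η ∂(T t ω))).trans (add_le_add le_rfl ?_)⟩
  rwa [enorm_sub_rev]

end Iteration

section Density

variable {b : E d → Config d → ℝ} {c : ℝ≥0} {T : ℝ≥0 → Kernel (Config d) (Config d)}
  {Λ : Set (E d)}

theorem tsum_expCoeff_dualOp_le (c : ℝ≥0) (v : ℝ≥0∞) {ε z : ℝ≥0} (hz : 1 ≤ z)
    (hε : 8 * (ε : ℝ≥0∞) * (growthConst c v * z) ≤ 1) (n : ℕ) :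
    ∑' k : ℕ, expCoeff ε k * (dualOp c v)^[k + 1] (fun n => (z : ℝ≥0∞) ^ n) n ≤
      4 * growthConst c v * z * (2 * (z : ℝ≥0∞)) ^ n := by
  set a := growthConst c v
  have hasc (k : ℕ) : (((n + 1).ascFactorial (k + 1) : ℕ) : ℝ≥0∞) ≤
      (k + 1).factorial * 2 ^ (n + (k + 1)) := by
    exact_mod_cast ascFactorial_le_factorial_mul_two_pow n (k + 1)
  have hterm (k : ℕ) : expCoeff ε k * (dualOp c v)^[k + 1] (fun n => (z : ℝ≥0∞) ^ n) n ≤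
      2 * (a * z) * (2 * (z : ℝ≥0∞)) ^ n * (1 / 2) ^ k :=
    calc expCoeff ε k * (dualOp c v)^[k + 1] (fun n => (z : ℝ≥0∞) ^ n) n
        ≤ expCoeff ε k * (a ^ (k + 1) * ((k + 1).factorial * 2 ^ (n + (k + 1))) *
            (z : ℝ≥0∞) ^ (n + (k + 1))) := by
          gcongr
          exact (dualOp_iterate_pow_le c v hz (k + 1) n).trans (by gcongr; exact hasc k)
      _ = expCoeff ε k * ((a * z) ^ (k + 1) * ((k + 1).factorial * 2 ^ (k + 1))) *
            (2 * (z : ℝ≥0∞)) ^ n := by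
          simp only [mul_pow, pow_add]
          ring
      _ ≤ 2 * (a * z) * (1 / 2) ^ k * (2 * (z : ℝ≥0∞)) ^ n := by
          gcongr ?_ * _
          exact expCoeff_mul_factorial_succ_mul_two_pow_le hε k
      _ = 2 * (a * z) * (2 * (z : ℝ≥0∞)) ^ n * (1 / 2) ^ k := mul_right_comm _ _ _
  refine (ENNReal.tsum_le_tsum hterm).trans_eq ?_
  rw [ENNReal.tsum_mul_left, ENNReal.tsum_geometric, one_div, ENNReal.one_sub_inv_two, inv_inv]
  ring

theorem IsPoissonComparable.lintegral_domOp_iterate_le [NeZero d] {μ : Measure (Config d)}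
    {a z : ℝ≥0} (hμ : IsPoissonComparable Λ (BirthDeath.marginal μ Λ) a z) (c : ℝ≥0)
    (hΛ : IsBounded Λ) (hm : MeasurableSet Λ) {F : Config d → ℝ≥0∞} (hFm : Measurable F)
    (hF : IsLocalOn Λ F) (k : ℕ) :
    ∫⁻ ω, (domOp c hΛ)^[k] F ω ∂μ ≤
      a * ∫⁻ η, (dualOp c (volume Λ))^[k] (fun n => (z : ℝ≥0∞) ^ n) (count Λ η) * F η
        ∂(poisson Λ) := by
  have hDm := measurable_domOp_iterate c hΛ hm hFm k
  have hwDm : Measurable fun η => (z : ℝ≥0∞) ^ count Λ η * (domOp c hΛ)^[k] F η :=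
    (measurable_comp_count hΛ hm fun n => (z : ℝ≥0∞) ^ n).mul hDm
  calc ∫⁻ ω, (domOp c hΛ)^[k] F ω ∂μ
      = ∫⁻ ω, (domOp c hΛ)^[k] F (ω.restrict Λ) ∂μ :=
        lintegral_congr fun ω => (isLocalOn_domOp_iterate c hΛ hm hF k ω).symm
    _ = ∫⁻ η, (domOp c hΛ)^[k] F η ∂(BirthDeath.marginal μ Λ) :=
        (lintegral_marginal hm μ hDm).symm
    _ ≤ ∫⁻ η, (a * (z : ℝ≥0∞) ^ count Λ η) * (domOp c hΛ)^[k] F η ∂(poisson Λ) := hμ.le _ hDm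
    _ = a * ∫⁻ η, (z : ℝ≥0∞) ^ count Λ η * (domOp c hΛ)^[k] F η ∂(poisson Λ) := by
        simp_rw [mul_assoc]
        exact lintegral_const_mul _ hwDm
    _ = _ := by rw [lintegral_poisson_domOp_iterate c hΛ hm _ hFm k]

theorem measurable_domSeries (c : ℝ≥0) (hΛ : IsBounded Λ) (hm : MeasurableSet Λ) (ε : ℝ≥0)
    {F : Config d → ℝ≥0∞} (hF : Measurable F) : Measurable (domSeries c hΛ ε F) :=
  Measurable.tsum fun k => (measurable_domOp_iterate c hΛ hm hF (k + 1)).const_mul _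

theorem IsPoissonComparable.lintegral_domSeries_le_poisson [NeZero d] {μ : Measure (Config d)}
    {a z : ℝ≥0} (hμ : IsPoissonComparable Λ (BirthDeath.marginal μ Λ) a z) (hΛ : IsBounded Λ)
    (hm : MeasurableSet Λ) {ε : ℝ≥0}
    (hε : 8 * (ε : ℝ≥0∞) * (growthConst c (volume Λ) * z) ≤ 1)
    {F : Config d → ℝ≥0∞} (hFm : Measurable F) (hF : IsLocalOn Λ F) :
    ∫⁻ ω, domSeries c hΛ ε F ω ∂μ ≤
      a * ∫⁻ η, 4 * growthConst c (volume Λ) * z * (2 * (z : ℝ≥0∞)) ^ count Λ η * F η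
        ∂(poisson Λ) := by
  set w : ℕ → ℕ → ℝ≥0∞ := fun k => (dualOp c (volume Λ))^[k + 1] fun n => (z : ℝ≥0∞) ^ n
  have hwFm (k : ℕ) : Measurable fun η => w k (count Λ η) * F η :=
    (measurable_comp_count hΛ hm (w k)).mul hFm
  calc ∫⁻ ω, domSeries c hΛ ε F ω ∂μ
      = ∑' k, expCoeff ε k * ∫⁻ ω, (domOp c hΛ)^[k + 1] F ω ∂μ := by
        unfold domSeries
        rw [lintegral_tsum fun k =>
          ((measurable_domOp_iterate c hΛ hm hFm (k + 1)).const_mul _).aemeasurable]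
        exact tsum_congr fun k =>
          lintegral_const_mul _ (measurable_domOp_iterate c hΛ hm hFm (k + 1))
    _ ≤ ∑' k, expCoeff ε k * (a * ∫⁻ η, w k (count Λ η) * F η ∂(poisson Λ)) := by
        gcongr with k
        exact hμ.lintegral_domOp_iterate_le c hΛ hm hFm hF (k + 1)
    _ = a * ∫⁻ η, ∑' k, expCoeff ε k * (w k (count Λ η) * F η) ∂(poisson Λ) := by
        rw [lintegral_tsum fun k => ((hwFm k).const_mul _).aemeasurable, ← ENNReal.tsum_mul_left]
        exact tsum_congr fun k => by rw [lintegral_const_mul _ (hwFm k), mul_left_comm]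
    _ ≤ _ := by
        simp_rw [← mul_assoc (expCoeff ε _), ENNReal.tsum_mul_right]
        gcongr with η
        exact tsum_expCoeff_dualOp_le c (volume Λ) hμ.one_le_base hε _

theorem IsPoissonComparable.lintegral_domSeries_le [NeZero d] {μ : Measure (Config d)}
    {a z : ℝ≥0} (hμ : IsPoissonComparable Λ (BirthDeath.marginal μ Λ) a z) (hΛ : IsBounded Λ)
    (hm : MeasurableSet Λ) {ε : ℝ≥0}
    (hε : 8 * (ε : ℝ≥0∞) * (growthConst c (volume Λ) * z) ≤ 1)
    {F : Config d → ℝ≥0∞} (hFm : Measurable F) (hF : IsLocalOn Λ F) :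
    ∫⁻ ω, domSeries c hΛ ε F ω ∂μ ≤
      ∫⁻ η, 4 * a ^ 2 * growthConst c (volume Λ) * z * (2 * (z : ℝ≥0∞) ^ 2) ^ count Λ η * F η
        ∂(BirthDeath.marginal μ Λ) := by
  set g := growthConst c (volume Λ)
  have hwFm : Measurable fun η => 4 * g * z * (2 * (z : ℝ≥0∞)) ^ count Λ η * F η :=
    (measurable_comp_count hΛ hm fun n => 4 * g * z * (2 * (z : ℝ≥0∞)) ^ n).mul hFm
  have huwFm : Measurable fun η =>
      (a * (z : ℝ≥0∞) ^ count Λ η) * (4 * g * z * (2 * (z : ℝ≥0∞)) ^ count Λ η * F η) :=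
    (measurable_comp_count hΛ hm fun n => a * (z : ℝ≥0∞) ^ n).mul hwFm
  calc ∫⁻ ω, domSeries c hΛ ε F ω ∂μ
      ≤ a * ∫⁻ η, 4 * g * z * (2 * (z : ℝ≥0∞)) ^ count Λ η * F η ∂(poisson Λ) :=
        hμ.lintegral_domSeries_le_poisson hΛ hm hε hFm hF
    _ ≤ a * ∫⁻ η, (a * (z : ℝ≥0∞) ^ count Λ η) *
          (4 * g * z * (2 * (z : ℝ≥0∞)) ^ count Λ η * F η) ∂(BirthDeath.marginal μ Λ) := by
        gcongr _ * ?_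
        exact hμ.ge _ hwFm
    _ = _ := by
        rw [← lintegral_const_mul _ huwFm]
        refine lintegral_congr fun η => ?_
        rw [mul_pow, mul_pow, ← pow_mul, mul_comm 2 (count Λ η), pow_mul]
        ring

theorem lintegral_marginal_indicator_restrict (hm : MeasurableSet Λ) (μ : Measure (Config d))
    {G : Config d → ℝ≥0∞} (hG : Measurable G) {B : Set (Config d)} (hB : MeasurableSet B) :
    ∫⁻ η, G η * (Config.restrict Λ ⁻¹' B).indicator 1 η ∂(marginal μ Λ) =
      ∫⁻ η in B, G η ∂(marginal μ Λ) := by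
  have hGm : Measurable fun η => G η * (Config.restrict Λ ⁻¹' B).indicator 1 η :=
    hG.mul (measurable_one.indicator (measurable_restrict hm hB))
  rw [← lintegral_indicator hB, lintegral_marginal hm μ (hG.indicator hB),
    lintegral_marginal hm μ hGm]
  refine lintegral_congr fun η => ?_
  by_cases h : η.restrict Λ ∈ B <;> simp [restrict_restrict, h]

theorem marginal_bind_apply (hm : MeasurableSet Λ) (μ : Measure (Config d)) (t : ℝ≥0)
    {B : Set (Config d)} (hB : MeasurableSet B) :
    marginal (μ.bind (T t)) Λ B = ∫⁻ ω, T t ω (Config.restrict Λ ⁻¹' B) ∂μ := by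
  rw [marginal, Measure.map_apply (measurable_restrict hm) hB,
    Measure.bind_apply (measurable_restrict hm hB) (T t).measurable.aemeasurable]

theorem marginal_bind_le_add [NeZero d] (hT : IsBirthDeathSemigroup b T) (hb : IsBoundedRate b c)
    (hΛ : IsBounded Λ) (hm : MeasurableSet Λ) {μ : Measure (Config d)} {ε : ℝ≥0}
    (hε : 8 * (ε : ℝ≥0∞) * growthConst c (volume Λ) ≤ 1) {t : ℝ≥0} (ht : t ≤ ε)
    {B : Set (Config d)} (hB : MeasurableSet B) :
    marginal (μ.bind (T t)) Λ B ≤ marginal μ Λ B +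
        t * ∫⁻ ω, domSeries c hΛ ε ((Config.restrict Λ ⁻¹' B).indicator 1) ω ∂μ ∧
      marginal μ Λ B ≤ marginal (μ.bind (T t)) Λ B +
        t * ∫⁻ ω, domSeries c hΛ ε ((Config.restrict Λ ⁻¹' B).indicator 1) ω ∂μ := by
  set A : Set (Config d) := Config.restrict Λ ⁻¹' B
  have hA : MeasurableSet A := measurable_restrict hm hB
  have hAl : IsLocalOn Λ (· ∈ A) := fun η => by simp [A, restrict_restrict]
  have hbound (ω : Config d) := hT.measure_le_add_domSeries hb hΛ hm hε hA hAl ω ht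
  have hSm := measurable_domSeries c hΛ hm ε (measurable_one.indicator hA)
  have hμB : marginal μ Λ B = ∫⁻ ω, A.indicator 1 ω ∂μ := by
    rw [lintegral_indicator_one hA, marginal, Measure.map_apply (measurable_restrict hm) hB]
  rw [marginal_bind_apply hm μ t hB, hμB, ← lintegral_const_mul _ hSm,
    ← lintegral_add_right _ (hSm.const_mul _), ← lintegral_add_right _ (hSm.const_mul _)]
  exact ⟨lintegral_mono fun ω => (hbound ω).1, lintegral_mono fun ω => (hbound ω).2⟩

theorem exists_marginal_bind_le_add_setLIntegral [NeZero d] (hT : IsBirthDeathSemigroup b T)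
    (hb : IsBoundedRate b c) (hΛ : IsBounded Λ) (hm : MeasurableSet Λ) {μ : Measure (Config d)}
    {a z : ℝ≥0} (hμ : IsPoissonComparable Λ (marginal μ Λ) a z) :
    ∃ ε > (0 : ℝ≥0), ∃ g y : ℝ≥0, ∀ t ≤ ε, ∀ B : Set (Config d), MeasurableSet B →
      marginal (μ.bind (T t)) Λ B ≤ marginal μ Λ B +
        t * ∫⁻ η in B, g * (y : ℝ≥0∞) ^ count Λ η ∂(marginal μ Λ) ∧
      marginal μ Λ B ≤ marginal (μ.bind (T t)) Λ B +
        t * ∫⁻ η in B, g * (y : ℝ≥0∞) ^ count Λ η ∂(marginal μ Λ) := by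
  obtain ⟨r, hr⟩ : ∃ r : ℝ≥0, (r : ℝ≥0∞) = growthConst c (volume Λ) :=
    ⟨_, ENNReal.coe_toNNReal (growthConst_ne_top c hΛ.measure_lt_top.ne)⟩
  have hz : (1 : ℝ≥0∞) ≤ z := by exact_mod_cast hμ.one_le_base
  have hr0 : r ≠ 0 := by
    have hr' : (r : ℝ≥0∞) ≠ 0 := by simp [hr, growthConst]
    exact_mod_cast hr'
  have hz0 : z ≠ 0 := (one_pos.trans_le hμ.one_le_base).ne'
  set ε : ℝ≥0 := (8 * (r * z))⁻¹
  have hεz : 8 * (ε : ℝ≥0∞) * (growthConst c (volume Λ) * z) ≤ 1 := by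
    rw [← hr]
    have : 8 * ε * (r * z) = 1 := by
      simp only [ε]
      field_simp
    exact_mod_cast this.le
  have hε : 8 * (ε : ℝ≥0∞) * growthConst c (volume Λ) ≤ 1 :=
    le_trans (by gcongr; exact le_mul_of_one_le_right' hz) hεz
  refine ⟨ε, by positivity, 4 * a ^ 2 * r * z, 2 * z ^ 2, fun t ht B hB => ?_⟩
  have hseries : ∫⁻ ω, domSeries c hΛ ε ((Config.restrict Λ ⁻¹' B).indicator 1) ω ∂μ ≤
      ∫⁻ η in B, (4 * a ^ 2 * r * z : ℝ≥0) * ((2 * z ^ 2 : ℝ≥0) : ℝ≥0∞) ^ count Λ η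
        ∂(marginal μ Λ) := by
    rw [← lintegral_marginal_indicator_restrict hm μ (measurable_comp_count hΛ hm
      fun n => ((4 * a ^ 2 * r * z : ℝ≥0) : ℝ≥0∞) * ((2 * z ^ 2 : ℝ≥0) : ℝ≥0∞) ^ n) hB]
    push_cast
    rw [hr]
    exact hμ.lintegral_domSeries_le hΛ hm hεz (measurable_one.indicator (measurable_restrict hm hB))
      (IsLocalOn.indicator_one fun η => by simp [restrict_restrict])
  have hbound := marginal_bind_le_add (μ := μ) hT hb hΛ hm hε ht hB
  exact ⟨hbound.1.trans (by gcongr), hbound.2.trans (by gcongr)⟩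

end Density

section ExponentialGrowth

variable {Λ Λ' : Set (E d)} {α : Type*} {a y y' : ℝ≥0}

theorem count_mono_set (hΛ' : IsBounded Λ') (hsub : Λ ⊆ Λ') (η : Config d) :
    count Λ η ≤ count Λ' η :=
  Set.ncard_le_ncard (Set.inter_subset_inter_right _ hsub) (η.finite_inter Λ' hΛ')

/-- Functions dominated by an exponential weight `a y^{N_Λ}`: the class to which Dynkin's formula
extends from bounded local functions. Stated with `‖·‖ₑ` so as to cover values in `ℝ` and in
`ℝ≥0∞`. -/
def HasExpGrowth [ENorm α] (Λ : Set (E d)) (a y : ℝ≥0) (F : Config d → α) : Prop :=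
  ∀ η, ‖F η‖ₑ ≤ a * (y : ℝ≥0∞) ^ count Λ η

theorem hasExpGrowth_iff_norm_le {F : Config d → ℝ} :
    HasExpGrowth Λ a y F ↔ ∀ η, ‖F η‖ ≤ a * (y : ℝ) ^ count Λ η := by
  refine forall_congr' fun η => ?_
  rw [← ENNReal.coe_pow, ← ENNReal.coe_mul, enorm_le_coe, ← NNReal.coe_le_coe]
  simp only [coe_nnnorm, NNReal.coe_mul, NNReal.coe_pow]

theorem HasExpGrowth.mono [ENorm α] {F : Config d → α} (hF : HasExpGrowth Λ a y F)
    (hΛ' : IsBounded Λ') (hsub : Λ ⊆ Λ') (hy : 1 ≤ y) (hyy' : y ≤ y') :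
    HasExpGrowth Λ' a y' F := fun η => by
  have hy' : (1 : ℝ≥0∞) ≤ y' := by exact_mod_cast hy.trans hyy'
  calc ‖F η‖ₑ ≤ a * (y : ℝ≥0∞) ^ count Λ η := hF η
    _ ≤ a * (y' : ℝ≥0∞) ^ count Λ η := by gcongr
    _ ≤ a * (y' : ℝ≥0∞) ^ count Λ' η := by
        gcongr
        exact count_mono_set hΛ' hsub η

theorem HasExpGrowth.lintegral_enorm_le [ENorm α] {F : Config d → α} (hF : HasExpGrowth Λ a y F)
    (m : Measure (Config d)) :
    ∫⁻ η, ‖F η‖ₑ ∂m ≤ a * ∫⁻ η, (y : ℝ≥0∞) ^ count Λ η ∂m :=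
  (lintegral_mono hF).trans_eq (lintegral_const_mul' _ _ ENNReal.coe_ne_top)

theorem HasExpGrowth.integrable {F : Config d → ℝ} (hF : HasExpGrowth Λ a y F)
    (hFm : Measurable F) {m : Measure (Config d)}
    (hy : ∫⁻ η, (y : ℝ≥0∞) ^ count Λ η ∂m ≠ ∞) : Integrable F m :=
  ⟨hFm.aestronglyMeasurable,
    (hF.lintegral_enorm_le m).trans_lt (ENNReal.mul_lt_top ENNReal.coe_lt_top hy.lt_top)⟩

theorem HasExpGrowth.truncation {F : Config d → ℝ} (hF : HasExpGrowth Λ a y F) (A : ℝ) :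
    HasExpGrowth Λ a y (truncation F A) :=
  hasExpGrowth_iff_norm_le.2 fun η =>
    (abs_truncation_le_abs_self F A η).trans (hasExpGrowth_iff_norm_le.1 hF η)

theorem IsLocalOn.truncation {F : Config d → ℝ} (hF : IsLocalOn Λ F) (A : ℝ) :
    IsLocalOn Λ (truncation F A) := fun η => by
  simp only [ProbabilityTheory.truncation, Function.comp_apply, hF η]

theorem tendsto_integral_of_hasExpGrowth (hΛ : IsBounded Λ) (hm : MeasurableSet Λ)
    {m : Measure (Config d)} {F : ℕ → Config d → ℝ} {G : Config d → ℝ}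
    (hFm : ∀ n, Measurable (F n)) (hF : ∀ n, HasExpGrowth Λ a y (F n))
    (hlim : ∀ η, Tendsto (fun n => F n η) atTop (𝓝 (G η)))
    (hy : ∫⁻ η, (y : ℝ≥0∞) ^ count Λ η ∂m ≠ ∞) :
    Tendsto (fun n => ∫ η, F n η ∂m) atTop (𝓝 (∫ η, G η ∂m)) := by
  have hbound : Integrable (fun η : Config d => (a : ℝ) * (y : ℝ) ^ count Λ η) m := by
    refine HasExpGrowth.integrable (Λ := Λ) (a := a) (hasExpGrowth_iff_norm_le.2 fun η => ?_)
      (measurable_comp_count hΛ hm fun n => (a : ℝ) * (y : ℝ) ^ n) hy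
    rw [Real.norm_of_nonneg (by positivity)]
  exact tendsto_integral_of_dominated_convergence _ (fun n => (hFm n).aestronglyMeasurable) hbound
    (fun n => .of_forall (hasExpGrowth_iff_norm_le.1 (hF n))) (.of_forall hlim)

/-- The constant `a'` for which the dominating operator maps functions below `a y^{N_Λ}` to
functions below `a' (2y)^{N_Λ}`. -/
noncomputable def weightConst (c : ℝ≥0) (Λ : Set (E d)) (a y : ℝ≥0) : ℝ≥0 :=
  a * (c * (volume Λ).toNNReal * (y + 1) + 2)

theorem HasExpGrowth.domOp {β : Type*} [ENorm β] {F : Config d → β} (hF : HasExpGrowth Λ a y F)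
    (hy : 1 ≤ y) (c : ℝ≥0) (hΛ : IsBounded Λ) :
    HasExpGrowth Λ (weightConst c Λ a y) (2 * y) (domOp c hΛ fun η => ‖F η‖ₑ) := fun η => by
  refine (domOp_mono c hΛ hF η).trans ((domOp_pow_count_le c hΛ hy η).trans_eq ?_)
  rw [weightConst]
  push_cast
  rw [ENNReal.coe_toNNReal hΛ.measure_lt_top.ne]

variable {b : E d → Config d → ℝ} {c : ℝ≥0}

theorem HasExpGrowth.generator {F : Config d → ℝ} (hF : HasExpGrowth Λ a y F) (hy : 1 ≤ y)
    (hb : IsBoundedRate b c) (hΛ : IsBounded Λ) (hFl : IsLocalOn Λ F) :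
    HasExpGrowth Λ (weightConst c Λ a y) (2 * y) (generator b F) := fun η =>
  (hb.enorm_generator_le hΛ hFl η).trans (hF.domOp hy c hΛ η)

theorem isLocalOn_generator (hΛ : IsBounded Λ) (hm : MeasurableSet Λ) (hsub : Λ ⊆ Λ')
    (hloc : ∀ x ∈ Λ, IsLocalOn Λ' (b x)) {F : Config d → ℝ} (hF : IsLocalOn Λ F) :
    IsLocalOn Λ' (generator b F) := by
  have hF' (η : Config d) : F (η.restrict Λ') = F η := by
    rw [← hF, restrict_restrict, Set.inter_eq_right.2 hsub, hF]
  intro η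
  rw [generator_eq hΛ hF, generator_eq hΛ hF]
  congr 1
  · refine setIntegral_congr_fun hm fun x hx => ?_
    simp only [birthTerm]
    rw [hloc x hx, hF', ← restrict_add_of_mem (hsub hx), hF']
  · have hpoints : (η.restrict Λ').points hΛ = η.points hΛ := by
      ext x
      simp only [mem_points, carrier_restrict, Set.mem_inter_iff]
      exact ⟨fun h => ⟨h.1.1, h.2⟩, fun h => ⟨⟨h.1, hsub h.2⟩, h.2⟩⟩
    rw [hpoints]
    exact Finset.sum_congr rfl fun x _ => by rw [← restrict_remove, hF', hF']

theorem generator_truncation_eventuallyEq (b : E d → Config d → ℝ) (hΛ : IsBounded Λ)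
    (hy : 1 ≤ y) {F : Config d → ℝ} (hF : HasExpGrowth Λ a y F) (ω : Config d) :
    ∀ᶠ n : ℕ in atTop, generator b (truncation F n) ω = generator b F ω := by
  filter_upwards [tendsto_natCast_atTop_atTop.eventually_gt_atTop
    ((a : ℝ) * (y : ℝ) ^ (count Λ ω + 1))] with n hn
  have heq (η : Config d) (hη : count Λ η ≤ count Λ ω + 1) : truncation F n η = F η := by
    refine truncation_eq_self (((hasExpGrowth_iff_norm_le.1 hF η).trans ?_).trans_lt hn)
    have hy1 : (1 : ℝ) ≤ y := by exact_mod_cast hy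
    gcongr
  have hself : truncation F n ω = F ω := heq ω (Nat.le_succ _)
  have hadd (x : E d) : truncation F n (ω.add x) = F (ω.add x) := heq _ (by
    rw [count_add hΛ]
    split_ifs <;> omega)
  have hremove (x : E d) : truncation F n (ω.remove x) = F (ω.remove x) := heq _ (by
    rw [count_remove]
    omega)
  simp only [BirthDeath.generator, birthTerm, hself, hadd, hremove]

end ExponentialGrowth

section Dynkin

variable {b : E d → Config d → ℝ} {c : ℝ≥0} {T : ℝ≥0 → Kernel (Config d) (Config d)}
  {Λ Λ' : Set (E d)} {a y ε ε' : ℝ≥0}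

/-- Exponential moments of the number of points in `Λ` at most double up to time `ε`. -/
def MomentBound (T : ℝ≥0 → Kernel (Config d) (Config d)) (Λ : Set (E d)) (y ε : ℝ≥0) : Prop :=
  ∀ t ≤ ε, ∀ ω, ∫⁻ η, (y : ℝ≥0∞) ^ count Λ η ∂(T t ω) ≤ 2 * (y : ℝ≥0∞) ^ count Λ ω

theorem IsBirthDeathSemigroup.exists_momentBound [NeZero d] (hT : IsBirthDeathSemigroup b T)
    (hb : IsBoundedRate b c) (hΛ : IsBounded Λ) (hm : MeasurableSet Λ) (hy : 1 ≤ y) :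
    ∃ ε > (0 : ℝ≥0), MomentBound T Λ y ε := by
  set r : ℝ≥0 := c * (volume Λ).toNNReal * y
  refine ⟨(2 * r + 1)⁻¹, by positivity, fun t ht ω =>
    hT.lintegral_pow_count_le hb hΛ hm hy ?_ ht ω⟩
  have hr : (c : ℝ) * volume.real Λ * (y - 1) ≤ r :=
    mul_le_mul_of_nonneg_left (sub_le_self _ zero_le_one) (by positivity)
  have hpos : (0 : ℝ) < 2 * r + 1 := by positivity
  push_cast
  rw [inv_mul_le_iff₀ hpos]
  linarith

theorem MomentBound.mono (h : MomentBound T Λ y ε) (hε : ε' ≤ ε) : MomentBound T Λ y ε' :=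
  fun t ht ω => h t (ht.trans hε) ω

theorem MomentBound.ne_top (h : MomentBound T Λ y ε) {t : ℝ≥0} (ht : t ≤ ε) (ω : Config d) :
    ∫⁻ η, (y : ℝ≥0∞) ^ count Λ η ∂(T t ω) ≠ ∞ :=
  ((h t ht ω).trans_lt (ENNReal.mul_lt_top (by simp) (ENNReal.pow_lt_top ENNReal.coe_lt_top))).ne

theorem MomentBound.lintegral_enorm_le {α : Type*} [ENorm α] (h : MomentBound T Λ y ε)
    {F : Config d → α} (hF : HasExpGrowth Λ a y F) {t : ℝ≥0} (ht : t ≤ ε) (ω : Config d) :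
    ∫⁻ η, ‖F η‖ₑ ∂(T t ω) ≤ 2 * a * (y : ℝ≥0∞) ^ count Λ ω :=
  calc ∫⁻ η, ‖F η‖ₑ ∂(T t ω)
      ≤ a * ∫⁻ η, (y : ℝ≥0∞) ^ count Λ η ∂(T t ω) := hF.lintegral_enorm_le _
    _ ≤ a * (2 * (y : ℝ≥0∞) ^ count Λ ω) := by
        gcongr
        exact h t ht ω
    _ = 2 * a * (y : ℝ≥0∞) ^ count Λ ω := by ring

theorem MomentBound.norm_integral_le (h : MomentBound T Λ y ε) {F : Config d → ℝ}
    (hF : HasExpGrowth Λ a y F) {t : ℝ≥0} (ht : t ≤ ε) (ω : Config d) :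
    ‖∫ η, F η ∂(T t ω)‖ ≤ 2 * a * (y : ℝ) ^ count Λ ω := by
  have hle := (enorm_integral_le_lintegral_enorm F).trans (h.lintegral_enorm_le hF ht ω)
  rw [← ENNReal.coe_ofNat, ← ENNReal.coe_pow, ← ENNReal.coe_mul, ← ENNReal.coe_mul,
    enorm_le_coe, ← NNReal.coe_le_coe] at hle
  simpa only [coe_nnnorm, NNReal.coe_mul, NNReal.coe_pow, NNReal.coe_ofNat] using hle

theorem IsBirthDeathSemigroup.dynkin_truncation [NeZero d] (hT : IsBirthDeathSemigroup b T)
    (hb : IsBoundedRate b c) (hΛ : IsBounded Λ) (hm : MeasurableSet Λ) (hy : 1 ≤ y)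
    (hM : MomentBound T Λ (2 * y) ε) {F : Config d → ℝ} (hFm : Measurable F)
    (hFl : IsLocalOn Λ F) (hF : HasExpGrowth Λ a y F) (A : ℝ) (ω : Config d) {t : ℝ≥0}
    (ht : t ≤ ε) :
    IntervalIntegrable (fun u : ℝ => ∫ η, generator b (truncation F A) η ∂(T u.toNNReal ω))
        volume 0 t ∧
      ∫ η, truncation F A η ∂(T t ω) - truncation F A ω =
        ∫ u in (0 : ℝ)..t, ∫ η, generator b (truncation F A) η ∂(T u.toNNReal ω) := by
  have hm_trunc := measurable_truncation hFm A
  have hl_trunc := hFl.truncation A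
  refine hT.dynkin ω ⟨hm_trunc, ⟨|A|, abs_truncation_le_bound F A⟩, Λ, hΛ, hm, hl_trunc⟩
    (measurable_generator hb.measurable hΛ hm hm_trunc hl_trunc) t
    (ne_top_of_le_ne_top ?_ (setLIntegral_Ioc_toNNReal_le
      (f := fun u => ∫⁻ η, ‖generator b (truncation F A) η‖ₑ ∂(T u ω)) fun u hu =>
        hM.lintegral_enorm_le ((hF.truncation A).generator hy hb hΛ hl_trunc) (hu.trans ht) ω))
  finiteness

/- Dynkin's formula holds for the truncations of `F`, whose generators are eventually equal to that
of `F` at each configuration and uniformly dominated by an exponential weight. -/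
theorem IsBirthDeathSemigroup.dynkin_of_hasExpGrowth [NeZero d] (hT : IsBirthDeathSemigroup b T)
    (hb : IsBoundedRate b c) (hΛ : IsBounded Λ) (hm : MeasurableSet Λ) (hy : 1 ≤ y)
    (hM : MomentBound T Λ (2 * y) ε) {F : Config d → ℝ} (hFm : Measurable F)
    (hFl : IsLocalOn Λ F) (hF : HasExpGrowth Λ a y F) (ω : Config d) {t : ℝ≥0} (ht : t ≤ ε) :
    IntervalIntegrable (fun u : ℝ => ∫ η, generator b F η ∂(T u.toNNReal ω)) volume 0 t ∧
      ∫ η, F η ∂(T t ω) - F ω =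
        ∫ u in (0 : ℝ)..t, ∫ η, generator b F η ∂(T u.toNNReal ω) := by
  have hgrowth (n : ℕ) : HasExpGrowth Λ (weightConst c Λ a y) (2 * y)
      (generator b (truncation F n)) := (hF.truncation n).generator hy hb hΛ (hFl.truncation n)
  have hdynkin (n : ℕ) := hT.dynkin_truncation hb hΛ hm hy hM hFm hFl hF n ω ht
  have hlim_left : Tendsto (fun n : ℕ => ∫ η, truncation F n η ∂(T t ω) - truncation F n ω) atTop
      (𝓝 (∫ η, F η ∂(T t ω) - F ω)) :=
    (tendsto_integral_of_hasExpGrowth hΛ hm (fun n => measurable_truncation hFm n)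
      (fun n => (hF.truncation n).mono hΛ subset_rfl hy (le_mul_of_one_le_left' one_le_two))
      (tendsto_truncation F) (hM.ne_top ht ω)).sub (tendsto_truncation F ω)
  have hle {u : ℝ} (hu : u ∈ Set.Ioc 0 (t : ℝ)) : u.toNNReal ≤ ε :=
    (Real.toNNReal_le_iff_le_coe.2 hu.2).trans ht
  have hlim_right (u : ℝ) (hu : u ∈ Set.Ioc 0 (t : ℝ)) :
      Tendsto (fun n : ℕ => ∫ η, generator b (truncation F n) η ∂(T u.toNNReal ω)) atTop
        (𝓝 (∫ η, generator b F η ∂(T u.toNNReal ω))) :=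
    tendsto_integral_of_hasExpGrowth hΛ hm
      (fun n => measurable_generator hb.measurable hΛ hm (measurable_truncation hFm n)
        (hFl.truncation n)) hgrowth
      (fun η => tendsto_nhds_of_eventually_eq (generator_truncation_eventuallyEq b hΛ hy hF η))
      (hM.ne_top (hle hu) ω)
  obtain ⟨hii, hlim⟩ := tendsto_intervalIntegral_of_norm_le t.coe_nonneg
    (fun n => (hdynkin n).1) (fun n u hu => hM.norm_integral_le (hgrowth n) (hle hu) ω) hlim_right
  exact ⟨hii, tendsto_nhds_unique hlim_left (hlim.congr fun n => (hdynkin n).2.symm)⟩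

theorem IsBirthDeathSemigroup.enorm_integral_sub_le_of_hasExpGrowth [NeZero d]
    (hT : IsBirthDeathSemigroup b T) (hb : IsBoundedRate b c) (hΛ : IsBounded Λ)
    (hm : MeasurableSet Λ) (hy : 1 ≤ y) (hM : MomentBound T Λ (2 * y) ε) {F : Config d → ℝ}
    (hFm : Measurable F) (hFl : IsLocalOn Λ F) (hF : HasExpGrowth Λ a y F) (ω : Config d)
    {t : ℝ≥0} (ht : t ≤ ε) :
    ‖∫ η, F η ∂(T t ω) - F ω‖ₑ ≤
      t * (2 * weightConst c Λ a y * ((2 * y : ℝ≥0) : ℝ≥0∞) ^ count Λ ω) := by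
  rw [(hT.dynkin_of_hasExpGrowth hb hΛ hm hy hM hFm hFl hF ω ht).2,
    intervalIntegral.integral_of_le t.coe_nonneg]
  exact ((enorm_integral_le_lintegral_enorm _).trans
    (lintegral_mono fun u => enorm_integral_le_lintegral_enorm _)).trans
    (setLIntegral_Ioc_toNNReal_le fun u hu =>
      hM.lintegral_enorm_le (hF.generator hy hb hΛ hFl) (hu.trans ht) ω)

/- Dynkin's formula for `F`, whose integrand is replaced by its value at time `0` at the cost of the
first-order estimate for `generator b F`. -/
theorem IsBirthDeathSemigroup.enorm_integral_sub_sub_generator_le [NeZero d]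
    (hT : IsBirthDeathSemigroup b T) (hb : IsBoundedRate b c) (hΛ : IsBounded Λ)
    (hm : MeasurableSet Λ) (hΛ' : IsBounded Λ') (hm' : MeasurableSet Λ') (hsub : Λ ⊆ Λ')
    (hloc : ∀ x ∈ Λ, IsLocalOn Λ' (b x)) (hy : 1 ≤ y) (hM : MomentBound T Λ (2 * y) ε)
    (hM' : MomentBound T Λ' (2 * (2 * y)) ε) {F : Config d → ℝ} (hFm : Measurable F)
    (hFl : IsLocalOn Λ F) (hF : HasExpGrowth Λ a y F) (ω : Config d) {t : ℝ≥0} (ht : t ≤ ε) :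
    ‖∫ η, F η ∂(T t ω) - F ω - t * generator b F ω‖ₑ ≤
      t * (t * (2 * weightConst c Λ' (weightConst c Λ a y) (2 * y) *
        ((2 * (2 * y) : ℝ≥0) : ℝ≥0∞) ^ count Λ' ω)) := by
  have hy2 : 1 ≤ 2 * y := one_le_two.trans (le_mul_of_one_le_right' hy)
  obtain ⟨hii, heq⟩ := hT.dynkin_of_hasExpGrowth hb hΛ hm hy hM hFm hFl hF ω ht
  have hgm := measurable_generator hb.measurable hΛ hm hFm hFl
  have hgl := isLocalOn_generator hΛ hm hsub hloc hFl
  have hg := (hF.generator hy hb hΛ hFl).mono hΛ' hsub hy2 le_rfl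
  have hconst : (t : ℝ) * generator b F ω = ∫ _ in (0 : ℝ)..t, generator b F ω := by simp
  rw [heq, hconst, ← intervalIntegral.integral_sub hii intervalIntegrable_const,
    intervalIntegral.integral_of_le t.coe_nonneg]
  refine (enorm_integral_le_lintegral_enorm _).trans (setLIntegral_Ioc_toNNReal_le
    (f := fun u => ‖∫ η, generator b F η ∂(T u ω) - generator b F ω‖ₑ) fun u hu => ?_)
  exact (hT.enorm_integral_sub_le_of_hasExpGrowth hb hΛ' hm' hy2 hM' hgm hgl hg ω
    (hu.trans ht)).trans (by gcongr)

end Dynkin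

section Evolution

variable {b : E d → Config d → ℝ} {c : ℝ≥0} {T : ℝ≥0 → Kernel (Config d) (Config d)}
  {Λ Λ' : Set (E d)} {a y ε : ℝ≥0} {μ : Measure (Config d)}

/-- Finiteness of all exponential moments of the number of points in `Λ`. -/
def HasExpMoments (μ : Measure (Config d)) (Λ : Set (E d)) : Prop :=
  ∀ y : ℝ≥0, ∫⁻ η, (y : ℝ≥0∞) ^ count Λ η ∂μ ≠ ∞

theorem HasExpMoments.mono (hμ : HasExpMoments μ Λ') (hΛ' : IsBounded Λ') (hsub : Λ ⊆ Λ') :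
    HasExpMoments μ Λ := fun y => by
  refine ne_top_of_le_ne_top (hμ (max y 1)) (lintegral_mono fun η => ?_)
  calc (y : ℝ≥0∞) ^ count Λ η ≤ ((max y 1 : ℝ≥0) : ℝ≥0∞) ^ count Λ η := by
        gcongr
        exact le_max_left y 1
    _ ≤ ((max y 1 : ℝ≥0) : ℝ≥0∞) ^ count Λ' η :=
        pow_le_pow_right₀ (by exact_mod_cast le_max_right y 1) (count_mono_set hΛ' hsub η)

theorem hasExpMoments_marginal (hΛ : IsBounded Λ) (hm : MeasurableSet Λ) :
    HasExpMoments (marginal μ Λ) Λ ↔ HasExpMoments μ Λ := by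
  refine forall_congr' fun y => ?_
  rw [lintegral_marginal hm μ (measurable_comp_count hΛ hm fun n => (y : ℝ≥0∞) ^ n)]
  simp only [isLocalOn_count Λ _]

theorem IsPoissonComparable.hasExpMoments [NeZero d] {z : ℝ≥0}
    (h : IsPoissonComparable Λ μ a z) (hΛ : IsBounded Λ) (hm : MeasurableSet Λ) :
    HasExpMoments μ Λ := fun y => by
  refine ne_top_of_le_ne_top ?_ (h.le _ (measurable_comp_count hΛ hm fun n => (y : ℝ≥0∞) ^ n))
  have hmul (η : Config d) : a * (z : ℝ≥0∞) ^ count Λ η * (y : ℝ≥0∞) ^ count Λ η =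
      a * ((z * y : ℝ≥0) : ℝ≥0∞) ^ count Λ η := by
    rw [mul_assoc, ← mul_pow, ENNReal.coe_mul]
  simp_rw [hmul]
  rw [lintegral_const_mul' _ _ ENNReal.coe_ne_top]
  exact ENNReal.mul_ne_top ENNReal.coe_ne_top (lintegral_poisson_pow_count_lt_top hΛ hm _).ne

theorem MomentBound.lintegral_bind_ne_top (hM : MomentBound T Λ y ε) (hΛ : IsBounded Λ)
    (hm : MeasurableSet Λ) {t : ℝ≥0} (ht : t ≤ ε) (hμ : HasExpMoments μ Λ) :
    ∫⁻ η, (y : ℝ≥0∞) ^ count Λ η ∂(μ.bind (T t)) ≠ ∞ := by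
  rw [Measure.lintegral_bind (T t).measurable.aemeasurable
    (measurable_comp_count hΛ hm fun n => (y : ℝ≥0∞) ^ n).aemeasurable]
  refine ne_top_of_le_ne_top ?_ (lintegral_mono fun ω => hM t ht ω)
  rw [lintegral_const_mul' _ _ ENNReal.ofNat_ne_top]
  exact ENNReal.mul_ne_top ENNReal.ofNat_ne_top (hμ y)

theorem IsBirthDeathSemigroup.enorm_integral_bind_sub_sub_generator_le [NeZero d]
    (hT : IsBirthDeathSemigroup b T) (hb : IsBoundedRate b c) (hΛ : IsBounded Λ)
    (hm : MeasurableSet Λ) (hΛ' : IsBounded Λ') (hm' : MeasurableSet Λ') (hsub : Λ ⊆ Λ')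
    (hloc : ∀ x ∈ Λ, IsLocalOn Λ' (b x)) (hy : 1 ≤ y) (hM : MomentBound T Λ (2 * y) ε)
    (hM' : MomentBound T Λ' (2 * (2 * y)) ε) {F : Config d → ℝ} (hFm : Measurable F)
    (hFl : IsLocalOn Λ F) (hF : HasExpGrowth Λ a y F) (hFi : Integrable F μ)
    (hgi : Integrable (generator b F) μ) {t : ℝ≥0} (ht : t ≤ ε)
    (hFt : Integrable F (μ.bind (T t))) :
    ‖∫ η, F η ∂(μ.bind (T t)) - ∫ η, F η ∂μ - t * ∫ η, generator b F η ∂μ‖ₑ ≤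
      t * (t * (2 * weightConst c Λ' (weightConst c Λ a y) (2 * y) *
        ∫⁻ ω, ((2 * (2 * y) : ℝ≥0) : ℝ≥0∞) ^ count Λ' ω ∂μ)) := by
  obtain ⟨hTi, hTe⟩ := integral_bind_of_integrable hFt
  have heq : ∫ η, F η ∂(μ.bind (T t)) - ∫ η, F η ∂μ - t * ∫ η, generator b F η ∂μ =
      ∫ ω, (∫ η, F η ∂(T t ω) - F ω - t * generator b F ω) ∂μ := by
    have hTF : Integrable (fun ω => ∫ η, F η ∂(T t ω) - F ω) μ := hTi.sub hFi
    rw [integral_sub hTF (hgi.const_mul _), integral_sub hTi hFi, integral_const_mul, hTe]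
  rw [heq]
  refine (enorm_integral_le_lintegral_enorm _).trans ((lintegral_mono fun ω =>
    hT.enorm_integral_sub_sub_generator_le hb hΛ hm hΛ' hm' hsub hloc hy hM hM' hFm hFl hF ω
      ht).trans_eq ?_)
  rw [lintegral_const_mul' _ _ ENNReal.coe_ne_top, lintegral_const_mul' _ _ ENNReal.coe_ne_top,
    lintegral_const_mul' _ _ (by finiteness)]

theorem IsBirthDeathSemigroup.exists_abs_integral_bind_sub_le [NeZero d]
    (hT : IsBirthDeathSemigroup b T) (hb : IsBoundedRate b c) (hΛ : IsBounded Λ)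
    (hm : MeasurableSet Λ) (hΛ' : IsBounded Λ') (hm' : MeasurableSet Λ') (hsub : Λ ⊆ Λ')
    (hloc : ∀ x ∈ Λ, IsLocalOn Λ' (b x)) (hμ : HasExpMoments μ Λ') (hy : 1 ≤ y)
    {F : Config d → ℝ} (hFm : Measurable F) (hFl : IsLocalOn Λ F) (hF : HasExpGrowth Λ a y F) :
    ∃ ε > (0 : ℝ≥0), ∃ B : ℝ, ∀ t ≤ ε, Integrable F (μ.bind (T t)) ∧
      |∫ η, F η ∂(μ.bind (T t)) - ∫ η, F η ∂μ - t * ∫ η, generator b F η ∂μ| ≤ B * (t : ℝ) ^ 2 := by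
  have hyy2 : y ≤ 2 * y := le_mul_of_one_le_left' one_le_two
  have hy2 : 1 ≤ 2 * y := hy.trans hyy2
  have hμΛ := hμ.mono hΛ' hsub
  obtain ⟨ε₁, hε₁, hM⟩ := hT.exists_momentBound hb hΛ hm hy2
  obtain ⟨ε₂, hε₂, hM'⟩ := hT.exists_momentBound hb hΛ' hm'
    (hy2.trans (le_mul_of_one_le_left' one_le_two) : 1 ≤ 2 * (2 * y))
  set D : ℝ≥0∞ := 2 * weightConst c Λ' (weightConst c Λ a y) (2 * y) *
    ∫⁻ ω, ((2 * (2 * y) : ℝ≥0) : ℝ≥0∞) ^ count Λ' ω ∂μ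
  have hD : D ≠ ∞ := ENNReal.mul_ne_top (by finiteness) (hμ _)
  refine ⟨min ε₁ ε₂, lt_min hε₁ hε₂, D.toReal, fun t ht => ?_⟩
  have hFt : Integrable F (μ.bind (T t)) := (hF.mono hΛ subset_rfl hy hyy2).integrable hFm
    (hM.lintegral_bind_ne_top hΛ hm (ht.trans (min_le_left _ _)) hμΛ)
  have hle : ‖∫ η, F η ∂(μ.bind (T t)) - ∫ η, F η ∂μ - t * ∫ η, generator b F η ∂μ‖ₑ ≤
      t * (t * D) := hT.enorm_integral_bind_sub_sub_generator_le hb hΛ hm hΛ' hm' hsub hloc hy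
    (hM.mono (min_le_left _ _)) (hM'.mono (min_le_right _ _)) hFm hFl hF
    (hF.integrable hFm (hμΛ y)) ((hF.generator hy hb hΛ hFl).integrable
      (measurable_generator hb.measurable hΛ hm hFm hFl) (hμΛ _)) ht hFt
  have hreal := ENNReal.toReal_mono (by finiteness) hle
  rw [toReal_enorm, Real.norm_eq_abs] at hreal
  refine ⟨hFt, hreal.trans_eq ?_⟩
  simp only [ENNReal.toReal_mul, ENNReal.coe_toReal]
  ring

end Evolution

section EntropyEvolution

variable {b : E d → Config d → ℝ} {c : ℝ≥0} {T : ℝ≥0 → Kernel (Config d) (Config d)}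
  {Λ : Set (E d)} {μ : Measure (Config d)}

theorem IsBirthDeathSemigroup.isProbabilityMeasure_bind (hT : IsBirthDeathSemigroup b T)
    [IsProbabilityMeasure μ] (t : ℝ≥0) : IsProbabilityMeasure (μ.bind (T t)) :=
  have : IsMarkovKernel (T t) := ⟨hT.isProbabilityMeasure t⟩
  inferInstance

theorem isProbabilityMeasure_marginal (hm : MeasurableSet Λ) (μ : Measure (Config d))
    [IsProbabilityMeasure μ] : IsProbabilityMeasure (marginal μ Λ) :=
  Measure.isProbabilityMeasure_map (measurable_restrict hm).aemeasurable

theorem IsBirthDeathSemigroup.exists_localEntropy_bind_le [NeZero d]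
    (hT : IsBirthDeathSemigroup b T) (hb : IsBoundedRate b c) (hΛ : IsBounded Λ)
    (hm : MeasurableSet Λ) [IsProbabilityMeasure μ] {a z : ℝ≥0}
    (hμ : IsPoissonComparable Λ (marginal μ Λ) a z) :
    ∃ ε > (0 : ℝ≥0), ∃ D : ℝ≥0, ∀ t ≤ ε,
      marginal (μ.bind (T t)) Λ ≪ marginal μ Λ ∧
      localEntropy Λ (μ.bind (T t)) μ ≤ D * (t : ℝ≥0∞) ^ 2 := by
  obtain ⟨ε, hε, g, y, hbind⟩ := exists_marginal_bind_le_add_setLIntegral hT hb hΛ hm hμ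
  lift (g : ℝ≥0∞) ^ 2 * ∫⁻ η, ((y ^ 2 : ℝ≥0) : ℝ≥0∞) ^ count Λ η ∂(marginal μ Λ) to ℝ≥0
    using ENNReal.mul_ne_top (by finiteness) (hμ.hasExpMoments hΛ hm (y ^ 2)) with D hD
  refine ⟨ε, hε, D, fun t ht => ?_⟩
  have := hT.isProbabilityMeasure_bind (μ := μ) t
  have := isProbabilityMeasure_marginal hm μ
  have := isProbabilityMeasure_marginal hm (μ.bind (T t))
  have hG : Measurable fun η : Config d => (t : ℝ≥0∞) * (g * (y : ℝ≥0∞) ^ count Λ η) :=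
    measurable_comp_count hΛ hm fun n => (t : ℝ≥0∞) * (g * (y : ℝ≥0∞) ^ n)
  obtain ⟨hac, hkl⟩ := klDiv_le_lintegral_sq (m := marginal (μ.bind (T t)) Λ)
    (m₀ := marginal μ Λ) hG
    (fun B hB => by
      rw [lintegral_const_mul' _ _ ENNReal.coe_ne_top]
      exact (hbind t ht B hB).1)
    (fun B hB => by
      rw [lintegral_const_mul' _ _ ENNReal.coe_ne_top]
      exact (hbind t ht B hB).2)
  refine ⟨hac, hkl.trans_eq ?_⟩
  rw [hD, ← lintegral_const_mul' _ _ (by finiteness), ← lintegral_mul_const' _ _ (by finiteness)]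
  refine lintegral_congr fun η => ?_
  push_cast
  ring

end EntropyEvolution

section LogDensity

variable {Λ : Set (E d)} {m n μ ν : Measure (Config d)} {a a' z z' : ℝ≥0}

theorem IsPoissonComparable.absolutelyContinuous_poisson (h : IsPoissonComparable Λ m a z) :
    m ≪ poisson Λ :=
  absolutelyContinuous_of_lintegral_le h.le

theorem IsPoissonComparable.poisson_absolutelyContinuous (h : IsPoissonComparable Λ m a z) :
    poisson Λ ≪ m :=
  absolutelyContinuous_of_lintegral_le h.ge

theorem IsPoissonComparable.absolutelyContinuous (hm : IsPoissonComparable Λ m a z)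
    (hn : IsPoissonComparable Λ n a' z') : m ≪ n :=
  hm.absolutelyContinuous_poisson.trans hn.poisson_absolutelyContinuous

theorem IsPoissonComparable.rnDeriv_le [SigmaFinite m] [SigmaFinite n] (hΛ : IsBounded Λ)
    (hΛm : MeasurableSet Λ) (hm : IsPoissonComparable Λ m a z)
    (hn : IsPoissonComparable Λ n a' z') :
    ∀ᵐ η ∂n, m.rnDeriv n η ≤ (a * a' : ℝ≥0) * ((z * z' : ℝ≥0) : ℝ≥0∞) ^ count Λ η := by
  refine rnDeriv_le_of_lintegral_le fun F hF => ?_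
  have hweight : Measurable fun η : Config d => (a : ℝ≥0∞) * (z : ℝ≥0∞) ^ count Λ η :=
    measurable_comp_count hΛ hΛm fun k => (a : ℝ≥0∞) * (z : ℝ≥0∞) ^ k
  refine ((hm.le F hF).trans (hn.ge _ (hweight.mul hF))).trans_eq (lintegral_congr fun η => ?_)
  push_cast
  ring

theorem measurable_logDensity (hm : MeasurableSet Λ) : Measurable (logDensity Λ μ ν) :=
  Real.measurable_log.comp
    (((Measure.measurable_rnDeriv _ _).comp (measurable_restrict hm)).ennreal_toReal)

theorem isLocalOn_logDensity (Λ : Set (E d)) (μ ν : Measure (Config d)) :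
    IsLocalOn Λ (logDensity Λ μ ν) := fun η => by
  rw [logDensity, logDensity, restrict_restrict, Set.inter_self]

theorem ae_of_ae_marginal (hm : MeasurableSet Λ) {P : Config d → Prop} (hP : IsLocalOn Λ P)
    (h : ∀ᵐ η ∂(marginal μ Λ), P η) : ∀ᵐ η ∂μ, P η := by
  filter_upwards [ae_of_ae_map (measurable_restrict hm).aemeasurable h] with η hη
  rwa [← hP η]

theorem IsPoissonComparable.ae_abs_llr_le [SigmaFinite m] [SigmaFinite n] (hΛ : IsBounded Λ)
    (hΛm : MeasurableSet Λ) (hm : IsPoissonComparable Λ m a z)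
    (hn : IsPoissonComparable Λ n a' z') :
    ∀ᵐ η ∂m, |llr m n η| ≤ (a * a' + z * z' : ℝ≥0) * (2 : ℝ) ^ count Λ η := by
  have hac := hm.absolutelyContinuous hn
  filter_upwards [hac (hm.rnDeriv_le hΛ hΛm hn), hn.rnDeriv_le hΛ hΛm hm,
    Measure.inv_rnDeriv hac] with η hmn hnm hinv
  rw [mul_comm a', mul_comm z', ← hinv, Pi.inv_apply] at hnm
  refine (abs_log_toReal_le (by finiteness) hmn hnm).trans ?_
  have ha : 0 < a * a' := mul_pos (one_pos.trans_le hm.one_le_const)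
    (one_pos.trans_le hn.one_le_const)
  have hz : 0 < z * z' := mul_pos (one_pos.trans_le hm.one_le_base)
    (one_pos.trans_le hn.one_le_base)
  simpa using log_mul_pow_le (NNReal.coe_pos.2 ha) (NNReal.coe_pos.2 hz) (count Λ η)

theorem ae_abs_logDensity_le [IsProbabilityMeasure μ] [IsProbabilityMeasure ν]
    (hΛ : IsBounded Λ) (hΛm : MeasurableSet Λ) (hμ : IsPoissonComparable Λ (marginal μ Λ) a z)
    (hν : IsPoissonComparable Λ (marginal ν Λ) a' z') :
    ∀ᵐ η ∂(poisson Λ),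
      |logDensity Λ μ ν η| ≤ (a * a' + z * z' : ℝ≥0) * (2 : ℝ) ^ count Λ η := by
  have := isProbabilityMeasure_marginal hΛm μ
  have := isProbabilityMeasure_marginal hΛm ν
  refine hμ.poisson_absolutelyContinuous ((ae_map_iff (measurable_restrict hΛm).aemeasurable
    (measurableSet_le (measurable_logDensity hΛm).abs
      (measurable_comp_count hΛ hΛm fun n => _ * (2 : ℝ) ^ n))).2 ?_)
  filter_upwards [ae_of_ae_map (measurable_restrict hΛm).aemeasurable
    (hμ.ae_abs_llr_le hΛ hΛm hν)] with η hη
  rwa [isLocalOn_logDensity Λ μ ν η, isLocalOn_count Λ η] at *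

theorem exists_hasExpGrowth_logDensity_ae_eq [IsProbabilityMeasure μ] [IsProbabilityMeasure ν]
    (hΛ : IsBounded Λ) (hΛm : MeasurableSet Λ) (hμ : IsPoissonComparable Λ (marginal μ Λ) a z)
    (hν : IsPoissonComparable Λ (marginal ν Λ) a' z') :
    ∃ (A : ℝ≥0) (ψ : Config d → ℝ), Measurable ψ ∧ IsLocalOn Λ ψ ∧ HasExpGrowth Λ A 2 ψ ∧
      logDensity Λ μ ν =ᵐ[poisson Λ] ψ := by
  set φ := logDensity Λ μ ν
  set B : Set (Config d) := {η | |φ η| ≤ (a * a' + z * z' : ℝ≥0) * (2 : ℝ) ^ count Λ η}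
  have hφl : IsLocalOn Λ φ := isLocalOn_logDensity Λ μ ν
  have hB : MeasurableSet B := measurableSet_le (measurable_logDensity hΛm).abs
    (measurable_comp_count hΛ hΛm fun n => _ * (2 : ℝ) ^ n)
  refine ⟨a * a' + z * z', B.indicator φ, (measurable_logDensity hΛm).indicator hB, fun η => ?_,
    hasExpGrowth_iff_norm_le.2 fun η => ?_, ?_⟩
  · simp only [B, Set.indicator_apply, Set.mem_ofPred_eq, hφl η, isLocalOn_count Λ η]
  · by_cases hη : η ∈ B
    · rw [Set.indicator_of_mem hη]
      exact hη
    · rw [Set.indicator_of_notMem hη, norm_zero]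
      positivity
  · filter_upwards [ae_abs_logDensity_le hΛ hΛm hμ hν] with η hη
    exact (Set.indicator_of_mem (show η ∈ B from hη) φ).symm

end LogDensity

section Modification

variable {b : E d → Config d → ℝ} {Λ : Set (E d)} {μ : Measure (Config d)} {a z : ℝ≥0}
  {F G : Config d → ℝ}

theorem IsPoissonComparable.ae_domOp_eq_zero [NeZero d] {m : Measure (Config d)}
    (hm : IsPoissonComparable Λ m a z) (c : ℝ≥0) (hΛ : IsBounded Λ) (hΛm : MeasurableSet Λ)
    {D : Config d → ℝ≥0∞} (hD : Measurable D) (h0 : D =ᵐ[poisson Λ] 0) :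
    domOp c hΛ D =ᵐ[m] 0 := by
  have hmeas := measurable_domOp c hΛ hΛm hD
  refine (lintegral_eq_zero_iff hmeas).1 (nonpos_iff_eq_zero.1 ((hm.le _ hmeas).trans_eq ?_))
  rw [lintegral_poisson_domOp c hΛ hΛm (fun k => (a : ℝ≥0∞) * (z : ℝ≥0∞) ^ k) hD]
  refine lintegral_eq_zero_of_ae_eq_zero (h0.mono fun η hη => ?_)
  simp [hη]

theorem IsPoissonComparable.ae_eq_add_remove [NeZero d] (hΛ : IsBounded Λ) (hm : MeasurableSet Λ)
    (hμ : IsPoissonComparable Λ (BirthDeath.marginal μ Λ) a z) (hFm : Measurable F)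
    (hGm : Measurable G) (hF : IsLocalOn Λ F) (hG : IsLocalOn Λ G) (h : F =ᵐ[poisson Λ] G) :
    ∀ᵐ η ∂μ, F η = G η ∧ (∀ᵐ x, F (η.add x) = G (η.add x)) ∧
      ∀ x ∈ η.carrier, F (η.remove x) = G (η.remove x) := by
  set D : Config d → ℝ≥0∞ := fun η => ‖F η - G η‖ₑ
  have hDm : Measurable D := (hFm.sub hGm).enorm
  have hDl : IsLocalOn Λ D := fun η => by simp only [D, hF η, hG η]
  have hD0 (η : Config d) : D η = 0 ↔ F η = G η := enorm_eq_zero.trans sub_eq_zero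
  have hdom := hμ.ae_domOp_eq_zero 1 hΛ hm hDm (h.mono fun η => (hD0 η).2)
  have hFG : IsLocalOn Λ fun η => F η = G η := fun η => by simp only [hF η, hG η]
  have hdoml : IsLocalOn Λ fun η => domOp 1 hΛ D η = 0 := fun η => by
    simp only [isLocalOn_domOp 1 hΛ hm hDl η]
  filter_upwards [ae_of_ae_marginal hm hFG (hμ.absolutelyContinuous_poisson h),
    ae_of_ae_marginal hm hdoml hdom] with η heq hη
  simp only [domOp, add_eq_zero, ENNReal.coe_one, one_mul] at hη
  obtain ⟨⟨hbirth, hdeath⟩, -⟩ := hη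
  refine ⟨heq, ?_, fun x hx => ?_⟩
  · have hI : Measurable fun x => D (η.add x) :=
      hDm.comp (Config.measurable_add.comp measurable_prodMk_left)
    filter_upwards [(ae_restrict_iff' hm).1 ((lintegral_eq_zero_iff hI).1 hbirth)] with x hx
    by_cases hxΛ : x ∈ Λ
    · exact (hD0 _).1 (hx hxΛ)
    · rw [hF.add_of_notMem hxΛ, hG.add_of_notMem hxΛ, heq]
  · by_cases hxΛ : x ∈ Λ
    · exact (hD0 _).1 (Finset.sum_eq_zero_iff.1 hdeath x (mem_points.2 ⟨hx, hxΛ⟩))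
    · rw [hF.remove_of_notMem hxΛ, hG.remove_of_notMem hxΛ, heq]

theorem birthTerm_ae_eq {η : Config d} (h : F η = G η)
    (hadd : ∀ᵐ x, F (η.add x) = G (η.add x)) :
    birthTerm b F η =ᵐ[volume] birthTerm b G η := by
  filter_upwards [hadd] with x hx
  rw [birthTerm, birthTerm, hx, h]

theorem generator_congr {η : Config d} (h : F η = G η)
    (hadd : ∀ᵐ x, F (η.add x) = G (η.add x))
    (hremove : ∀ x ∈ η.carrier, F (η.remove x) = G (η.remove x)) :
    generator b F η = generator b G η := by
  rw [generator, generator, integral_congr_ae (birthTerm_ae_eq h hadd)]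
  congr 1
  exact tsum_congr fun x => by rw [hremove x.1 x.2, h]

theorem IsPoissonComparable.generator_ae_eq [NeZero d] (b : E d → Config d → ℝ)
    (hΛ : IsBounded Λ) (hm : MeasurableSet Λ)
    (hμ : IsPoissonComparable Λ (BirthDeath.marginal μ Λ) a z) (hFm : Measurable F)
    (hGm : Measurable G) (hF : IsLocalOn Λ F) (hG : IsLocalOn Λ G) (h : F =ᵐ[poisson Λ] G) :
    (∀ᵐ η ∂μ, birthTerm b F η =ᵐ[volume] birthTerm b G η) ∧
      BirthDeath.generator b F =ᵐ[μ] BirthDeath.generator b G := by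
  have hae := hμ.ae_eq_add_remove hΛ hm hFm hGm hF hG h
  exact ⟨hae.mono fun η hη => birthTerm_ae_eq hη.1 hη.2.1,
    hae.mono fun η hη => generator_congr hη.1 hη.2.1 hη.2.2⟩

theorem HasExpGrowth.integrable_birthTerm {c A y : ℝ≥0} (hF : HasExpGrowth Λ A y F)
    (hy : 1 ≤ y) (hb : IsBoundedRate b c) (hΛ : IsBounded Λ) (hFm : Measurable F)
    (hFl : IsLocalOn Λ F) (η : Config d) : Integrable (birthTerm b F η) := by
  have hbm : Measurable (birthTerm b F η) :=
    (hb.measurable.comp measurable_prodMk_left).mul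
      ((hFm.comp (Config.measurable_add.comp measurable_prodMk_left)).sub measurable_const)
  have hsupp : Function.support (birthTerm b F η) ⊆ Λ := fun x hx => by
    by_contra hxΛ
    exact hx (by rw [birthTerm, hFl.add_of_notMem hxΛ, sub_self, mul_zero])
  have hbound {ξ : Config d} (hξ : count Λ ξ ≤ count Λ η + 1) :
      |F ξ| ≤ A * (y : ℝ) ^ (count Λ η + 1) := by
    refine (hasExpGrowth_iff_norm_le.1 hF ξ).trans ?_
    gcongr
  rw [← integrableOn_iff_integrable_of_support_subset hsupp]
  refine Measure.integrableOn_of_bounded (M := c * (2 * (A * (y : ℝ) ^ (count Λ η + 1))))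
    hΛ.measure_lt_top.ne hbm.aestronglyMeasurable (Eventually.of_forall fun x => ?_)
  have hcount : count Λ (η.add x) ≤ count Λ η + 1 := by
    rw [count_add hΛ]
    split_ifs <;> omega
  rw [birthTerm, Real.norm_eq_abs, abs_mul, abs_of_nonneg (hb.nonneg x η), two_mul]
  gcongr
  · exact hb.le x η
  · exact (abs_sub _ _).trans (add_le_add (hbound hcount) (hbound (Nat.le_succ _)))

end Modification

section EntropyProduction

open InformationTheory

variable {b : E d → Config d → ℝ} {c : ℝ≥0} {T : ℝ≥0 → Kernel (Config d) (Config d)}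
  {Λ Λ' : Set (E d)} {ρ μ ν : Measure (Config d)} {a a' z z' : ℝ≥0}

theorem toReal_localEntropy_eq_add [IsProbabilityMeasure ρ] [IsProbabilityMeasure μ]
    [IsProbabilityMeasure ν] (hm : MeasurableSet Λ) (hρ : marginal ρ Λ ≪ marginal μ Λ)
    (hμ : marginal μ Λ ≪ marginal ν Λ) (hkl : localEntropy Λ ρ μ ≠ ∞)
    (hint : Integrable (logDensity Λ μ ν) ρ) :
    localEntropy Λ ρ ν ≠ ∞ ∧ (localEntropy Λ ρ ν).toReal =
      (localEntropy Λ ρ μ).toReal + ∫ η, logDensity Λ μ ν η ∂ρ := by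
  have := isProbabilityMeasure_marginal hm ρ
  have := isProbabilityMeasure_marginal hm μ
  have := isProbabilityMeasure_marginal hm ν
  have hr := (measurable_restrict hm).aemeasurable (μ := ρ)
  have hs : AEStronglyMeasurable (llr (marginal μ Λ) (marginal ν Λ)) (ρ.map (restrict Λ)) :=
    (stronglyMeasurable_llr _ _).aestronglyMeasurable
  obtain ⟨hfin, heq⟩ := toReal_klDiv_eq_add hρ hμ hkl ((integrable_map_measure hs hr).2 hint)
  refine ⟨hfin, heq.trans ?_⟩
  rw [marginal, integral_map hr hs]
  rfl

theorem integrable_generator_logDensity [NeZero d] [IsProbabilityMeasure μ]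
    [IsProbabilityMeasure ν] (hb : IsBoundedRate b c) (hΛ : IsBounded Λ) (hm : MeasurableSet Λ)
    (hμ : IsPoissonComparable Λ (marginal μ Λ) a z)
    (hν : IsPoissonComparable Λ (marginal ν Λ) a' z') :
    (∀ᵐ η ∂μ, Integrable (birthTerm b (logDensity Λ μ ν) η)) ∧
      Integrable (generator b (logDensity Λ μ ν)) μ := by
  obtain ⟨A, ψ, hψm, hψl, hψ, heq⟩ := exists_hasExpGrowth_logDensity_ae_eq hΛ hm hμ hν
  obtain ⟨hbirth, hgen⟩ := hμ.generator_ae_eq b hΛ hm (measurable_logDensity hm) hψm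
    (isLocalOn_logDensity Λ μ ν) hψl heq
  have hmom := (hasExpMoments_marginal hΛ hm).1 (hμ.hasExpMoments hΛ hm)
  exact ⟨hbirth.mono fun η hη =>
      (hψ.integrable_birthTerm one_le_two hb hΛ hψm hψl η).congr hη.symm,
    ((hψ.generator one_le_two hb hΛ hψl).integrable
      (measurable_generator hb.measurable hΛ hm hψm hψl) (hmom _)).congr hgen.symm⟩

theorem exists_abs_integral_logDensity_bind_sub_le [NeZero d] [IsProbabilityMeasure μ]
    [IsProbabilityMeasure ν] (hT : IsBirthDeathSemigroup b T) (hb : IsBoundedRate b c)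
    (hΛ : IsBounded Λ) (hm : MeasurableSet Λ) (hΛ' : IsBounded Λ') (hm' : MeasurableSet Λ')
    (hsub : Λ ⊆ Λ') (hloc : ∀ x ∈ Λ, IsLocalOn Λ' (b x)) (hmom : HasExpMoments μ Λ')
    (hμ : IsPoissonComparable Λ (marginal μ Λ) a z)
    (hν : IsPoissonComparable Λ (marginal ν Λ) a' z') :
    ∃ ε > (0 : ℝ≥0), ∃ B : ℝ, ∀ t ≤ ε, marginal (μ.bind (T t)) Λ ≪ marginal μ Λ →
      Integrable (logDensity Λ μ ν) (μ.bind (T t)) ∧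
      |∫ η, logDensity Λ μ ν η ∂(μ.bind (T t)) - ∫ η, logDensity Λ μ ν η ∂μ -
        t * ∫ η, generator b (logDensity Λ μ ν) η ∂μ| ≤ B * (t : ℝ) ^ 2 := by
  obtain ⟨A, ψ, hψm, hψl, hψ, heq⟩ := exists_hasExpGrowth_logDensity_ae_eq hΛ hm hμ hν
  have hφl := isLocalOn_logDensity Λ μ ν
  have hφψ : IsLocalOn Λ fun η => logDensity Λ μ ν η = ψ η := fun η => by
    simp only [hφl η, hψl η]
  have heq_marginal := hμ.absolutelyContinuous_poisson heq
  have hgen := (hμ.generator_ae_eq b hΛ hm (measurable_logDensity hm) hψm hφl hψl heq).2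
  obtain ⟨ε, hε, B, hψt⟩ := hT.exists_abs_integral_bind_sub_le hb hΛ hm hΛ' hm' hsub hloc hmom
    one_le_two hψm hψl hψ
  refine ⟨ε, hε, B, fun t ht hac => ?_⟩
  have heq_bind : logDensity Λ μ ν =ᵐ[μ.bind (T t)] ψ :=
    ae_of_ae_marginal hm hφψ (hac heq_marginal)
  rw [integral_congr_ae heq_bind, integral_congr_ae (ae_of_ae_marginal hm hφψ heq_marginal),
    integral_congr_ae hgen]
  exact ⟨(hψt t ht).1.congr heq_bind.symm, (hψt t ht).2⟩

theorem exists_abs_toReal_localEntropy_sub_le [NeZero d] [IsProbabilityMeasure μ]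
    [IsProbabilityMeasure ν] (hT : IsBirthDeathSemigroup b T) (hb : IsBoundedRate b c)
    (hΛ : IsBounded Λ) (hm : MeasurableSet Λ) (hΛ' : IsBounded Λ') (hm' : MeasurableSet Λ')
    (hsub : Λ ⊆ Λ') (hloc : ∀ x ∈ Λ, IsLocalOn Λ' (b x)) (hmom : HasExpMoments μ Λ')
    (hμ : IsPoissonComparable Λ (marginal μ Λ) a z)
    (hν : IsPoissonComparable Λ (marginal ν Λ) a' z') :
    ∃ ε > (0 : ℝ≥0), ∃ B : ℝ, ∀ t ≤ ε, localEntropy Λ (μ.bind (T t)) ν ≠ ∞ ∧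
      |(localEntropy Λ (μ.bind (T t)) ν).toReal - ∫ η, logDensity Λ μ ν η ∂μ -
        t * ∫ η, generator b (logDensity Λ μ ν) η ∂μ| ≤ B * (t : ℝ) ^ 2 := by
  obtain ⟨ε₁, hε₁, D, hself⟩ := hT.exists_localEntropy_bind_le hb hΛ hm hμ
  obtain ⟨ε₂, hε₂, B, hlog⟩ := exists_abs_integral_logDensity_bind_sub_le hT hb hΛ hm hΛ' hm'
    hsub hloc hmom hμ hν
  refine ⟨min ε₁ ε₂, lt_min hε₁ hε₂, D + B, fun t ht => ?_⟩
  obtain ⟨hac, hkl⟩ := hself t (ht.trans (min_le_left _ _))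
  obtain ⟨hint, hbound⟩ := hlog t (ht.trans (min_le_right _ _)) hac
  have hDt : (D : ℝ≥0∞) * (t : ℝ≥0∞) ^ 2 ≠ ∞ := by finiteness
  have hkl_real : (localEntropy Λ (μ.bind (T t)) μ).toReal ≤ D * (t : ℝ) ^ 2 := by
    simpa using ENNReal.toReal_mono hDt hkl
  have := hT.isProbabilityMeasure_bind (μ := μ) t
  obtain ⟨hfin, hchain⟩ := toReal_localEntropy_eq_add hm hac (hμ.absolutelyContinuous hν)
    (ne_top_of_le_ne_top hDt hkl) hint
  refine ⟨hfin, ?_⟩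
  rw [hchain, add_sub_assoc, add_sub_assoc, add_mul]
  refine (abs_add_le _ _).trans (add_le_add ?_ hbound)
  rwa [abs_of_nonneg ENNReal.toReal_nonneg]

theorem IsAdmissible.exists_isBoundedRate {H : Finset (E d) → ℝ} (hH : IsAdmissible H) :
    ∃ c : ℝ≥0, IsBoundedRate (birthRate H) c :=
  (exists_birthRate_le hH).imp fun _ hc =>
    ⟨measurable_birthRate hH, fun x η => (birthRate_pos x η).le, hc⟩

theorem IsAdmissible.exists_isLocalOn_birthRate {H : Finset (E d) → ℝ} (hH : IsAdmissible H)
    (hΛ : IsBounded Λ) :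
    ∃ Λ' : Set (E d), IsBounded Λ' ∧ MeasurableSet Λ' ∧ Λ ⊆ Λ' ∧
      ∀ x ∈ Λ, IsLocalOn Λ' (birthRate H x) := by
  obtain ⟨R, hloc⟩ := exists_birthRate_restrict hH
  exact ⟨Metric.cthickening R Λ, hΛ.cthickening, Metric.isClosed_cthickening.measurableSet,
    Metric.self_subset_cthickening Λ, hloc Λ⟩

theorem IsRegular.hasExpMoments [NeZero d] [IsProbabilityMeasure μ] (hμ : IsRegular μ)
    (hΛ : IsBounded Λ) (hm : MeasurableSet Λ) : HasExpMoments μ Λ := by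
  obtain ⟨a, z, hcomp⟩ := hμ.exists_isPoissonComparable hΛ hm
  exact (hasExpMoments_marginal hΛ hm).1 (hcomp.hasExpMoments hΛ hm)

end EntropyProduction

end BirthDeath

open BirthDeath in
theorem mainTheorem3_general {d : ℕ} [NeZero d] {c : ℝ≥0}
    {b : E d → Config d → ℝ} (hb : IsBoundedRate b c)
    {T : ℝ≥0 → Kernel (Config d) (Config d)}
    (hT : IsBirthDeathSemigroup b T) {μ ν : Measure (Config d)}
    [IsProbabilityMeasure μ] [IsProbabilityMeasure ν] {Λ Λ' : Set (E d)}
    (hΛ : Bornology.IsBounded Λ) (hΛm : MeasurableSet Λ) (hΛ' : Bornology.IsBounded Λ')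
    (hΛm' : MeasurableSet Λ') (hsub : Λ ⊆ Λ')
    (hloc : ∀ x ∈ Λ, IsLocalOn Λ' (b x)) (hmom : HasExpMoments μ Λ')
    {a a' z z' : ℝ≥0}
    (hμ : IsPoissonComparable Λ (marginal μ Λ) a z)
    (hν : IsPoissonComparable Λ (marginal ν Λ) a' z') :
    (marginal μ Λ ≪ marginal ν Λ ∧
      marginal ν Λ ≪ marginal μ Λ) ∧
    (∀ᵐ η ∂μ, Integrable (birthTerm b (logDensity Λ μ ν) η)) ∧
    Integrable (generator b (logDensity Λ μ ν)) μ ∧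
    (∀ᶠ t in 𝓝[≥] (0 : ℝ), localEntropy Λ (evolve μ T t) ν ≠ ∞) ∧
    HasDerivWithinAt
      (fun t : ℝ => (localEntropy Λ (evolve μ T t) ν).toReal)
      (∫ η, generator b (logDensity Λ μ ν) η ∂μ) (Set.Ici 0) 0 := by
  obtain ⟨hbirth, hgen⟩ := integrable_generator_logDensity hb hΛ hΛm hμ hν
  obtain ⟨ε, hε, B, hexpand⟩ := exists_abs_toReal_localEntropy_sub_le hT hb hΛ hΛm hΛ'
    hΛm' hsub hloc hmom hμ hν
  have hsmall {t : ℝ} (ht : t ≤ ε) : t.toNNReal ≤ ε := Real.toNNReal_le_iff_le_coe.2 ht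
  refine ⟨⟨hμ.absolutelyContinuous hν, hν.absolutelyContinuous hμ⟩, hbirth, hgen, ?_, ?_⟩
  · filter_upwards [Icc_mem_nhdsGE (NNReal.coe_pos.2 hε)] with t ht
    exact (hexpand _ (hsmall ht.2)).1
  · refine hasDerivWithinAt_of_abs_sub_le (NNReal.coe_pos.2 hε) (B := B)
      (a := ∫ η, logDensity Λ μ ν η ∂μ) fun t ht₀ ht => ?_
    simpa only [evolve, Real.coe_toNNReal t ht₀] using (hexpand _ (hsmall ht)).2

theorem mainTheorem3 {d : ℕ} (hd : 1 ≤ d)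
    (H : Finset (BirthDeath.E d) → ℝ) (hH : BirthDeath.IsAdmissible H)
    (T : ℝ≥0 → Kernel (BirthDeath.Config d) (BirthDeath.Config d))
    (hT : BirthDeath.IsBirthDeathSemigroup (BirthDeath.birthRate H) T)
    (ν : Measure (BirthDeath.Config d)) (hν : BirthDeath.IsGibbs H ν)
    (μ : Measure (BirthDeath.Config d)) [IsProbabilityMeasure μ] (hμ : BirthDeath.IsRegular μ)
    (Λ : Set (BirthDeath.E d)) (hΛ : Bornology.IsBounded Λ) (hΛm : MeasurableSet Λ) :
    -- the density `dμ_Λ/dν_Λ` exists and is positive and finite almost everywhere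
    (BirthDeath.marginal μ Λ ≪ BirthDeath.marginal ν Λ ∧
      BirthDeath.marginal ν Λ ≪ BirthDeath.marginal μ Λ) ∧
    -- the right-hand side `μ[𝓛 log (dμ_Λ/dν_Λ)]` is well defined
    (∀ᵐ η ∂μ, Integrable
      (BirthDeath.birthTerm (BirthDeath.birthRate H) (BirthDeath.logDensity Λ μ ν) η)) ∧
    Integrable
      (BirthDeath.generator (BirthDeath.birthRate H) (BirthDeath.logDensity Λ μ ν)) μ ∧
    -- the local relative entropy is finite for small times
    (∀ᶠ t in 𝓝[≥] (0 : ℝ), BirthDeath.localEntropy Λ (BirthDeath.evolve μ T t) ν ≠ ∞) ∧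
    -- and its (one-sided) derivative at time `0` is the right-hand side
    HasDerivWithinAt
      (fun t : ℝ => (BirthDeath.localEntropy Λ (BirthDeath.evolve μ T t) ν).toReal)
      (∫ η, BirthDeath.generator (BirthDeath.birthRate H) (BirthDeath.logDensity Λ μ ν) η ∂μ)
      (Set.Ici 0) 0 := by
  have : NeZero d := ⟨by omega⟩
  have := hν.isProbabilityMeasure
  obtain ⟨c, hb⟩ := hH.exists_isBoundedRate
  obtain ⟨Λ', hΛ', hΛm', hsub, hloc⟩ := hH.exists_isLocalOn_birthRate hΛ
  obtain ⟨a, z, hμΛ⟩ := hμ.exists_isPoissonComparable hΛ hΛm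
  obtain ⟨a', z', hνΛ⟩ := hν.exists_isPoissonComparable hH hΛ hΛm
  exact mainTheorem3_general hb hT hΛ hΛm hΛ' hΛm' hsub hloc (hμ.hasExpMoments hΛ' hΛm') hμΛ hνΛ
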